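/- Let $\mathbb R^2\times\mathbb R_+$ be spacetime with points $\xi=(x,y,t)$, $t>0$, and height function $h(x,y,t)=t$. Let $L\subset\mathbb R^2\times\mathbb R_+$ be a link, i.e. a finite union of disjoint smoothly embedded closed curves, with an orientation $\zeta$, in general position with respect to $h$: all critical points of $h|_L$ (the horizontal points) are nondegenerate. A positive (resp. negative) interval of $L$ is an open arc of $L$ between two consecutive horizontal points along which $h$ increases (resp. decreases) in the direction of $\zeta$. Choose any subcollection of the positive intervals; let $L^+_{\max}$ be its union and $L^+_{\min}$ the union of the remaining positive intervals. Fix an integer $r\ge 1$ and a real number $\varepsilon_1>0$. Then there exist a tubular neighborhood $\Omega\subset\mathbb R^2\times\mathbb R_+$ of $L$, a smooth diffeomorphism $\Phi_1:\Omega\to\Omega$ with $\|\Phi_1-\mathrm{id}\|_{C^r(\Omega)}<\varepsilon_1$, and a smooth solution $v:\Omega\to\mathbb R$ of the heat equation $\partial_t v=\partial_{xx}v+\partial_{yy}v$ such that, writing $L_1:=\Phi_1(L)$ with the orientation induced by $\zeta$ via $\Phi_1$: (A) The set of spatial critical points $\{\xi\in\Omega:\partial_xv(\xi)=\partial_yv(\xi)=0\}$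 is exactly $L_1$. (B) $L_1$ is again in general position with respect to $h$, and the partition of $L$ descends to $L_1$: each positive interval of $L_1$ meets $\Phi_1(I)$ for exactly one positive interval $I$ of $L$, and for each positive interval $I$ of $L$ the arc $\Phi_1(I)$ meets exactly one positive interval of $L_1$. Let $L^+_{1,\max}$ (resp. $L^+_{1,\min}$) be the union of the positive intervals of $L_1$ that meet $\Phi_1(L^+_{\max})$ (resp. $\Phi_1(L^+_{\min})$). Then, as critical points of $v(\cdot,\cdot,t)$ in the time slice through them, all points of $L^+_{1,\max}$ are nondegenerate local maxima, all points of $L^+_{1,\min}$ are nondegenerate local minima, and all points of the negative intervals of $L_1$ are nondegenerate saddles. (C) (Structural stability.) With $v_x=\partial_xv$, $v_y=\partial_yv$ and $\nabla_3$ the gradient in $(x,y,t)$, the $2\times3$ matrix $\big(\nabla_3v_x(\xi),\nabla_3v_y(\xi)\big)$ has rank $2$ for every $\xi\in L_1$. -/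

import Mathlib

open Set Filter Topology
open scoped ContDiff ENNReal

noncomputable section

/-- Points `ξ = (x, y, t)` of spacetime, with `x = ξ 0`, `y = ξ 1`, `t = ξ 2`. -/
abbrev Spacetime : Type := EuclideanSpace ℝ (Fin 3)

/-- The region `ℝ² × ℝ₊` of positive times. -/
def positiveTimes : Set Spacetime := {ξ | 0 < ξ 2}

/-! ### Oriented links and their positive and negative intervals -/

/-- A finite family of closed curves, given by `2π`-periodic parametrizations, is an oriented smooth
link in `ℝ² × ℝ₊`: each curve is smooth and regular, it is simple, different curves are disjoint,
and all of them lie in positive times. The orientation is that of increasing parameter. -/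
structure IsOrientedLink {m : ℕ} (γ : Fin m → ℝ → Spacetime) : Prop where
  smooth : ∀ i, ContDiff ℝ ∞ (γ i)
  periodic : ∀ i, Function.Periodic (γ i) (2 * Real.pi)
  regular : ∀ i s, deriv (γ i) s ≠ 0
  simple : ∀ i j s s', γ i s = γ j s' → i = j ∧ ∃ n : ℤ, s' = s + n * (2 * Real.pi)
  positive : ∀ i s, γ i s ∈ positiveTimes

/-- The point set of a family of parametrized curves. -/
def linkSet {m : ℕ} (γ : Fin m → ℝ → Spacetime) : Set Spacetime := ⋃ i, range (γ i)

/-- The height `h(x, y, t) = t` along a parametrized curve. -/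
def heightAlong (c : ℝ → Spacetime) : ℝ → ℝ := fun s => c s 2

/-- General position with respect to the height: all critical points of the restriction of the
height to the link are nondegenerate. -/
def InGeneralPosition {m : ℕ} (γ : Fin m → ℝ → Spacetime) : Prop :=
  ∀ i s, deriv (heightAlong (γ i)) s = 0 → deriv (deriv (heightAlong (γ i))) s ≠ 0

/-- The positive intervals: the open arcs between two consecutive horizontal points along which the
height increases in the direction of the orientation. -/
def positiveIntervals {m : ℕ} (γ : Fin m → ℝ → Spacetime) : Set (Set Spacetime) :=
  {I | ∃ i a b, a < b ∧ deriv (heightAlong (γ i)) a = 0 ∧ deriv (heightAlong (γ i)) b = 0 ∧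
    (∀ s ∈ Ioo a b, 0 < deriv (heightAlong (γ i)) s) ∧ I = γ i '' Ioo a b}

/-- The negative intervals: the open arcs between two consecutive horizontal points along which the
height decreases in the direction of the orientation. -/
def negativeIntervals {m : ℕ} (γ : Fin m → ℝ → Spacetime) : Set (Set Spacetime) :=
  {I | ∃ i a b, a < b ∧ deriv (heightAlong (γ i)) a = 0 ∧ deriv (heightAlong (γ i)) b = 0 ∧
    (∀ s ∈ Ioo a b, deriv (heightAlong (γ i)) s < 0) ∧ I = γ i '' Ioo a b}

/-- The image of a family of parametrized curves under a map, with the induced orientation. -/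
def imageLink {m : ℕ} (Φ : Spacetime → Spacetime) (γ : Fin m → ℝ → Spacetime) :
    Fin m → ℝ → Spacetime := fun i s => Φ (γ i s)

/-- The union of the intervals in `J` that overlap the image under `Φ` of some interval in `K`. -/
def overlapUnion (Φ : Spacetime → Spacetime) (K J : Set (Set Spacetime)) : Set Spacetime :=
  ⋃₀ {I' ∈ J | ∃ I ∈ K, (Φ '' I ∩ I').Nonempty}

/-! ### Tubular neighbourhoods, diffeomorphisms and the `C^r` norm -/

/-- `Ω` is a tubular neighbourhood of the link: the disjoint union of the images of smooth open
embeddings `Θ i : 𝕋¹ × 𝔻² → ℝ³`, one for each component, which send the core circle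
`𝕋¹ × {0}` to that component. (The normal bundle of a closed curve in `ℝ³` is trivial.) -/
def IsTubularNeighborhood {m : ℕ} (γ : Fin m → ℝ → Spacetime) (Ω : Set Spacetime) : Prop :=
  ∃ Θ : Fin m → ℝ × EuclideanSpace ℝ (Fin 2) → Spacetime,
    (∀ i, ContDiffOn ℝ ∞ (Θ i) (univ ×ˢ Metric.ball 0 1)) ∧
    (∀ i s, ∀ z ∈ Metric.ball (0 : EuclideanSpace ℝ (Fin 2)) 1,
      Θ i (s + 2 * Real.pi, z) = Θ i (s, z)) ∧
    (∀ i s, Θ i (s, 0) = γ i s) ∧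
    (∀ i s, ∀ z ∈ Metric.ball (0 : EuclideanSpace ℝ (Fin 2)) 1,
      Function.Bijective (fderiv ℝ (Θ i) (s, z))) ∧
    (∀ i j s s', ∀ z ∈ Metric.ball (0 : EuclideanSpace ℝ (Fin 2)) 1,
      ∀ z' ∈ Metric.ball (0 : EuclideanSpace ℝ (Fin 2)) 1, Θ i (s, z) = Θ j (s', z') →
        i = j ∧ z = z' ∧ ∃ n : ℤ, s' = s + n * (2 * Real.pi)) ∧
    Ω = ⋃ i, Θ i '' (univ ×ˢ Metric.ball 0 1)

/-- `Φ` restricts to a smooth diffeomorphism of the open set `Ω` onto itself. -/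
def IsDiffeoOn (Φ : Spacetime → Spacetime) (Ω : Set Spacetime) : Prop :=
  ContDiffOn ℝ ∞ Φ Ω ∧ MapsTo Φ Ω Ω ∧
    ∃ Ψ : Spacetime → Spacetime, ContDiffOn ℝ ∞ Ψ Ω ∧ MapsTo Ψ Ω Ω ∧ InvOn Ψ Φ Ω Ω

/-- The `C^r` norm on the open set `Ω`: the sum over `k ≤ r` of the supremum over `Ω` of the norm of
the `k`-th derivative. -/
def crNorm (r : ℕ) (Ω : Set Spacetime) (F : Spacetime → Spacetime) : ℝ≥0∞ :=
  ∑ k ∈ Finset.range (r + 1), ⨆ ξ ∈ Ω, ‖iteratedFDeriv ℝ k F ξ‖ₑ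

/-! ### The heat equation and spatial critical points -/

/-- The partial derivative in the `i`-th spacetime coordinate. -/
def pderiv (i : Fin 3) (u : Spacetime → ℝ) : Spacetime → ℝ :=
  fun ξ => fderiv ℝ u ξ (EuclideanSpace.single i 1)

/-- `v` is a smooth solution of the heat equation `v_t = v_xx + v_yy` on the open set `Ω`. -/
def IsHeatSolutionOn (v : Spacetime → ℝ) (Ω : Set Spacetime) : Prop :=
  ContDiffOn ℝ ∞ v Ω ∧
    ∀ ξ ∈ Ω, pderiv 2 v ξ = pderiv 0 (pderiv 0 v) ξ + pderiv 1 (pderiv 1 v) ξ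

/-- Spatial critical points: `v_x = v_y = 0`. -/
def IsSpatialCritical (v : Spacetime → ℝ) (ξ : Spacetime) : Prop :=
  pderiv 0 v ξ = 0 ∧ pderiv 1 v ξ = 0

/-- The determinant `v_xx v_yy - v_xy v_yx` of the spatial Hessian. -/
def spatialHessianDet (v : Spacetime → ℝ) (ξ : Spacetime) : ℝ :=
  pderiv 0 (pderiv 0 v) ξ * pderiv 1 (pderiv 1 v) ξ -
    pderiv 1 (pderiv 0 v) ξ * pderiv 0 (pderiv 1 v) ξ

/-- Nondegenerate critical point that is a local maximum of `v` in the time slice through `ξ`. -/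
def IsSpatialMax (v : Spacetime → ℝ) (ξ : Spacetime) : Prop :=
  IsSpatialCritical v ξ ∧ spatialHessianDet v ξ ≠ 0 ∧ IsLocalMaxOn v {η | η 2 = ξ 2} ξ

/-- Nondegenerate critical point that is a local minimum of `v` in the time slice through `ξ`. -/
def IsSpatialMin (v : Spacetime → ℝ) (ξ : Spacetime) : Prop :=
  IsSpatialCritical v ξ ∧ spatialHessianDet v ξ ≠ 0 ∧ IsLocalMinOn v {η | η 2 = ξ 2} ξ

/-- Nondegenerate saddle of `v` in the time slice through `ξ`: the spatial Hessian is indefinite. -/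
def IsSpatialSaddle (v : Spacetime → ℝ) (ξ : Spacetime) : Prop :=
  IsSpatialCritical v ξ ∧ spatialHessianDet v ξ < 0

/-- The `2 × 3` matrix whose rows are the spacetime gradients of `v_x` and `v_y`. -/
def stabilityMatrix (v : Spacetime → ℝ) (ξ : Spacetime) : Matrix (Fin 2) (Fin 3) ℝ :=
  Matrix.of ![fun j => pderiv j (pderiv 0 v) ξ, fun j => pderiv j (pderiv 1 v) ξ]

end

/-! Let f be the height speed of a component, that is, the time coordinate of its velocity. Along a
curve of spatial critical points the velocity is annihilated by ∇v_x and ∇v_y, so ∇v_x × ∇v_y is a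
multiple of it, a positive one when the determinant `jetDet` of the velocity and the two gradients
is positive. The time coordinate of the cross product is the determinant of the spatial Hessian,
which then has the sign of f (`jetDet_mul`): saddles on negative intervals, extrema on positive
ones. Maxima and minima are told apart by the trace of the Hessian, which is v_t by the heat
equation. Positivity of `jetDet` also gives rank 2 and, by the implicit function theorem,
persistence of the critical curve. So what is needed is a heat solution near L whose critical curve
is close to L, with `jetDet` positive and v_t of prescribed sign where f ≥ 0.

Approximate solution. Some direction (a, b, 1) is nowhere tangent to a given component
(`exists_slope_ne`). The lines in this direction through the component sweep out a strip z = 0 which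
is not characteristic, so Cauchy data may be prescribed on it: a function G, which becomes v_t on
the curve, and a function κ, the normal derivative on the curve of the derivative in the slanted
direction. The compatibility condition is that G f has integral zero over a period. By `jet_det_pos`
the determinant is positive once q G G' + f (G'² + κ²) < 0, where q > 0 depends on the curve only.
Where f ≥ 0, G gets the wanted sign and slowly decaying modulus; where f is definitely negative, a
large κ makes any G admissible, which leaves room to change the sign of G, to make it periodic and
to achieve the integral condition (`exists_curve_data`). Expanding in powers of z
(`exists_formal_heatSolution`) gives w with heat operator z ^ K R, for any finite K.

Exact solution. With K = k + 2, subtract ρ² times the heat potential of ρ ^ k φ(z/ρ) R, where φ(x) =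
x ^ (k + 2) for |x| ≤ 1. The error vanishes exactly for |z| ≤ ρ. The source is C^n jointly in ρ and
the point, even at ρ = 0, if k > n (`contDiff_scaledProfile`), so the correction is O(ρ²) with
control of derivatives, and the critical curve becomes a graph of size O(ρ²) over L
(`IsApproxSolution.exists_critical_section`). It therefore stays well inside the tube of radius ρ on
which the equation holds.

Diffeomorphism. In the tube coordinates the core 0 has to be moved to d(s) = O(ρ²) by a
diffeomorphism of a tube of radius of order ρ onto itself. Take a rotation by a small angle, with
factor η, about the centre d/(1 - η): it sends 0 to d, preserves discs about that centre, and has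
the form ζ ↦ η ζ + d, which is C^r-close to the identity with no loss from the thinness of the tube.
If the angle is fixed before ρ, the centre is within ρ/2 of 0 for small ρ. Fibrewise Möbius
transformations show that the tube about the displaced centre is a tubular neighbourhood with core L
(`isTubularNeighborhood_discTube`). The intervals correspond because the height functions are
C¹-close relative to their nondegeneracy (`partition_descends`). -/

/-! ### The heat potential -/

open MeasureTheory Real in
/-- The standard planar Gaussian profile `(4π)⁻¹ exp(-|y|²/4)`. -/
noncomputable def planarGauss (y : ℝ × ℝ) : ℝ :=
  ((4 * π)⁻¹ * Real.exp (-(1 / 4) * y.1 ^ 2)) * Real.exp (-(1 / 4) * y.2 ^ 2)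

section PlanarGauss
open MeasureTheory Real

theorem planarGauss_pos (y : ℝ × ℝ) : 0 < planarGauss y := by
  unfold planarGauss; positivity

theorem contDiff_planarGauss : ContDiff ℝ ∞ planarGauss := by
  unfold planarGauss; fun_prop

theorem integrable_planarGauss : Integrable planarGauss :=
  ((integrable_exp_neg_mul_sq (by norm_num : (0 : ℝ) < 1 / 4)).const_mul _).mul_prod
    (integrable_exp_neg_mul_sq (by norm_num : (0 : ℝ) < 1 / 4))

theorem integral_planarGauss : ∫ y, planarGauss y = 1 := by
  unfold planarGauss
  rw [Measure.volume_eq_prod,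
    integral_prod_mul (fun x : ℝ => (4 * π)⁻¹ * Real.exp (-(1 / 4) * x ^ 2))
    (fun x : ℝ => Real.exp (-(1 / 4) * x ^ 2)), integral_const_mul, integral_gaussian]
  have h : √(π / (1 / 4)) * √(π / (1 / 4)) = 4 * π := by
    rw [Real.mul_self_sqrt (by positivity)]; ring
  rw [mul_assoc, h]
  field_simp

theorem integrable_fst_mul_planarGauss : Integrable (fun y : ℝ × ℝ => y.1 * planarGauss y) := by
  have := ((integrable_mul_exp_neg_mul_sq (by norm_num : (0 : ℝ) < 1 / 4)).const_mul
    (4 * π)⁻¹).mul_prod (integrable_exp_neg_mul_sq (by norm_num : (0 : ℝ) < 1 / 4))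
  refine this.congr (ae_of_all _ fun y => ?_)
  simp only [planarGauss]; ring

theorem integrable_snd_mul_planarGauss : Integrable (fun y : ℝ × ℝ => y.2 * planarGauss y) := by
  have := ((integrable_exp_neg_mul_sq (by norm_num : (0 : ℝ) < 1 / 4)).const_mul
    (4 * π)⁻¹).mul_prod (integrable_mul_exp_neg_mul_sq (by norm_num : (0 : ℝ) < 1 / 4))
  refine this.congr (ae_of_all _ fun y => ?_)
  simp only [planarGauss]; ring

theorem hasFDerivAt_planarGauss (y : ℝ × ℝ) : HasFDerivAt planarGauss
    (planarGauss y • (-(1 / 2 * y.1) • ContinuousLinearMap.fst ℝ ℝ ℝ -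
      (1 / 2 * y.2) • ContinuousLinearMap.snd ℝ ℝ ℝ)) y := by
  have h1 : HasFDerivAt (fun y : ℝ × ℝ => Real.exp (-(1 / 4) * y.1 ^ 2)) _ y :=
    (((hasFDerivAt_fst (𝕜 := ℝ) (E := ℝ) (F := ℝ) (p := y)).pow 2).const_mul (-(1 / 4))).exp
  have h2 : HasFDerivAt (fun y : ℝ × ℝ => Real.exp (-(1 / 4) * y.2 ^ 2)) _ y :=
    (((hasFDerivAt_snd (𝕜 := ℝ) (E := ℝ) (F := ℝ) (p := y)).pow 2).const_mul (-(1 / 4))).exp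
  refine ((h1.const_mul (4 * π)⁻¹).mul h2).congr_fderiv ?_
  ext <;> simp [planarGauss] <;> ring

/-- The heat kernel of the plane, with the time coordinate first. -/
noncomputable def heatKernel (p : ℝ × (ℝ × ℝ)) : ℝ :=
  if 0 < p.1 then (4 * π * p.1)⁻¹ * Real.exp (-(p.2.1 ^ 2 + p.2.2 ^ 2) / (4 * p.1)) else 0

theorem measurable_heatKernel : Measurable heatKernel := by
  unfold heatKernel
  refine Measurable.ite (measurableSet_lt measurable_const measurable_fst) ?_ measurable_const
  fun_prop

theorem heatKernel_nonneg (p : ℝ × (ℝ × ℝ)) : 0 ≤ heatKernel p := by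
  unfold heatKernel; split_ifs with h
  · positivity
  · exact le_rfl

theorem heatKernel_smul {t : ℝ} (ht : 0 < t) (y : ℝ × ℝ) :
    heatKernel (t, √t • y) = t⁻¹ * planarGauss y := by
  have h : (√t) ^ 2 = t := Real.sq_sqrt ht.le
  simp only [heatKernel, ht, if_true, planarGauss, Prod.smul_fst, Prod.smul_snd, smul_eq_mul,
    mul_pow, h]
  have he : Real.exp (-(t * y.1 ^ 2 + t * y.2 ^ 2) / (4 * t)) =
      Real.exp (-(1 / 4) * y.1 ^ 2) * Real.exp (-(1 / 4) * y.2 ^ 2) := by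
    rw [← Real.exp_add]
    congr 1
    field_simp
    ring
  rw [he, mul_inv]
  ring

theorem heatKernel_eq_planarGauss {t : ℝ} (ht : 0 < t) (x : ℝ × ℝ) :
    heatKernel (t, x) = t⁻¹ * planarGauss ((√t)⁻¹ • x) := by
  rw [← heatKernel_smul ht, smul_smul, mul_inv_cancel₀ (by positivity), one_smul]

theorem integrable_heatKernel_slice (t : ℝ) : Integrable (fun x => heatKernel (t, x)) := by
  rcases le_or_gt t 0 with h | h
  · simp [heatKernel, not_lt.2 h]
  · simp_rw [heatKernel_eq_planarGauss h]
    exact (integrable_planarGauss.comp_smul (by positivity)).const_mul _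

/-- Parabolic rescaling: the area factor t cancels the t⁻¹ of the kernel. The singular kernel is
replaced by a fixed Gaussian, and the remaining dependence on √t is regular down to t = 0. -/
theorem integral_heatKernel_mul {t : ℝ} (ht : 0 < t) (f : ℝ × ℝ → ℝ) :
    ∫ x, heatKernel (t, x) * f x = ∫ y, planarGauss y * f (√t • y) := by
  have h := Measure.integral_comp_smul_of_nonneg volume
    (fun x : ℝ × ℝ => heatKernel (t, x) * f x) (√t) (hR := by positivity)
  have h2 : (√t) ^ 2 = t := Real.sq_sqrt ht.le
  simp only [heatKernel_smul ht, Module.finrank_prod, Module.finrank_self, smul_eq_mul] at h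
  norm_num [h2] at h
  simp_rw [mul_assoc, integral_const_mul] at h
  exact (mul_left_cancel₀ (by positivity) h).symm

theorem integral_heatKernel {t : ℝ} (ht : 0 < t) : ∫ x, heatKernel (t, x) = 1 := by
  simpa [integral_planarGauss] using integral_heatKernel_mul ht (fun _ => 1)

/-- Each slice has mass 1 for t > 0 and 0 otherwise, so the total mass below time T is finite in
spite of the singularity at the origin. -/
theorem integrableOn_heatKernel (T : ℝ) : IntegrableOn heatKernel (Iio T ×ˢ univ) := by
  rw [IntegrableOn, Measure.volume_eq_prod, ← Measure.prod_restrict, Measure.restrict_univ,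
    integrable_prod_iff measurable_heatKernel.aestronglyMeasurable]
  refine ⟨ae_of_all _ fun t => integrable_heatKernel_slice t, ?_⟩
  have : (fun t : ℝ => ∫ x, ‖heatKernel (t, x)‖) = (Ioi 0).indicator 1 := by
    ext t
    simp_rw [Real.norm_of_nonneg (heatKernel_nonneg _)]
    rcases le_or_gt t 0 with h | h
    · simp [heatKernel, not_lt.2 h]
    · simp [integral_heatKernel h, h]
  rw [this]
  change IntegrableOn _ _ volume
  rw [integrableOn_indicator_iff measurableSet_Ioi, Ioi_inter_Iio]
  exact integrableOn_const (by simp)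

theorem locallyIntegrable_heatKernel : LocallyIntegrable heatKernel := by
  intro p
  refine ⟨Iio (p.1 + 1) ×ˢ univ, prod_mem_nhds (Iio_mem_nhds (by linarith)) univ_mem,
    integrableOn_heatKernel _⟩

end PlanarGauss

/-! ### The heat kernel as a fundamental solution -/

section HeatPotential
open MeasureTheory Real

theorem HasCompactSupport.exists_norm_fderiv_le {E F : Type*} [NormedAddCommGroup E]
    [NormedSpace ℝ E] [NormedAddCommGroup F] [NormedSpace ℝ F] {G : E → F}
    (hc : HasCompactSupport G) (hG : ContDiff ℝ 1 G) : ∃ C, 0 ≤ C ∧ ∀ p, ‖fderiv ℝ G p‖ ≤ C := by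
  obtain ⟨C, hC⟩ := (hc.fderiv ℝ).exists_bound_of_continuous (hG.continuous_fderiv one_ne_zero)
  exact ⟨C, (norm_nonneg _).trans (hC 0), hC⟩

/-- The Gaussian mean of `G` at time `σ²` over the plane, at scale `σ`. -/
noncomputable def gaussMean (G : ℝ × (ℝ × ℝ) → ℝ) (σ : ℝ) : ℝ :=
  ∫ y, planarGauss y * G (σ ^ 2, σ • y)

theorem integrable_planarGauss_mul {f : ℝ × ℝ → ℝ} (hf : Continuous f) {C : ℝ}
    (hC : ∀ y, ‖f y‖ ≤ C) : Integrable (fun y => planarGauss y * f y) :=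
  integrable_planarGauss.mul_bdd hf.aestronglyMeasurable (ae_of_all _ hC)

theorem integrable_norm_mul_planarGauss : Integrable (fun y : ℝ × ℝ => ‖y‖ * planarGauss y) := by
  refine (integrable_fst_mul_planarGauss.norm.add integrable_snd_mul_planarGauss.norm).mono'
    (continuous_norm.mul contDiff_planarGauss.continuous).aestronglyMeasurable
    (ae_of_all _ fun y => ?_)
  have h0 := (planarGauss_pos y).le
  have h : ‖y‖ ≤ ‖y.1‖ + ‖y.2‖ := max_le (by simp) (by simp)
  simp only [norm_mul, norm_norm, Pi.add_apply, Real.norm_of_nonneg h0]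
  nlinarith

/-- The point (σ², σ y) moves with velocity (2σ, y), so the derivative of the integrand is at most a
constant plus a multiple of ‖y‖, times the Gaussian; this is integrable and locally uniform in σ. -/
theorem hasDerivAt_gaussMean {G : ℝ × (ℝ × ℝ) → ℝ} (hG : ContDiff ℝ 1 G)
    (hc : HasCompactSupport G) (σ : ℝ) :
    HasDerivAt (gaussMean G)
      (∫ y, planarGauss y * fderiv ℝ G (σ ^ 2, σ • y) (2 * σ, y)) σ := by
  obtain ⟨C, hC0, hC⟩ := hc.exists_norm_fderiv_le hG
  obtain ⟨C', hC'⟩ := hc.exists_bound_of_continuous hG.continuous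
  have hcont : ∀ τ : ℝ, Continuous fun y : ℝ × ℝ => ((τ ^ 2, τ • y) : ℝ × (ℝ × ℝ)) := by
    intro τ; fun_prop
  have hg := contDiff_planarGauss.continuous
  have hfd := hG.continuous_fderiv one_ne_zero
  refine (hasDerivAt_integral_of_dominated_loc_of_deriv_le
    (F := fun σ y => planarGauss y * G (σ ^ 2, σ • y))
    (F' := fun σ y => planarGauss y * fderiv ℝ G (σ ^ 2, σ • y) (2 * σ, y))
    (bound := fun y => (C * (2 * (|σ| + 1))) * planarGauss y + C * (‖y‖ * planarGauss y))
    (Metric.ball_mem_nhds σ one_pos) ?_ ?_ ?_ ?_ ?_ ?_).2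
  · exact .of_forall fun τ => (hg.mul (hG.continuous.comp (hcont τ))).aestronglyMeasurable
  · exact integrable_planarGauss_mul (hG.continuous.comp (hcont σ)) (fun y => hC' _)
  · refine (hg.mul ?_).aestronglyMeasurable
    exact (hfd.comp (hcont σ)).clm_apply (by fun_prop)
  · refine ae_of_all _ fun y τ hτ => ?_
    have h0 := (planarGauss_pos y).le
    rw [norm_mul, Real.norm_of_nonneg h0]
    have h1 : ‖((2 * τ, y) : ℝ × (ℝ × ℝ))‖ ≤ 2 * (|σ| + 1) + ‖y‖ := by
      refine max_le ?_ ?_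
      · rw [norm_mul, Real.norm_ofNat, Real.norm_eq_abs]
        have : |τ| ≤ |σ| + 1 := by
          have := abs_sub_abs_le_abs_sub τ σ
          have h2 : |τ - σ| < 1 := by simpa [Real.dist_eq] using hτ
          linarith
        have := norm_nonneg y
        linarith
      · have := abs_nonneg σ
        simp only
        linarith
    have h2 := (fderiv ℝ G (τ ^ 2, τ • y)).le_of_opNorm_le (hC _) (2 * τ, y)
    have h3 : C * ‖((2 * τ, y) : ℝ × (ℝ × ℝ))‖ ≤ C * (2 * (|σ| + 1) + ‖y‖) :=
      mul_le_mul_of_nonneg_left h1 hC0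
    nlinarith [mul_le_mul_of_nonneg_left (h2.trans h3) h0]
  · exact (integrable_planarGauss.const_mul _).add (integrable_norm_mul_planarGauss.const_mul _)
  · refine ae_of_all _ fun y τ _ => ?_
    have h1 : HasDerivAt (fun τ : ℝ => ((τ ^ 2, τ • y) : ℝ × (ℝ × ℝ))) (2 * τ, y) τ := by
      have ha : HasDerivAt (fun τ : ℝ => τ ^ 2) (2 * τ) τ := by simpa using hasDerivAt_pow 2 τ
      have hb : HasDerivAt (fun τ : ℝ => τ • y) y τ := by
        simpa using (hasDerivAt_id τ).smul_const y
      exact ha.prodMk hb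
    have h2 := (hG.differentiable one_ne_zero (τ ^ 2, τ • y)).hasFDerivAt.comp_hasDerivAt τ h1
    exact h2.const_mul _

/-- Gaussian integration by parts in the direction `v`. -/
theorem integral_planarGauss_mul_fderiv {φ : ℝ × ℝ → ℝ} (hφ : ContDiff ℝ 1 φ) {C C' : ℝ}
    (hC : ∀ y, ‖φ y‖ ≤ C) (hC' : ∀ y, ‖fderiv ℝ φ y‖ ≤ C') (v : ℝ × ℝ) :
    ∫ y, planarGauss y * fderiv ℝ φ y v =
      ∫ y, planarGauss y * ((1 / 2 * (y.1 * v.1 + y.2 * v.2)) * φ y) := by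
  have hd : ∀ y, fderiv ℝ planarGauss y v =
      -(1 / 2 * (y.1 * v.1 + y.2 * v.2)) * planarGauss y := by
    intro y
    rw [(hasFDerivAt_planarGauss y).fderiv]
    simp; ring
  have hfd := (hφ.continuous_fderiv one_ne_zero)
  have key := integral_mul_fderiv_eq_neg_fderiv_mul_of_integrable (μ := volume)
    (f := planarGauss) (g := φ) (v := v) ?_ ?_ ?_ ?_ ?_
  · rw [key, ← integral_neg]
    congr 1 with y
    rw [hd]; ring
  · simp_rw [hd]
    have h1 := ((integrable_fst_mul_planarGauss.const_mul (-(1 / 2) * v.1)).add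
      (integrable_snd_mul_planarGauss.const_mul (-(1 / 2) * v.2))).mul_bdd
      hφ.continuous.aestronglyMeasurable (ae_of_all _ hC)
    refine h1.congr (ae_of_all _ fun y => ?_)
    simp only [Pi.add_apply]; ring
  · refine integrable_planarGauss_mul (C := C' * ‖v‖) (hfd.clm_apply continuous_const) fun y => ?_
    exact (fderiv ℝ φ y).le_of_opNorm_le (hC' y) v
  · exact integrable_planarGauss_mul hφ.continuous hC
  · exact fun y _ => (contDiff_planarGauss.differentiable (by simp)) y
  · exact fun y _ => (hφ.differentiable one_ne_zero) y

/-- The second derivative of `G` in the direction `v`, twice. -/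
noncomputable def dirDeriv2 (G : ℝ × (ℝ × ℝ) → ℝ) (v p : ℝ × (ℝ × ℝ)) : ℝ :=
  fderiv ℝ (fun q => fderiv ℝ G q v) p v

/-- The backward heat operator `∂ₜ + Δ` in the coordinates `(t, (x, y))`. -/
noncomputable def backwardHeat (G : ℝ × (ℝ × ℝ) → ℝ) (p : ℝ × (ℝ × ℝ)) : ℝ :=
  fderiv ℝ G p (1, 0) + (dirDeriv2 G (0, (1, 0)) p + dirDeriv2 G (0, (0, 1)) p)

theorem contDiff_fderiv_dir {E F : Type*} [NormedAddCommGroup E] [NormedSpace ℝ E]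
    [NormedAddCommGroup F] [NormedSpace ℝ F] {G : E → F} {n m : ℕ∞ω} (hG : ContDiff ℝ n G)
    (h : m + 1 ≤ n) (v : E) : ContDiff ℝ m (fun q => fderiv ℝ G q v) :=
  (hG.fderiv_right h).clm_apply contDiff_const

theorem continuous_backwardHeat {G : ℝ × (ℝ × ℝ) → ℝ} (hG : ContDiff ℝ 2 G) :
    Continuous (backwardHeat G) := by
  have h1 := fun v => contDiff_fderiv_dir (m := 1) hG (by norm_num) v
  have h2 := fun v => contDiff_fderiv_dir (m := 0) (h1 v) (by norm_num) v
  exact (h1 _).continuous.add ((h2 _).continuous.add (h2 _).continuous)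

theorem hasCompactSupport_fderiv_dir {E F : Type*} [NormedAddCommGroup E] [NormedSpace ℝ E]
    [NormedAddCommGroup F] [NormedSpace ℝ F] {G : E → F} (hc : HasCompactSupport G) (v : E) :
    HasCompactSupport (fun q => fderiv ℝ G q v) :=
  (hc.fderiv ℝ).comp_left (g := fun L : E →L[ℝ] F => L v) (by simp)

theorem hasCompactSupport_backwardHeat {G : ℝ × (ℝ × ℝ) → ℝ} (hc : HasCompactSupport G) :
    HasCompactSupport (backwardHeat G) := by
  have h1 := fun v => hasCompactSupport_fderiv_dir hc v
  have h2 := fun v => hasCompactSupport_fderiv_dir (h1 v) v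
  exact (h1 _).add ((h2 _).add (h2 _))

/-- The part of the derivative of `G (σ², σ y)` in a fixed spatial direction, integrated. -/
theorem integral_planarGauss_mul_dir {G : ℝ × (ℝ × ℝ) → ℝ} (hG : ContDiff ℝ 2 G)
    (hc : HasCompactSupport G) (σ : ℝ) (v : ℝ × ℝ) :
    ∫ y, planarGauss y * ((1 / 2 * (y.1 * v.1 + y.2 * v.2)) * fderiv ℝ G (σ ^ 2, σ • y) (0, v)) =
      σ * ∫ y, planarGauss y * dirDeriv2 G (0, v) (σ ^ 2, σ • y) := by
  have h1 : ContDiff ℝ 1 (fun q => fderiv ℝ G q (0, v)) :=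
    contDiff_fderiv_dir hG (by norm_num) _
  have hc1 : HasCompactSupport (fun q => fderiv ℝ G q (0, v)) := hasCompactSupport_fderiv_dir hc _
  obtain ⟨C, hC0, hC⟩ := hc1.exists_norm_fderiv_le h1
  obtain ⟨C', hC'⟩ := hc1.exists_bound_of_continuous h1.continuous
  set L : ℝ × ℝ →L[ℝ] ℝ × (ℝ × ℝ) := σ • ContinuousLinearMap.inr ℝ ℝ (ℝ × ℝ) with hL
  have hA : ∀ y : ℝ × ℝ, HasFDerivAt (fun y : ℝ × ℝ => ((σ ^ 2, σ • y) : ℝ × (ℝ × ℝ))) L y := by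
    intro y
    refine ((hasFDerivAt_const (σ ^ 2) y).prodMk ((hasFDerivAt_id y).const_smul σ)).congr_fderiv ?_
    ext <;> simp [hL]
  have hφ : ∀ y : ℝ × ℝ, HasFDerivAt (fun y : ℝ × ℝ => fderiv ℝ G (σ ^ 2, σ • y) (0, v))
      ((fderiv ℝ (fun q => fderiv ℝ G q (0, v)) (σ ^ 2, σ • y)).comp L) y := fun y =>
    ((h1.differentiable one_ne_zero) _).hasFDerivAt.comp y (hA y)
  rw [← integral_planarGauss_mul_fderiv (φ := fun y => fderiv ℝ G (σ ^ 2, σ • y) (0, v)) ?_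
    (fun y => hC' _) (C' := C * ‖L‖) ?_ v, ← integral_const_mul]
  · congr 1 with y
    rw [(hφ y).fderiv]
    have : L v = σ • ((0, v) : ℝ × (ℝ × ℝ)) := by simp [hL]
    rw [ContinuousLinearMap.comp_apply, this, map_smul, dirDeriv2, smul_eq_mul]
    ring
  · exact h1.comp (by fun_prop)
  · intro y
    rw [(hφ y).fderiv]
    exact (ContinuousLinearMap.opNorm_comp_le _ _).trans
      (mul_le_mul_of_nonneg_right (hC _) (norm_nonneg _))

/-- The derivative along (σ², σ y) is 2σ ∂ₜ + y·∇, and Gaussian integration by parts turns y·∇ into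
2σ Δ. Only derivatives of G occur, never those of the kernel. -/
theorem hasDerivAt_gaussMean_sq {G : ℝ × (ℝ × ℝ) → ℝ} (hG : ContDiff ℝ 2 G)
    (hc : HasCompactSupport G) (σ : ℝ) :
    HasDerivAt (gaussMean G) (2 * σ * gaussMean (backwardHeat G) σ) σ := by
  refine (hasDerivAt_gaussMean (hG.of_le (by norm_num)) hc σ).congr_deriv ?_
  have hd := fun v => integral_planarGauss_mul_dir hG hc σ v
  have h1 := fun v => contDiff_fderiv_dir (m := 1) hG (by norm_num) v
  have h2 := fun v => contDiff_fderiv_dir (m := 0) (h1 v) (by norm_num) v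
  have c1 := fun v => hasCompactSupport_fderiv_dir hc v
  have c2 := fun v => hasCompactSupport_fderiv_dir (c1 v) v
  have hcont : Continuous fun y : ℝ × ℝ => ((σ ^ 2, σ • y) : ℝ × (ℝ × ℝ)) := by fun_prop
  have int1 : ∀ f : ℝ × (ℝ × ℝ) → ℝ, Continuous f → HasCompactSupport f →
      Integrable (fun y : ℝ × ℝ => planarGauss y * f (σ ^ 2, σ • y)) := by
    intro f hf hcf
    obtain ⟨C, hC⟩ := hcf.exists_bound_of_continuous hf
    exact integrable_planarGauss_mul (hf.comp hcont) (fun y => hC _)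
  have int2 : ∀ f : ℝ × (ℝ × ℝ) → ℝ, Continuous f → HasCompactSupport f → ∀ v : ℝ × ℝ,
      Integrable (fun y : ℝ × ℝ => planarGauss y *
        ((1 / 2 * (y.1 * v.1 + y.2 * v.2)) * f (σ ^ 2, σ • y))) := by
    intro f hf hcf v
    obtain ⟨C, hC⟩ := hcf.exists_bound_of_continuous hf
    have h1 := ((integrable_fst_mul_planarGauss.const_mul (1 / 2 * v.1)).add
      (integrable_snd_mul_planarGauss.const_mul (1 / 2 * v.2))).mul_bdd
      (g := fun y : ℝ × ℝ => f (σ ^ 2, σ • y))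
      (hf.comp hcont).aestronglyMeasurable (ae_of_all _ fun y => hC _)
    refine h1.congr (ae_of_all _ fun y => ?_)
    simp only [Pi.add_apply]; ring
  have e1 := int1 _ (h1 (1, 0)).continuous (c1 _)
  have e2 := int2 _ (h1 (0, (1, 0))).continuous (c1 _) (1, 0)
  have e3 := int2 _ (h1 (0, (0, 1))).continuous (c1 _) (0, 1)
  have e23 : Integrable (fun y : ℝ × ℝ =>
      2 * (planarGauss y * ((1 / 2 * (y.1 * (1, 0).1 + y.2 * (1, 0).2)) *
          fderiv ℝ G (σ ^ 2, σ • y) (0, (1, 0)))) +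
        2 * (planarGauss y * ((1 / 2 * (y.1 * (0, 1).1 + y.2 * (0, 1).2)) *
          fderiv ℝ G (σ ^ 2, σ • y) (0, (0, 1))))) := (e2.const_mul 2).add (e3.const_mul 2)
  have e4 : Integrable (fun y : ℝ × ℝ => planarGauss y * dirDeriv2 G (0, (1, 0)) (σ ^ 2, σ • y)) :=
    int1 _ (h2 (0, (1, 0))).continuous (c2 _)
  have e5 : Integrable (fun y : ℝ × ℝ => planarGauss y * dirDeriv2 G (0, (0, 1)) (σ ^ 2, σ • y)) :=
    int1 _ (h2 (0, (0, 1))).continuous (c2 _)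
  have e45 : Integrable (fun y : ℝ × ℝ => planarGauss y * dirDeriv2 G (0, (1, 0)) (σ ^ 2, σ • y) +
      planarGauss y * dirDeriv2 G (0, (0, 1)) (σ ^ 2, σ • y)) := e4.add e5
  calc ∫ y, planarGauss y * fderiv ℝ G (σ ^ 2, σ • y) (2 * σ, y)
      = ∫ y, (2 * σ * (planarGauss y * fderiv ℝ G (σ ^ 2, σ • y) (1, 0)) +
        (2 * (planarGauss y * ((1 / 2 * (y.1 * (1, 0).1 + y.2 * (1, 0).2)) *
          fderiv ℝ G (σ ^ 2, σ • y) (0, (1, 0)))) +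
        2 * (planarGauss y * ((1 / 2 * (y.1 * (0, 1).1 + y.2 * (0, 1).2)) *
          fderiv ℝ G (σ ^ 2, σ • y) (0, (0, 1)))))) := by
        congr 1 with y
        have : ((2 * σ, y) : ℝ × (ℝ × ℝ)) = (2 * σ) • ((1, 0) : ℝ × (ℝ × ℝ)) +
            (y.1 • ((0, (1, 0)) : ℝ × (ℝ × ℝ)) + y.2 • ((0, (0, 1)) : ℝ × (ℝ × ℝ))) := by
          ext <;> simp
        rw [this, map_add, map_add, map_smul, map_smul, map_smul]
        simp only [smul_eq_mul]
        ring
    _ = 2 * σ * (∫ y, planarGauss y * fderiv ℝ G (σ ^ 2, σ • y) (1, 0)) +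
        (2 * (σ * ∫ y, planarGauss y * dirDeriv2 G (0, (1, 0)) (σ ^ 2, σ • y)) +
        2 * (σ * ∫ y, planarGauss y * dirDeriv2 G (0, (0, 1)) (σ ^ 2, σ • y))) := by
        rw [integral_add (e1.const_mul _) e23,
          integral_add (e2.const_mul _) (e3.const_mul _), integral_const_mul, integral_const_mul,
          integral_const_mul, hd, hd]
    _ = 2 * σ * gaussMean (backwardHeat G) σ := by
        have : gaussMean (backwardHeat G) σ =
            (∫ y, planarGauss y * fderiv ℝ G (σ ^ 2, σ • y) (1, 0)) +
            ((∫ y, planarGauss y * dirDeriv2 G (0, (1, 0)) (σ ^ 2, σ • y)) +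
            ∫ y, planarGauss y * dirDeriv2 G (0, (0, 1)) (σ ^ 2, σ • y)) := by
          rw [← integral_add e4 e5, ← integral_add e1 e45]
          simp only [gaussMean, backwardHeat, mul_add]
        rw [this]; ring

theorem gaussMean_zero (G : ℝ × (ℝ × ℝ) → ℝ) : gaussMean G 0 = G 0 := by
  have : ((0 : ℝ), (0 : ℝ × ℝ)) = 0 := rfl
  simp [gaussMean, integral_mul_const, integral_planarGauss, this]

theorem exists_forall_eq_zero_of_hasCompactSupport {G : ℝ × (ℝ × ℝ) → ℝ}
    (hc : HasCompactSupport G) : ∃ T, 0 < T ∧ ∀ t x, T ≤ t → G (t, x) = 0 := by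
  obtain ⟨R, hR⟩ := hc.isCompact.isBounded.subset_closedBall 0
  refine ⟨max R 0 + 1, by positivity, fun t x ht => ?_⟩
  by_contra h
  have h1 := hR (subset_tsupport _ h)
  have h2 : ‖t‖ ≤ R := (norm_fst_le (t, x)).trans (by simpa using h1)
  rw [Real.norm_eq_abs] at h2
  linarith [le_abs_self t, le_max_left R 0]

/-- The integral over the slice at time t > 0 is the t-derivative of `gaussMean G (√t)`, since the
factor 2σ cancels the derivative of √t. The fundamental theorem of calculus on (0, ∞) leaves the
value 0 at infinity, by compact support, minus the value G 0 at zero. -/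
theorem integral_heatKernel_mul_backwardHeat {G : ℝ × (ℝ × ℝ) → ℝ} (hG : ContDiff ℝ 2 G)
    (hc : HasCompactSupport G) : ∫ p, heatKernel p * backwardHeat G p = -G 0 := by
  have hH := continuous_backwardHeat hG
  have hcH := hasCompactSupport_backwardHeat hc
  have hint : Integrable (fun p => heatKernel p * backwardHeat G p) := by
    simpa [mul_comm] using locallyIntegrable_heatKernel.integrable_smul_left_of_hasCompactSupport
      hH hcH
  have hint' := hint
  rw [Measure.volume_eq_prod] at hint'
  rw [Measure.volume_eq_prod, integral_prod _ hint']
  have hz : ∀ t : ℝ, t ∉ Ioi (0 : ℝ) → ∫ x, heatKernel (t, x) * backwardHeat G (t, x) = 0 := by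
    intro t ht
    have ht' : ¬ 0 < t := ht
    simp only [heatKernel, ht', if_false, zero_mul, integral_zero]
  rw [← setIntegral_eq_integral_of_forall_compl_eq_zero hz]
  have hm : ∀ t ∈ Ioi (0 : ℝ), HasDerivAt (fun t => gaussMean G (√t))
      (∫ x, heatKernel (t, x) * backwardHeat G (t, x)) t := by
    intro t ht
    have ht' : 0 < √t := Real.sqrt_pos.2 ht
    refine ((hasDerivAt_gaussMean_sq hG hc (√t)).comp t
      ((hasDerivAt_id t).sqrt (ne_of_gt ht))).congr_deriv ?_
    rw [integral_heatKernel_mul ht, gaussMean]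
    simp only [Real.sq_sqrt (le_of_lt ht), id]
    field_simp
  obtain ⟨T, hT0, hT⟩ := exists_forall_eq_zero_of_hasCompactSupport hc
  have hlim : Tendsto (fun t => gaussMean G (√t)) atTop (𝓝 0) := by
    refine tendsto_const_nhds.congr' ?_
    filter_upwards [eventually_ge_atTop T] with t ht
    have : ∀ y : ℝ × ℝ, G ((√t) ^ 2, √t • y) = 0 := fun y => by
      rw [Real.sq_sqrt (hT0.le.trans ht)]; exact hT _ _ ht
    simp [gaussMean, this]
  have hcont : ContinuousWithinAt (fun t => gaussMean G (√t)) (Ici 0) 0 := by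
    have h0 : ContinuousAt (gaussMean G) (√0) := (hasDerivAt_gaussMean_sq hG hc _).continuousAt
    exact (ContinuousAt.comp (f := fun t : ℝ => √t) h0
      Real.continuous_sqrt.continuousAt).continuousWithinAt
  rw [integral_Ioi_of_hasDerivAt_of_tendsto hcont hm hint'.integral_prod_left.integrableOn hlim]
  simp [gaussMean_zero]

end HeatPotential

/-! ### The inhomogeneous heat equation with parameters -/

section HeatPotentialPDE
open MeasureTheory Real

instance isAddHaarMeasure_volume_prod_prod :
    (volume : Measure (ℝ × (ℝ × ℝ))).IsAddHaarMeasure := by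
  have : (volume : Measure (ℝ × ℝ)).IsAddHaarMeasure := by
    rw [Measure.volume_eq_prod]; infer_instance
  rw [Measure.volume_eq_prod]; infer_instance

/-- Convolution with the heat kernel. -/
noncomputable def heatConv (g : ℝ × (ℝ × ℝ) → ℝ) : ℝ × (ℝ × ℝ) → ℝ :=
  convolution heatKernel g (ContinuousLinearMap.mul ℝ ℝ) volume

theorem fderiv_heatConv {g : ℝ × (ℝ × ℝ) → ℝ} (hg : ContDiff ℝ 1 g) (hc : HasCompactSupport g)
    (v p : ℝ × (ℝ × ℝ)) : fderiv ℝ (heatConv g) p v = heatConv (fun q => fderiv ℝ g q v) p := by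
  have h := hc.hasFDerivAt_convolution_right (ContinuousLinearMap.mul ℝ ℝ)
    locallyIntegrable_heatKernel hg p
  rw [heatConv, h.fderiv]
  exact convolution_precompR_apply (ContinuousLinearMap.mul ℝ ℝ) (μ := volume)
    locallyIntegrable_heatKernel (hc.fderiv ℝ) (hg.continuous_fderiv one_ne_zero) p v

theorem dirDeriv2_heatConv {g : ℝ × (ℝ × ℝ) → ℝ} (hg : ContDiff ℝ 2 g) (hc : HasCompactSupport g)
    (v p : ℝ × (ℝ × ℝ)) : dirDeriv2 (heatConv g) v p = heatConv (dirDeriv2 g v) p := by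
  have h1 : (fun q => fderiv ℝ (heatConv g) q v) = heatConv (fun q => fderiv ℝ g q v) := by
    ext q; exact fderiv_heatConv (hg.of_le (by norm_num)) hc v q
  rw [dirDeriv2, h1, fderiv_heatConv (contDiff_fderiv_dir hg (by norm_num) v)
    (hasCompactSupport_fderiv_dir hc v)]
  rfl

theorem fderiv_comp_const_sub {E F : Type*} [NormedAddCommGroup E] [NormedSpace ℝ E]
    [NormedAddCommGroup F] [NormedSpace ℝ F] {g : E → F} (hg : Differentiable ℝ g) (p q v : E) :
    fderiv ℝ (fun q => g (p - q)) q v = -fderiv ℝ g (p - q) v := by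
  have h : HasFDerivAt (fun q : E => p - q) (-(ContinuousLinearMap.id ℝ E)) q := by
    simpa using (hasFDerivAt_id q).const_sub p
  have h2 : HasFDerivAt (fun q => g (p - q)) _ q := (hg (p - q)).hasFDerivAt.comp q h
  rw [h2.fderiv]; simp

/-- The duality identity for the backward operator is applied to q ↦ g (p - q): the reflection
changes the sign of ∂ₜ and leaves Δ unchanged. -/
theorem heat_heatConv {g : ℝ × (ℝ × ℝ) → ℝ} (hg : ContDiff ℝ 2 g) (hc : HasCompactSupport g)
    (p : ℝ × (ℝ × ℝ)) : fderiv ℝ (heatConv g) p (1, 0) =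
      dirDeriv2 (heatConv g) (0, (1, 0)) p + dirDeriv2 (heatConv g) (0, (0, 1)) p + g p := by
  have h1 := fun v => contDiff_fderiv_dir (m := 1) hg (by norm_num) v
  have h2 := fun v => contDiff_fderiv_dir (m := 0) (h1 v) (by norm_num) v
  have c1 := fun v => hasCompactSupport_fderiv_dir hc v
  have c2 := fun v => hasCompactSupport_fderiv_dir (c1 v) v
  have hex : ∀ f : ℝ × (ℝ × ℝ) → ℝ, Continuous f → HasCompactSupport f →
      Integrable (fun q => heatKernel q * f (p - q)) := fun f hf hcf =>
    hcf.convolutionExists_right (ContinuousLinearMap.mul ℝ ℝ)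
      locallyIntegrable_heatKernel hf p
  have hexx : ∀ f : ℝ × (ℝ × ℝ) → ℝ, heatConv f p = ∫ q, heatKernel q * f (p - q) := fun f => rfl
  have i1 := hex _ (h1 (1, 0)).continuous (c1 _)
  have i2 : Integrable (fun q => heatKernel q * dirDeriv2 g (0, (1, 0)) (p - q)) :=
    hex _ (h2 (0, (1, 0))).continuous (c2 _)
  have i3 : Integrable (fun q => heatKernel q * dirDeriv2 g (0, (0, 1)) (p - q)) :=
    hex _ (h2 (0, (0, 1))).continuous (c2 _)
  have i23 : Integrable (fun q => heatKernel q * dirDeriv2 g (0, (1, 0)) (p - q) +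
    heatKernel q * dirDeriv2 g (0, (0, 1)) (p - q)) := i2.add i3
  rw [fderiv_heatConv (hg.of_le (by norm_num)) hc, dirDeriv2_heatConv hg hc,
    dirDeriv2_heatConv hg hc, hexx, hexx, hexx]
  have key := integral_heatKernel_mul_backwardHeat (G := fun q => g (p - q))
    (hg.comp (by fun_prop)) (hc.comp_homeomorph (Homeomorph.subLeft p))
  have hd1 : ∀ v q, fderiv ℝ (fun q => g (p - q)) q v = -fderiv ℝ g (p - q) v :=
    fun v q => fderiv_comp_const_sub (hg.differentiable (by norm_num)) p q v
  have hd2 : ∀ v q, dirDeriv2 (fun q => g (p - q)) v q = dirDeriv2 g v (p - q) := by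
    intro v q
    have h3 : (fun q => fderiv ℝ (fun q => g (p - q)) q v) =
        fun q => -(fun r => fderiv ℝ g r v) (p - q) := by ext q; exact hd1 v q
    rw [dirDeriv2, h3, fderiv_fun_neg, neg_apply,
      fderiv_comp_const_sub ((h1 v).differentiable (by norm_num)), neg_neg]
    rfl
  have e : ∀ q, heatKernel q * backwardHeat (fun q => g (p - q)) q =
      (heatKernel q * dirDeriv2 g (0, (1, 0)) (p - q) +
      heatKernel q * dirDeriv2 g (0, (0, 1)) (p - q)) -
      heatKernel q * fderiv ℝ g (p - q) (1, 0) := by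
    intro q
    rw [backwardHeat, hd1, hd2, hd2]; ring
  simp_rw [e] at key
  rw [integral_sub i23 i1, integral_add i2 i3, sub_zero] at key
  linarith

/-- The coordinates `(t, (x, y))` on spacetime. -/
noncomputable def timeFirst : Spacetime →L[ℝ] ℝ × (ℝ × ℝ) :=
  (EuclideanSpace.proj 2).prod ((EuclideanSpace.proj 0).prod (EuclideanSpace.proj 1))

/-- The inverse of `timeFirst`. -/
noncomputable def timeLast : ℝ × (ℝ × ℝ) →L[ℝ] Spacetime :=
  (ContinuousLinearMap.fst ℝ ℝ (ℝ × ℝ)).smulRight (EuclideanSpace.single 2 1) +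
    ((ContinuousLinearMap.fst ℝ ℝ ℝ ∘L ContinuousLinearMap.snd ℝ ℝ (ℝ × ℝ)).smulRight
      (EuclideanSpace.single 0 1) +
    (ContinuousLinearMap.snd ℝ ℝ ℝ ∘L ContinuousLinearMap.snd ℝ ℝ (ℝ × ℝ)).smulRight
      (EuclideanSpace.single 1 1))

theorem timeLast_timeFirst (ξ : Spacetime) : timeLast (timeFirst ξ) = ξ := by
  ext i; fin_cases i <;> simp [timeLast, timeFirst]

theorem timeFirst_timeLast (p : ℝ × (ℝ × ℝ)) : timeFirst (timeLast p) = p := by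
  ext <;> simp [timeLast, timeFirst]

theorem timeFirst_single (i : Fin 3) : timeFirst (EuclideanSpace.single i 1) =
    ![(0, (1, 0)), (0, (0, 1)), (1, 0)] i := by
  fin_cases i <;> ext <;> simp [timeFirst]

theorem pderiv_comp_timeFirst {u : ℝ × (ℝ × ℝ) → ℝ} (hu : Differentiable ℝ u) (i : Fin 3)
    (ξ : Spacetime) : pderiv i (fun ξ => u (timeFirst ξ)) ξ =
      fderiv ℝ u (timeFirst ξ) (![(0, (1, 0)), (0, (0, 1)), (1, 0)] i) := by
  have h : HasFDerivAt (fun ξ => u (timeFirst ξ)) _ ξ :=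
    (hu (timeFirst ξ)).hasFDerivAt.comp ξ timeFirst.hasFDerivAt
  rw [pderiv, h.fderiv, ContinuousLinearMap.comp_apply, timeFirst_single]

/-- The source used later is only C^n at parameter 0 and smooth for positive parameters, so both
regularities are carried along: global C^n and smoothness over open sets of parameters. -/
theorem exists_heatPotential {n : ℕ} (hn : 2 ≤ n) {f : ℝ × Spacetime → ℝ} (hf : ContDiff ℝ n f)
    {K : Set Spacetime} (hK : IsCompact K) (hfK : ∀ p ξ, ξ ∉ K → f (p, ξ) = 0) :
    ∃ c : ℝ × Spacetime → ℝ, ContDiff ℝ n c ∧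
      (∀ p ξ, pderiv 2 (fun ξ => c (p, ξ)) ξ = pderiv 0 (pderiv 0 fun ξ => c (p, ξ)) ξ +
        pderiv 1 (pderiv 1 fun ξ => c (p, ξ)) ξ + f (p, ξ)) ∧
      ∀ s : Set ℝ, IsOpen s → ContDiffOn ℝ ∞ f (s ×ˢ univ) → ContDiffOn ℝ ∞ c (s ×ˢ univ) := by
  set g : ℝ → ℝ × (ℝ × ℝ) → ℝ := fun p q => f (p, timeLast q) with hg
  have hK' : IsCompact (timeFirst '' K) := hK.image timeFirst.continuous
  have hgK : ∀ p q, q ∉ timeFirst '' K → g p q = 0 := by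
    intro p q hq
    refine hfK p _ fun h => hq ⟨_, h, timeFirst_timeLast q⟩
  have hmap : ContDiff ℝ ∞ (fun q : ℝ × (ℝ × (ℝ × ℝ)) => (q.1, timeLast q.2)) :=
    contDiff_fst.prodMk (timeLast.contDiff.comp contDiff_snd)
  have hmap' : ContDiff ℝ ∞ (fun q : ℝ × Spacetime => (q.1, timeFirst q.2)) :=
    contDiff_fst.prodMk (timeFirst.contDiff.comp contDiff_snd)
  -- All derivatives of the convolution fall on the source, so it inherits the joint regularity of
  -- the source. This is used with m = n over all parameters and with m = ∞ over s.
  have main : ∀ (m : ℕ∞) (s : Set ℝ), IsOpen s → ContDiffOn ℝ m f (s ×ˢ univ) →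
      ContDiffOn ℝ m (fun q : ℝ × Spacetime => heatConv (g q.1) (timeFirst q.2))
        (s ×ˢ univ) := by
    intro m s hs hfs
    have h1 : ContDiffOn ℝ m ↿g (s ×ˢ univ) :=
      hfs.comp (hmap.of_le (by exact_mod_cast le_top)).contDiffOn fun q hq => ⟨hq.1, mem_univ _⟩
    have h2 := contDiffOn_convolution_right_with_param (ContinuousLinearMap.mul ℝ ℝ) hs hK'
      (fun p x _ hx => hgK p x hx) locallyIntegrable_heatKernel h1
    exact h2.comp (hmap'.of_le (by exact_mod_cast le_top)).contDiffOn
      fun q hq => ⟨hq.1, mem_univ _⟩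
  refine ⟨fun q => heatConv (g q.1) (timeFirst q.2), ?_, ?_, fun s hs h => main ⊤ s hs h⟩
  · have := main n univ isOpen_univ (by simpa using hf.contDiffOn)
    simpa [contDiffOn_univ] using this
  · intro p ξ
    have hgp : ContDiff ℝ 2 (g p) :=
      (hf.of_le (by exact_mod_cast hn)).comp (contDiff_const.prodMk timeLast.contDiff)
    have hgc : HasCompactSupport (g p) := HasCompactSupport.intro hK' fun q hq => hgK p q hq
    have hu : ContDiff ℝ 2 (heatConv (g p)) :=
      hgc.contDiff_convolution_right _ locallyIntegrable_heatKernel hgp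
    have h1 := fun v => contDiff_fderiv_dir (m := 1) hu (by norm_num) v
    have hp1 : ∀ i, pderiv i (fun ξ => heatConv (g p) (timeFirst ξ)) = fun ξ =>
        (fun q => fderiv ℝ (heatConv (g p)) q (![(0, (1, 0)), (0, (0, 1)), (1, 0)] i))
          (timeFirst ξ) := by
      intro i; ext η
      exact pderiv_comp_timeFirst (hu.differentiable (by norm_num)) i η
    simp only [hp1]
    rw [pderiv_comp_timeFirst ((h1 _).differentiable one_ne_zero),
      pderiv_comp_timeFirst ((h1 _).differentiable one_ne_zero)]
    have := heat_heatConv hgp hgc (timeFirst ξ)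
    simpa [dirDeriv2, hg, timeLast_timeFirst] using this

end HeatPotentialPDE

/-! ### Cutoff functions -/

section Cutoff

variable {E F : Type*} [NormedAddCommGroup E] [NormedSpace ℝ E] [FiniteDimensional ℝ E]
  [NormedAddCommGroup F] [NormedSpace ℝ F]

theorem exists_contDiff_zero_one_nhds {s t : Set E} (hs : IsClosed s) (ht : IsClosed t)
    (hd : Disjoint s t) : ∃ f : E → ℝ, ContDiff ℝ ∞ f ∧ (∀ᶠ x in 𝓝ˢ s, f x = 0) ∧
      (∀ᶠ x in 𝓝ˢ t, f x = 1) := by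
  obtain ⟨f, h0, h1, -⟩ := exists_contMDiffMap_zero_one_nhds_of_isClosed
    (n := (⊤ : ℕ∞)) (modelWithCornersSelf ℝ E) hs ht hd
  exact ⟨f, contMDiff_iff_contDiff.1 f.contMDiff, h0, h1⟩

/-- A function which is smooth on a neighbourhood of a compact set agrees near this set with a
smooth function of compact support. -/
theorem exists_contDiff_hasCompactSupport_eventuallyEq {K U : Set E} (hK : IsCompact K)
    (hU : IsOpen U) (hKU : K ⊆ U) {f : E → F} (hf : ContDiffOn ℝ ∞ f U) :
    ∃ g : E → F, ContDiff ℝ ∞ g ∧ HasCompactSupport g ∧ ∀ᶠ x in 𝓝ˢ K, g x = f x := by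
  obtain ⟨L, hL, hKL, hLU⟩ := exists_compact_between hK hU hKU
  obtain ⟨χ, hχ, h0, h1⟩ := exists_contDiff_zero_one_nhds (s := (interior L)ᶜ) (t := K)
    isOpen_interior.isClosed_compl hK.isClosed
    (by rwa [← subset_compl_iff_disjoint_left, compl_compl])
  refine ⟨fun x => χ x • f x, contDiff_iff_contDiffAt.2 fun x => ?_,
    HasCompactSupport.intro hL fun x hx => ?_, h1.mono fun x hx => by simp [hx]⟩
  · by_cases hx : x ∈ U
    · exact hχ.contDiffAt.smul (hf.contDiffAt (hU.mem_nhds hx))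
    · have hx' : x ∈ (interior L)ᶜ := fun h => hx (hLU (interior_subset h))
      have : (fun x => χ x • f x) =ᶠ[𝓝 x] fun _ => 0 := by
        filter_upwards [(eventually_nhdsSet_iff_forall.1 h0) x hx'] with y hy
        simp [hy]
      exact contDiffAt_const.congr_of_eventuallyEq this
  · have hx' : x ∈ (interior L)ᶜ := fun h => hx (interior_subset h)
    simp [h0.self_of_nhdsSet x hx']

end Cutoff

/-! ### Rescaled profiles -/

section Scale

/-- The rescaled profile `(ρ, u) ↦ ρ ^ k * φ (u / ρ)`. -/
noncomputable def scaledProfile (k : ℕ) (φ : ℝ → ℝ) (p : ℝ × ℝ) : ℝ := p.1 ^ k * φ (p.2 / p.1)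

variable {φ : ℝ → ℝ}

theorem exists_abs_scaledProfile_le (hφ : Continuous φ) (hc : HasCompactSupport φ) :
    ∃ C, 0 ≤ C ∧ ∀ k p, |scaledProfile k φ p| ≤ C * |p.1| ^ k := by
  obtain ⟨C, hC⟩ := hc.exists_bound_of_continuous hφ
  refine ⟨C, (norm_nonneg _).trans (hC 0), fun k p => ?_⟩
  rw [scaledProfile, abs_mul, abs_pow, mul_comm]
  exact mul_le_mul_of_nonneg_right (hC _) (by positivity)

theorem contDiffAt_scaledProfile {n : ℕ∞ω} (k : ℕ) (hφ : ContDiff ℝ n φ) {p : ℝ × ℝ}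
    (hp : p.1 ≠ 0) : ContDiffAt ℝ n (scaledProfile k φ) p :=
  (contDiff_fst.pow k).contDiffAt.mul
    (hφ.contDiffAt.comp p (contDiffAt_snd.div contDiffAt_fst hp))

theorem continuous_scaledProfile {k : ℕ} (hk : 1 ≤ k) (hφ : Continuous φ)
    (hc : HasCompactSupport φ) : Continuous (scaledProfile k φ) := by
  rw [continuous_iff_continuousAt]
  intro p
  by_cases hp : p.1 = 0
  · obtain ⟨C, hC0, hC⟩ := exists_abs_scaledProfile_le hφ hc
    have h0 : scaledProfile k φ p = 0 := by
      simp [scaledProfile, hp, (by lia : k ≠ 0)]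
    rw [ContinuousAt, h0]
    refine squeeze_zero_norm (fun q => hC k q) ?_
    have : Continuous fun q : ℝ × ℝ => C * |q.1| ^ k := by fun_prop
    simpa [hp, (by lia : k ≠ 0)] using this.tendsto p
  · have : ContDiffAt ℝ 0 (scaledProfile k φ) p :=
      contDiffAt_scaledProfile k (contDiff_zero.2 hφ) hp
    exact this.continuousAt

/-- For ρ ≠ 0 this is the chain rule, and the partial derivatives are again rescaled profiles with
one power of ρ less. At ρ = 0 the function is bounded by C |ρ| ^ (k + 1) with exponent at least 2,
so its derivative vanishes. -/
theorem hasFDerivAt_scaledProfile {k : ℕ} (hk : 1 ≤ k) (hφ : ContDiff ℝ ∞ φ)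
    (hc : HasCompactSupport φ) (p : ℝ × ℝ) : HasFDerivAt (scaledProfile (k + 1) φ)
      (scaledProfile k (fun x => (k + 1) * φ x - x * deriv φ x) p • ContinuousLinearMap.fst ℝ ℝ ℝ +
        scaledProfile k (deriv φ) p • ContinuousLinearMap.snd ℝ ℝ ℝ) p := by
  by_cases hp : p.1 = 0
  · obtain ⟨C, hC0, hC⟩ := exists_abs_scaledProfile_le hφ.continuous hc
    have h0 : ∀ m ψ, 1 ≤ m → scaledProfile m ψ p = 0 := by
      intro m ψ hm
      simp [scaledProfile, hp, (by lia : m ≠ 0)]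
    rw [h0 k _ hk, h0 k _ hk, zero_smul, zero_smul, add_zero]
    rw [hasFDerivAt_iff_isLittleO]
    simp only [h0 (k + 1) _ (by lia), sub_zero, zero_apply]
    have hO : (scaledProfile (k + 1) φ) =O[𝓝 p] fun q : ℝ × ℝ => ‖q - p‖ ^ (k + 1) := by
      refine Asymptotics.IsBigO.of_bound C (.of_forall fun q => ?_)
      refine (hC (k + 1) q).trans (mul_le_mul_of_nonneg_left ?_ hC0)
      rw [norm_pow, norm_norm]
      refine pow_le_pow_left₀ (abs_nonneg _) ?_ _
      simpa [hp] using norm_fst_le (q - p)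
    refine hO.trans_isLittleO ?_
    have h1 : (fun q : ℝ × ℝ => ‖q - p‖ ^ (k + 1)) =o[𝓝 p] fun q => ‖q - p‖ ^ 1 := by
      have ht : Tendsto (fun q : ℝ × ℝ => ‖q - p‖) (𝓝 p) (𝓝 0) := by
        have : Continuous fun q : ℝ × ℝ => ‖q - p‖ := by fun_prop
        simpa using this.tendsto p
      exact (Asymptotics.isLittleO_pow_pow (by lia : 1 < k + 1)).comp_tendsto ht
    simpa using h1.norm_right.norm_right
  · have h1 : HasFDerivAt (fun q : ℝ × ℝ => q.1 ^ (k + 1)) _ p :=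
      (hasFDerivAt_fst (𝕜 := ℝ) (E := ℝ) (F := ℝ) (p := p)).pow (k + 1)
    have h3 : HasFDerivAt (fun q : ℝ × ℝ => (q.1)⁻¹) _ p :=
      (hasDerivAt_inv hp).comp_hasFDerivAt p (hasFDerivAt_fst (𝕜 := ℝ) (E := ℝ) (F := ℝ) (p := p))
    have h2 : HasFDerivAt (fun q : ℝ × ℝ => φ (q.2 * (q.1)⁻¹)) _ p :=
      (((hφ.differentiable (by simp)) (p.2 * (p.1)⁻¹)).hasDerivAt.comp_hasFDerivAt p
        ((hasFDerivAt_snd (𝕜 := ℝ) (E := ℝ) (F := ℝ) (p := p)).mul h3))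
    have h4 := h1.mul h2
    simp only [← div_eq_mul_inv] at h4
    refine h4.congr_fderiv ?_
    ext
    · simp [scaledProfile, pow_succ]
      field_simp
      ring
    · simp [scaledProfile, pow_succ]
      field_simp

/-- Each derivative costs one power of ρ and stays within the class of compactly supported smooth
profiles; the last remaining power gives continuity at ρ = 0. -/
theorem contDiff_scaledProfile (n : ℕ) : ∀ {k : ℕ}, n + 1 ≤ k → ∀ {φ : ℝ → ℝ},
    ContDiff ℝ ∞ φ → HasCompactSupport φ → ContDiff ℝ n (scaledProfile k φ) := by
  induction n with
  | zero => exact fun hk φ hφ hc => contDiff_zero.2 (continuous_scaledProfile hk hφ.continuous hc)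
  | succ n ih =>
    intro k hk φ hφ hc
    obtain ⟨k, rfl⟩ : ∃ l, k = l + 1 := ⟨k - 1, by lia⟩
    have hd : ContDiff ℝ ∞ (deriv φ) := by
      exact ContDiff.iterate_deriv 1 hφ
    push_cast
    rw [contDiff_succ_iff_hasFDerivAt]
    refine ⟨_, ?_, hasFDerivAt_scaledProfile (by lia) hφ hc⟩
    refine ((ih (by lia) ?_ ?_).smul contDiff_const).add
      ((ih (by lia) hd hc.deriv).smul contDiff_const)
    · exact (contDiff_const.mul hφ).sub (contDiff_id.mul hd)
    · exact (hc.mul_left (f := fun _ => (k + 1 : ℝ))).sub (hc.deriv.mul_left (f := fun x => x))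

/-- A smooth profile of compact support which agrees with `x ^ m` on `[-1, 1]`. -/
theorem exists_profile (m : ℕ) : ∃ φ : ℝ → ℝ, ContDiff ℝ ∞ φ ∧ HasCompactSupport φ ∧
    ∀ x, |x| ≤ 1 → φ x = x ^ m := by
  obtain ⟨χ, hχ, hc, h⟩ := exists_contDiff_hasCompactSupport_eventuallyEq
    (isCompact_Icc (a := (-1 : ℝ)) (b := 1)) isOpen_univ (subset_univ _)
    (f := fun x : ℝ => x ^ m) (by fun_prop)
  exact ⟨χ, hχ, hc, fun x hx => h.self_of_nhdsSet x (abs_le.1 hx)⟩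

end Scale

/-! ### Formal solutions of the heat equation -/

section FormalSolution

/-- The heat operator `∂ₜ - ∂ₓₓ - ∂ᵧᵧ`. -/
noncomputable def heatOp (u : Spacetime → ℝ) (ξ : Spacetime) : ℝ :=
  pderiv 2 u ξ - (pderiv 0 (pderiv 0 u) ξ + pderiv 1 (pderiv 1 u) ξ)

variable {f g : Spacetime → ℝ}

theorem ContDiff.pderiv' {n m : ℕ∞ω} (hf : ContDiff ℝ n f) (h : m + 1 ≤ n) (i : Fin 3) :
    ContDiff ℝ m (pderiv i f) := contDiff_fderiv_dir hf h _

theorem ContDiff.pderiv (hf : ContDiff ℝ ∞ f) (i : Fin 3) : ContDiff ℝ ∞ (pderiv i f) :=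
  hf.pderiv' (by simp) i

theorem pderiv_add (hf : Differentiable ℝ f) (hg : Differentiable ℝ g) (i : Fin 3) :
    pderiv i (fun ξ => f ξ + g ξ) = fun ξ => pderiv i f ξ + pderiv i g ξ := by
  ext ξ
  rw [pderiv, fderiv_fun_add (hf ξ) (hg ξ)]; rfl

theorem pderiv_const_mul (hf : Differentiable ℝ f) (c : ℝ) (i : Fin 3) :
    pderiv i (fun ξ => c * f ξ) = fun ξ => c * pderiv i f ξ := by
  ext ξ
  rw [pderiv, fderiv_const_mul (hf ξ)]; rfl

theorem pderiv_mul (hf : Differentiable ℝ f) (hg : Differentiable ℝ g) (i : Fin 3) :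
    pderiv i (fun ξ => f ξ * g ξ) = fun ξ => f ξ * pderiv i g ξ + g ξ * pderiv i f ξ := by
  ext ξ
  rw [pderiv, fderiv_fun_mul (hf ξ) (hg ξ)]; rfl

theorem pderiv_pow (hf : Differentiable ℝ f) (n : ℕ) (i : Fin 3) :
    pderiv i (fun ξ => f ξ ^ (n + 1)) = fun ξ => (n + 1) * (f ξ ^ n * pderiv i f ξ) := by
  ext ξ
  rw [pderiv, fderiv_fun_pow (n + 1) (hf ξ)]
  simp [pderiv, mul_assoc]

theorem ContDiff.heatOp (hf : ContDiff ℝ ∞ f) : ContDiff ℝ ∞ (heatOp f) :=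
  (hf.pderiv 2).sub (((hf.pderiv 0).pderiv 0).add ((hf.pderiv 1).pderiv 1))

theorem ContDiff.differentiable_infty {E F : Type*} [NormedAddCommGroup E] [NormedSpace ℝ E]
    [NormedAddCommGroup F] [NormedSpace ℝ F] {f : E → F} (hf : ContDiff ℝ ∞ f) :
    Differentiable ℝ f :=
  hf.differentiable (by simp)

theorem heatOp_add (hf : ContDiff ℝ 2 f) (hg : ContDiff ℝ 2 g) (ξ : Spacetime) :
    heatOp (fun ξ => f ξ + g ξ) ξ = heatOp f ξ + heatOp g ξ := by
  have hf0 := hf.differentiable (by norm_num)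
  have hg0 := hg.differentiable (by norm_num)
  have hf1 := fun i => (hf.pderiv' (m := 1) (by norm_num) i).differentiable (by norm_num)
  have hg1 := fun i => (hg.pderiv' (m := 1) (by norm_num) i).differentiable (by norm_num)
  simp only [heatOp, pderiv_add hf0 hg0, pderiv_add (hf1 _) (hg1 _)]
  ring

theorem heatOp_const_mul (hf : ContDiff ℝ 2 f) (c : ℝ) (ξ : Spacetime) :
    heatOp (fun ξ => c * f ξ) ξ = c * heatOp f ξ := by
  have hf0 := hf.differentiable (by norm_num)
  have hf1 := fun i => (hf.pderiv' (m := 1) (by norm_num) i).differentiable (by norm_num)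
  simp only [heatOp, pderiv_const_mul hf0, pderiv_const_mul (hf1 _)]
  ring

theorem heatOp_mul (hf : ContDiff ℝ ∞ f) (hg : ContDiff ℝ ∞ g) (ξ : Spacetime) :
    heatOp (fun ξ => f ξ * g ξ) ξ = f ξ * heatOp g ξ + g ξ * heatOp f ξ -
      2 * (pderiv 0 f ξ * pderiv 0 g ξ + pderiv 1 f ξ * pderiv 1 g ξ) := by
  have hf0 := hf.differentiable_infty
  have hg0 := hg.differentiable_infty
  have hf1 := fun i => (hf.pderiv i).differentiable_infty
  have hg1 := fun i => (hg.pderiv i).differentiable_infty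
  simp only [heatOp, pderiv_mul hf0 hg0, pderiv_add (hf0.fun_mul (hg1 _)) (hg0.fun_mul (hf1 _)),
    pderiv_mul hf0 (hg1 _), pderiv_mul hg0 (hf1 _)]
  ring

theorem heatOp_pow (hf : ContDiff ℝ ∞ f) (k : ℕ) (ξ : Spacetime) :
    heatOp (fun ξ => f ξ ^ (k + 2)) ξ = (k + 2) * (f ξ ^ (k + 1) * heatOp f ξ) -
      (k + 2) * (k + 1) * (f ξ ^ k * (pderiv 0 f ξ ^ 2 + pderiv 1 f ξ ^ 2)) := by
  have hf0 := hf.differentiable_infty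
  have hf1 := fun i => (hf.pderiv i).differentiable_infty
  have hp := (hf.pow (k + 1)).differentiable_infty
  simp only [heatOp, pderiv_pow hf0 (k + 1), pderiv_const_mul (hp.fun_mul (hf1 _)),
    pderiv_mul hp (hf1 _), pderiv_pow hf0 k]
  push_cast
  ring

/-- Formal solution of the heat equation along the surface `z = 0`, to any finite order, with the
same Cauchy data as `w₀`. -/
theorem exists_formal_heatSolution {w₀ z a : Spacetime → ℝ} (hw : ContDiff ℝ ∞ w₀)
    (hz : ContDiff ℝ ∞ z) (ha : ContDiff ℝ ∞ a) {V : Set Spacetime}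
    (hV : ∀ ξ ∈ V, a ξ * (pderiv 0 z ξ ^ 2 + pderiv 1 z ξ ^ 2) = 1) (k : ℕ) :
    ∃ Q R : Spacetime → ℝ, ContDiff ℝ ∞ Q ∧ ContDiff ℝ ∞ R ∧
      ∀ ξ ∈ V, heatOp (fun ξ => w₀ ξ + z ξ ^ 2 * Q ξ) ξ = z ξ ^ k * R ξ := by
  induction k with
  | zero => exact ⟨fun _ => 0, heatOp w₀, contDiff_const, hw.heatOp, fun ξ _ => by simp⟩
  | succ k ih =>
    obtain ⟨Q, R, hQ, hR, h⟩ := ih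
    -- Adding z ^ (k + 2) H changes the heat operator by -(k + 2)(k + 1) z ^ k |∇z|² H, with the
    -- spatial gradient, up to terms divisible by z ^ (k + 1). Since a is the inverse of |∇z|² on V,
    -- the choice H = c a R cancels z ^ k R there.
    set c : ℝ := 1 / ((k + 2) * (k + 1)) with hc
    have hcc : c * ((k + 2) * (k + 1)) = 1 := by
      rw [hc]; field_simp
    set H : Spacetime → ℝ := fun ξ => c * (a ξ * R ξ) with hH
    have hHs : ContDiff ℝ ∞ H := contDiff_const.mul (ha.mul hR)
    refine ⟨fun ξ => Q ξ + z ξ ^ k * H ξ, fun ξ => z ξ * heatOp H ξ + (k + 2) * H ξ * heatOp z ξ -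
      2 * (k + 2) * (pderiv 0 z ξ * pderiv 0 H ξ + pderiv 1 z ξ * pderiv 1 H ξ),
      hQ.add ((hz.pow k).mul hHs), ?_, fun ξ hξ => ?_⟩
    · exact ((hz.mul hHs.heatOp).add ((contDiff_const.mul hHs).mul hz.heatOp)).sub
        (contDiff_const.mul (((hz.pderiv 0).mul (hHs.pderiv 0)).add
          ((hz.pderiv 1).mul (hHs.pderiv 1))))
    · have e : (fun ξ => w₀ ξ + z ξ ^ 2 * (Q ξ + z ξ ^ k * H ξ)) =
          fun ξ => (w₀ ξ + z ξ ^ 2 * Q ξ) + z ξ ^ (k + 2) * H ξ := by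
        ext η; ring
      have h1 : ContDiff ℝ ∞ (fun ξ => w₀ ξ + z ξ ^ 2 * Q ξ) := hw.add ((hz.pow 2).mul hQ)
      have h2 : ContDiff ℝ ∞ (fun ξ => z ξ ^ (k + 2)) := hz.pow _
      have h3 := fun i => pderiv_pow hz.differentiable_infty (k + 1) i
      rw [e, heatOp_add (h1.of_le ENat.LEInfty.out)
        ((h2.mul hHs).of_le ENat.LEInfty.out), h ξ hξ, heatOp_mul h2 hHs,
        heatOp_pow hz, h3, h3]
      have hA := hV ξ hξ
      have hHξ : H ξ = c * (a ξ * R ξ) := rfl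
      push_cast
      have key : H ξ * ((k + 2) * (k + 1) *
          (z ξ ^ k * (pderiv 0 z ξ ^ 2 + pderiv 1 z ξ ^ 2))) = z ξ ^ k * R ξ := by
        rw [hHξ]
        linear_combination (z ξ ^ k * R ξ) * hcc + (c * ((k + 2) * (k + 1)) * R ξ * z ξ ^ k) * hA
      linear_combination -key

end FormalSolution

/-! ### Tubes around a link -/

section Periodic

theorem exists_int_add_mem_Icc (s : ℝ) : ∃ n : ℤ, s + n * (2 * Real.pi) ∈ Icc 0 (2 * Real.pi) := by
  obtain ⟨n, hn, -⟩ := existsUnique_add_zsmul_mem_Ico Real.two_pi_pos s 0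
  exact ⟨n, by simpa using Ico_subset_Icc_self hn⟩

/-- A local statement which is periodic in `s` holds uniformly in `s`. -/
theorem eventually_forall_periodic {X : Type*} [TopologicalSpace X] {x₀ : X} {P : X → ℝ → Prop}
    (hper : ∀ x s (n : ℤ), P x (s + n * (2 * Real.pi)) → P x s)
    (h : ∀ s, ∀ᶠ q : X × ℝ in 𝓝 (x₀, s), P q.1 q.2) : ∀ᶠ x in 𝓝 x₀, ∀ s, P x s := by
  filter_upwards [(isCompact_Icc (a := 0) (b := 2 * Real.pi)).eventually_forall_of_forall_eventually
    (fun s _ => h s)] with x hx s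
  obtain ⟨n, hn⟩ := exists_int_add_mem_Icc s
  exact hper x s n (hx _ hn)

end Periodic

/-! ### Tube coordinates and descent of functions to spacetime -/

section Tube

variable {m : ℕ}

/-- The maps `Y i` parametrize disjoint embedded solid tori of radius `ρ`, periodically. -/
structure IsTube (Y : Fin m → ℝ × ℂ → Spacetime) (ρ : ℝ) : Prop where
  pos : 0 < ρ
  smooth : ∀ i, ContDiff ℝ ∞ (Y i)
  periodic : ∀ i s ζ (n : ℤ), Y i (s + n * (2 * Real.pi), ζ) = Y i (s, ζ)
  invertible : ∀ i p, ‖p.2‖ < ρ → (fderiv ℝ (Y i) p).IsInvertible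
  inj : ∀ i j p p', ‖p.2‖ < ρ → ‖p'.2‖ < ρ → Y i p = Y j p' →
    i = j ∧ p.2 = p'.2 ∧ ∃ n : ℤ, p'.1 = p.1 + n * (2 * Real.pi)

theorem eventually_isInvertible {E F X : Type*} [NormedAddCommGroup E] [NormedSpace ℝ E]
    [CompleteSpace E] [NormedAddCommGroup F] [NormedSpace ℝ F] [TopologicalSpace X]
    {f : X → E →L[ℝ] F} {x : X} (hf : ContinuousAt f x) (h : (f x).IsInvertible) :
    ∀ᶠ y in 𝓝 x, (f y).IsInvertible := by
  obtain ⟨e, he⟩ := h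
  have := ContinuousLinearEquiv.nhds e
  rw [he] at this
  exact (hf.eventually this)

/-- Invertibility and injectivity hold on the core and are open conditions there; compactness of a
period, and of pairs of parameters for injectivity, makes the radius uniform. -/
theorem exists_isTube {Y : Fin m → ℝ × ℂ → Spacetime} (hY : ∀ i, ContDiff ℝ ∞ (Y i))
    (hper : ∀ i s ζ (n : ℤ), Y i (s + n * (2 * Real.pi), ζ) = Y i (s, ζ))
    (hinv : ∀ i s, (fderiv ℝ (Y i) (s, 0)).IsInvertible)
    (hinj : ∀ i j s s', Y i (s, 0) = Y j (s', 0) → i = j ∧ ∃ n : ℤ, s' = s + n * (2 * Real.pi)) :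
    ∀ᶠ ρ in 𝓝[>] (0 : ℝ), IsTube Y ρ := by
  have h1 : ∀ i, ∀ᶠ ζ in 𝓝 (0 : ℂ), ∀ s, (fderiv ℝ (Y i) (s, ζ)).IsInvertible := by
    intro i
    refine eventually_forall_periodic (fun ζ s n h => ?_) fun s => ?_
    · have e : (fun p : ℝ × ℂ => Y i (p + (n * (2 * Real.pi), 0))) = Y i := by
        ext1 p
        have : p + ((n * (2 * Real.pi), 0) : ℝ × ℂ) = (p.1 + n * (2 * Real.pi), p.2) := by
          ext <;> simp
        rw [this, hper]
      have h2 := fderiv_comp_add_right (𝕜 := ℝ) (f := Y i) (x := ((s, ζ) : ℝ × ℂ))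
        (n * (2 * Real.pi), 0)
      rw [e] at h2
      rw [h2]
      simpa using h
    · have hc : Continuous (fun q : ℂ × ℝ => fderiv ℝ (Y i) (q.2, q.1)) :=
        ((hY i).continuous_fderiv (by simp)).comp (by fun_prop)
      exact eventually_isInvertible hc.continuousAt (hinv i s)
  have h2 : ∀ i j, ∀ᶠ ζ : ℂ × ℂ in 𝓝 0, ∀ s s', Y i (s, ζ.1) = Y j (s', ζ.2) →
      i = j ∧ ζ.1 = ζ.2 ∧ ∃ n : ℤ, s' = s + n * (2 * Real.pi) := by
    intro i j
    have hK := (isCompact_Icc (a := 0) (b := 2 * Real.pi)).prod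
      (isCompact_Icc (a := 0) (b := 2 * Real.pi))
    have := hK.eventually_forall_of_forall_eventually (x₀ := (0 : ℂ × ℂ))
      (P := fun ζ q => Y i (q.1, ζ.1) = Y j (q.2, ζ.2) →
        i = j ∧ ζ.1 = ζ.2 ∧ ∃ n : ℤ, q.2 = q.1 + n * (2 * Real.pi)) ?_
    · filter_upwards [this] with ζ hζ s s' h
      obtain ⟨k, hk⟩ := exists_int_add_mem_Icc s
      obtain ⟨k', hk'⟩ := exists_int_add_mem_Icc s'
      obtain ⟨hij, hz, n, hn⟩ := hζ (_, _) ⟨hk, hk'⟩ (by simpa [hper] using h)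
      refine ⟨hij, hz, n + k - k', ?_⟩
      simp only at hn
      push_cast
      linear_combination hn
    · rintro ⟨s, s'⟩ -
      have hci : Continuous fun q : (ℂ × ℂ) × (ℝ × ℝ) => Y i (q.2.1, q.1.1) :=
        (hY i).continuous.comp (by fun_prop)
      have hcj : Continuous fun q : (ℂ × ℂ) × (ℝ × ℝ) => Y j (q.2.2, q.1.2) :=
        (hY j).continuous.comp (by fun_prop)
      -- If the core points coincide, the parameters differ by a period and the inverse function
      -- theorem gives local injectivity after the shift. If they differ, nearby images remain
      -- different by continuity.
      by_cases hne : Y i (s, 0) = Y j (s', 0)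
      · obtain ⟨rfl, n, hn⟩ := hinj i j s s' hne
        obtain ⟨e, he⟩ := hinv i s
        have hs : HasStrictFDerivAt (Y i) (e : ℝ × ℂ →L[ℝ] Spacetime) (s, 0) := by
          rw [he]; exact (hY i).contDiffAt.hasStrictFDerivAt (by simp)
        have c1 : ContinuousAt (fun q : (ℂ × ℂ) × (ℝ × ℝ) => (q.2.1, q.1.1)) (0, (s, s')) := by
          fun_prop
        have c2 : ContinuousAt (fun q : (ℂ × ℂ) × (ℝ × ℝ) => (q.2.2 - n * (2 * Real.pi), q.1.2))
            (0, (s, s')) := by fun_prop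
        have hsrc' := (hs.toOpenPartialHomeomorph (Y i)).open_source.mem_nhds
          hs.mem_toOpenPartialHomeomorph_source
        have e2 : (s' - n * (2 * Real.pi), (0 : ℂ)) = (s, 0) := by rw [hn]; simp
        filter_upwards [c1.eventually hsrc', c2.eventually (by
          simp only [Prod.snd_zero]; rw [e2]; exact hsrc')] with q hq1 hq2 h
        have h3 : Y i (q.2.2 - n * (2 * Real.pi), q.1.2) = Y i (q.2.2, q.1.2) := by
          rw [← hper i (q.2.2 - n * (2 * Real.pi)) q.1.2 n]; simp
        have h4 := (hs.toOpenPartialHomeomorph (Y i)).injOn hq1 hq2 (h.trans h3.symm)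
        rw [Prod.mk.injEq] at h4
        exact ⟨rfl, h4.2, n, by linarith [h4.1]⟩
      · filter_upwards [(isOpen_ne_fun hci hcj).mem_nhds
          (show (0, (s, s')) ∈ _ from hne)] with q hq h
        exact absurd h hq
  have h1' := Metric.eventually_nhds_iff.1 (eventually_all.2 h1)
  have h2' := Metric.eventually_nhds_iff.1 (eventually_all.2 fun i => eventually_all.2 (h2 i))
  obtain ⟨r1, hr1, H1⟩ := h1'
  obtain ⟨r2, hr2, H2⟩ := h2'
  filter_upwards [Ioo_mem_nhdsGT (lt_min hr1 hr2)] with ρ hρ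
  refine ⟨hρ.1, hY, hper, fun i p hp => ?_, fun i j p p' hp hp' h => ?_⟩
  · exact H1 (y := p.2) (by simpa using hp.trans (hρ.2.trans_le (min_le_left _ _))) i p.1
  · refine H2 (y := (p.2, p'.2)) ?_ i j p.1 p'.1 h
    have : ‖((p.2, p'.2) : ℂ × ℂ)‖ < r2 :=
      (max_lt hp hp').trans (hρ.2.trans_le (min_le_right _ _))
    simpa using this

namespace IsTube

variable {Y : Fin m → ℝ × ℂ → Spacetime} {ρ : ℝ} {X : Type*} [Zero X]

theorem mono (hT : IsTube Y ρ) {ρ' : ℝ} (h0 : 0 < ρ') (h : ρ' ≤ ρ) : IsTube Y ρ' :=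
  ⟨h0, hT.smooth, hT.periodic, fun i p hp => hT.invertible i p (hp.trans_le h),
    fun i j p p' hp hp' => hT.inj i j p p' (hp.trans_le h) (hp'.trans_le h)⟩

theorem exists_localInverse (hT : IsTube Y ρ) (i : Fin m) {p : ℝ × ℂ} (hp : ‖p.2‖ < ρ) :
    ∃ l : Spacetime → ℝ × ℂ, ContDiffAt ℝ ∞ l (Y i p) ∧ l (Y i p) = p ∧
      ∀ᶠ ξ in 𝓝 (Y i p), ‖(l ξ).2‖ < ρ ∧ Y i (l ξ) = ξ := by
  obtain ⟨e, he⟩ := hT.invertible i p hp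
  have hd : HasFDerivAt (Y i) (e : ℝ × ℂ →L[ℝ] Spacetime) p := by
    rw [he]; exact ((hT.smooth i).differentiable (by simp) p).hasFDerivAt
  have hc : ContDiffAt ℝ ∞ (Y i) p := (hT.smooth i).contDiffAt
  have hl := hc.to_localInverse hd (by simp)
  have hl0 := hc.localInverse_apply_image hd (by simp)
  refine ⟨_, hl, hl0, ?_⟩
  have hs := hc.hasStrictFDerivAt' hd (by simp)
  have h1 : ∀ᶠ ξ in 𝓝 (Y i p), ‖(hc.localInverse hd (by simp) ξ).2‖ < ρ := by
    refine (hl.continuousAt.snd.norm.eventually_lt continuousAt_const ?_)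
    rw [hl0]; exact hp
  exact h1.and hs.eventually_right_inverse

open Classical in
/-- The function on spacetime which is given by `H i` in the coordinates of the `i`-th tube. -/
noncomputable def _root_.tubeDesc (Y : Fin m → ℝ × ℂ → Spacetime) (ρ : ℝ)
    (H : Fin m → ℝ × ℂ → X) (ξ : Spacetime) : X :=
  if h : ∃ q : Fin m × (ℝ × ℂ), ‖q.2.2‖ < ρ ∧ Y q.1 q.2 = ξ then H h.choose.1 h.choose.2 else 0

/-- The preimage chosen in the definition can differ from (i, p) only by a multiple of the period,
which a periodic H does not see. -/
theorem tubeDesc_apply (hT : IsTube Y ρ) {H : Fin m → ℝ × ℂ → X}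
    (hH : ∀ i s ζ (n : ℤ), H i (s + n * (2 * Real.pi), ζ) = H i (s, ζ)) (i : Fin m) {p : ℝ × ℂ}
    (hp : ‖p.2‖ < ρ) : tubeDesc Y ρ H (Y i p) = H i p := by
  have h : ∃ q : Fin m × (ℝ × ℂ), ‖q.2.2‖ < ρ ∧ Y q.1 q.2 = Y i p := ⟨(i, p), hp, rfl⟩
  rw [tubeDesc, dif_pos h]
  obtain ⟨h1, h2, n, hn⟩ := hT.inj _ _ _ _ hp h.choose_spec.1 h.choose_spec.2.symm
  rw [← h1]
  have : h.choose.2 = (p.1 + n * (2 * Real.pi), p.2) := Prod.ext hn h2.symm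
  rw [this, hH]

/-- Near Y i p the descended function is H i composed with a smooth local inverse of Y i. The
parameter θ is kept so that joint regularity can be differentiated later. -/
theorem contDiffAt_tubeDesc {E F : Type*} [NormedAddCommGroup E] [NormedSpace ℝ E]
    [NormedAddCommGroup F] [NormedSpace ℝ F] (hT : IsTube Y ρ) {H : E → Fin m → ℝ × ℂ → F}
    (hH : ∀ θ i s ζ (n : ℤ), H θ i (s + n * (2 * Real.pi), ζ) = H θ i (s, ζ)) {n : ℕ∞ω}
    (hn : n ≤ (∞ : ℕ∞ω)) {θ : E} {i : Fin m} {p : ℝ × ℂ} (hp : ‖p.2‖ < ρ)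
    (hs : ContDiffAt ℝ n (fun q : E × (ℝ × ℂ) => H q.1 i q.2) (θ, p)) :
    ContDiffAt ℝ n (fun q : E × Spacetime => tubeDesc Y ρ (H q.1) q.2) (θ, Y i p) := by
  obtain ⟨l, hl, hl0, hev⟩ := hT.exists_localInverse i hp
  have h1 : ContDiffAt ℝ n (fun q : E × Spacetime => H q.1 i (l q.2)) (θ, Y i p) := by
    have h2 : ContDiffAt ℝ n (fun q : E × Spacetime => (q.1, l q.2)) (θ, Y i p) :=
      contDiffAt_fst.prodMk ((hl.of_le hn).comp (θ, Y i p) contDiffAt_snd)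
    exact ContDiffAt.comp (θ, Y i p) (by simpa [hl0] using hs) h2
  refine h1.congr_of_eventuallyEq ?_
  have : ∀ᶠ q : E × Spacetime in 𝓝 (θ, Y i p), ‖(l q.2).2‖ < ρ ∧ Y i (l q.2) = q.2 :=
    (continuousAt_snd (p := (θ, Y i p))).eventually hev
  filter_upwards [this] with q hq
  conv_lhs => rw [← hq.2]
  exact hT.tubeDesc_apply (hH q.1) i hq.1

theorem contDiffAt_tubeDesc' {F : Type*} [NormedAddCommGroup F] [NormedSpace ℝ F]
    (hT : IsTube Y ρ) {H : Fin m → ℝ × ℂ → F}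
    (hH : ∀ i s ζ (n : ℤ), H i (s + n * (2 * Real.pi), ζ) = H i (s, ζ)) {n : ℕ∞ω} (hn : n ≤ (∞ : ℕ∞ω))
    {i : Fin m} {p : ℝ × ℂ} (hp : ‖p.2‖ < ρ) (hs : ContDiffAt ℝ n (H i) p) :
    ContDiffAt ℝ n (tubeDesc Y ρ H) (Y i p) := by
  have h := hT.contDiffAt_tubeDesc (E := ℝ) (H := fun _ => H) (fun _ => hH) hn (θ := 0) hp
    (hs.comp (0, p) contDiffAt_snd)
  exact ContDiffAt.comp (Y i p) h (contDiffAt_const.prodMk contDiffAt_id)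

theorem isOpen_image (hT : IsTube Y ρ) (i : Fin m) {W : Set (ℝ × ℂ)} (hW : IsOpen W)
    (h : ∀ p ∈ W, ‖p.2‖ < ρ) : IsOpen (Y i '' W) := by
  rw [isOpen_iff_mem_nhds]
  rintro _ ⟨p, hp, rfl⟩
  obtain ⟨l, hl, hl0, hev⟩ := hT.exists_localInverse i (h p hp)
  have : ∀ᶠ ξ in 𝓝 (Y i p), l ξ ∈ W :=
    hl.continuousAt.eventually (by rw [hl0]; exact hW.mem_nhds hp)
  filter_upwards [this, hev] with ξ h1 h2
  exact ⟨l ξ, h1, h2.2⟩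

end IsTube

end Tube

/-! ### A slanted direction which is nowhere tangent to a curve -/

section Slant

theorem isInvertible_of_injective {E F : Type*} [NormedAddCommGroup E] [NormedSpace ℝ E]
    [FiniteDimensional ℝ E] [NormedAddCommGroup F] [NormedSpace ℝ F] [FiniteDimensional ℝ F]
    (L : E →L[ℝ] F) (hd : Module.finrank ℝ E = Module.finrank ℝ F)
    (h : ∀ x, L x = 0 → x = 0) : L.IsInvertible := by
  have hinj : Function.Injective (L : E →ₗ[ℝ] F) := by
    rw [← LinearMap.ker_eq_bot, LinearMap.ker_eq_bot']
    exact fun x hx => h x hx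
  refine ⟨(LinearMap.linearEquivOfInjective (L : E →ₗ[ℝ] F) hinj hd).toContinuousLinearEquiv, ?_⟩
  ext x
  simp

/-- A tangent with nonzero time component is parallel to (a, b, 1) for exactly one pair (a, b).
These pairs form the locally Lipschitz image of a set of reals, hence a set of Hausdorff dimension
at most 1, which cannot fill the plane. A horizontal tangent is never parallel to such a direction.
-/
theorem exists_slope_ne {c : ℝ → Spacetime} (hc : ContDiff ℝ ∞ c) (hreg : ∀ s, deriv c s ≠ 0) :
    ∃ a b : ℝ, ∀ s, 0 < (deriv c s 0 - a * deriv c s 2) ^ 2 +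
      (deriv c s 1 - b * deriv c s 2) ^ 2 := by
  have hd : ContDiff ℝ ∞ (deriv c) := by exact ContDiff.iterate_deriv 1 hc
  have hdi : ∀ i, ContDiff ℝ ∞ (fun s => deriv c s i) := fun i => contDiff_euclidean.1 hd i
  set S : Set ℝ := {s | deriv c s 2 ≠ 0} with hS
  set q : ℝ → ℝ × ℝ := fun s => (deriv c s 0 / deriv c s 2, deriv c s 1 / deriv c s 2) with hq
  have hdim : dimH (q '' S) ≤ 1 := by
    refine (dimH_image_le_of_locally_lipschitzOn fun s hs => ?_).trans
      ((dimH_mono (subset_univ S)).trans Real.dimH_univ.le)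
    · have h1 : ContDiffAt ℝ 1 q s :=
        (((hdi 0).contDiffAt.div (hdi 2).contDiffAt hs).prodMk
          ((hdi 1).contDiffAt.div (hdi 2).contDiffAt hs)).of_le (by simp)
      obtain ⟨K, t, ht, hK⟩ := h1.exists_lipschitzOnWith
      exact ⟨K, t, mem_nhdsWithin_of_mem_nhds ht, hK⟩
  have hdense : Dense (q '' S)ᶜ := dense_compl_of_dimH_lt_finrank (hdim.trans_lt (by
    simp [Module.finrank_prod]))
  obtain ⟨⟨a, b⟩, hab⟩ := hdense.nonempty
  refine ⟨a, b, fun s => ?_⟩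
  by_contra hcon
  have h0 : deriv c s 0 - a * deriv c s 2 = 0 := by nlinarith
  have h1 : deriv c s 1 - b * deriv c s 2 = 0 := by nlinarith
  by_cases h2 : deriv c s 2 = 0
  · refine hreg s ?_
    ext i
    fin_cases i
    · simpa [h2] using h0
    · simpa [h2] using h1
    · simpa using h2
  · refine hab ⟨s, h2, ?_⟩
    simp only [hq, Prod.mk.injEq]
    constructor
    · field_simp; linarith
    · field_simp; linarith

/-- The direction `(a, b, 1)`. -/
noncomputable def slantDir (a b : ℝ) : Spacetime := !₂[a, b, 1]

/-- A horizontal normal of the projection of the curve along the direction `(a, b, 1)`. -/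
noncomputable def slantNormal (c : ℝ → Spacetime) (a b s : ℝ) : Spacetime :=
  !₂[-(deriv c s 1 - b * deriv c s 2), deriv c s 0 - a * deriv c s 2, 0]

/-- The tube coordinates of a curve which belong to the direction `(a, b, 1)`. -/
noncomputable def slantTube (c : ℝ → Spacetime) (a b : ℝ) (p : ℝ × ℂ) : Spacetime :=
  c p.1 + (p.2.re • slantDir a b + p.2.im • slantNormal c a b p.1)

variable {c : ℝ → Spacetime} {a b : ℝ}

theorem contDiff_slantNormal (hc : ContDiff ℝ ∞ c) : ContDiff ℝ ∞ (slantNormal c a b) := by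
  have hd : ContDiff ℝ ∞ (deriv c) := by exact ContDiff.iterate_deriv 1 hc
  have hdi : ∀ i, ContDiff ℝ ∞ (fun s => deriv c s i) := fun i => contDiff_euclidean.1 hd i
  rw [contDiff_euclidean]
  intro i
  fin_cases i
  · exact ((hdi 1).sub (contDiff_const.mul (hdi 2))).neg
  · exact (hdi 0).sub (contDiff_const.mul (hdi 2))
  · exact contDiff_const

theorem contDiff_slantTube (hc : ContDiff ℝ ∞ c) : ContDiff ℝ ∞ (slantTube c a b) :=
  (hc.comp contDiff_fst).add (((Complex.reCLM.contDiff.comp contDiff_snd).smul contDiff_const).add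
    ((Complex.imCLM.contDiff.comp contDiff_snd).smul ((contDiff_slantNormal hc).comp contDiff_fst)))

theorem slantTube_zero (s : ℝ) : slantTube c a b (s, 0) = c s := by
  simp [slantTube]

theorem slantTube_periodic (hp : Function.Periodic c (2 * Real.pi)) (s : ℝ) (ζ : ℂ) (n : ℤ) :
    slantTube c a b (s + n * (2 * Real.pi), ζ) = slantTube c a b (s, ζ) := by
  have h1 := hp.int_mul n s
  have h2 : deriv c (s + n * (2 * Real.pi)) = deriv c s := by
    rw [← deriv_comp_add_const]
    congr 1
    ext1 t
    exact hp.int_mul n t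
  simp only [slantTube, slantNormal, h1, h2]

theorem hasFDerivAt_slantTube (hc : ContDiff ℝ ∞ c) (s : ℝ) :
    HasFDerivAt (slantTube c a b) ((ContinuousLinearMap.fst ℝ ℝ ℂ).smulRight (deriv c s) +
      ((Complex.reCLM ∘L ContinuousLinearMap.snd ℝ ℝ ℂ).smulRight (slantDir a b) +
      (Complex.imCLM ∘L ContinuousLinearMap.snd ℝ ℝ ℂ).smulRight (slantNormal c a b s))) (s, 0) := by
  have h1 : HasFDerivAt (fun p : ℝ × ℂ => c p.1) _ (s, 0) :=
    ((hc.differentiable (by simp) s).hasDerivAt.hasFDerivAt).comp (s, (0 : ℂ)) hasFDerivAt_fst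
  have hre : HasFDerivAt (fun p : ℝ × ℂ => p.2.re) _ (s, 0) :=
    Complex.reCLM.hasFDerivAt.comp (s, (0 : ℂ)) hasFDerivAt_snd
  have him : HasFDerivAt (fun p : ℝ × ℂ => p.2.im) _ (s, 0) :=
    Complex.imCLM.hasFDerivAt.comp (s, (0 : ℂ)) hasFDerivAt_snd
  have hn : HasFDerivAt (fun p : ℝ × ℂ => slantNormal c a b p.1) _ (s, 0) :=
    HasFDerivAt.comp (g := slantNormal c a b) (s, (0 : ℂ))
      (((contDiff_slantNormal hc).differentiable (by simp) s).hasDerivAt.hasFDerivAt)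
      hasFDerivAt_fst
  refine (h1.add ((hre.smul_const (slantDir a b)).add (him.smul hn))).congr_fderiv ?_
  ext <;> simp

/-- Subtracting the multiple of (a, b, 1) with the same time component from the tangent leaves the
nonzero horizontal vector (p0, p1), and the normal is its quarter turn (-p1, p0). Together with (a,
b, 1) these are independent. -/
theorem isInvertible_fderiv_slantTube (hc : ContDiff ℝ ∞ c) {s : ℝ}
    (h : 0 < (deriv c s 0 - a * deriv c s 2) ^ 2 + (deriv c s 1 - b * deriv c s 2) ^ 2) :
    (fderiv ℝ (slantTube c a b) (s, 0)).IsInvertible := by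
  refine isInvertible_of_injective _ (by simp [Module.finrank_prod]) fun x hx => ?_
  rw [(hasFDerivAt_slantTube hc s).fderiv] at hx
  have e0 := congrArg (fun v : Spacetime => v 0) hx
  have e1 := congrArg (fun v : Spacetime => v 1) hx
  have e2 := congrArg (fun v : Spacetime => v 2) hx
  simp [slantDir, slantNormal] at e0 e1 e2
  set p0 := deriv c s 0 - a * deriv c s 2 with hp0
  set p1 := deriv c s 1 - b * deriv c s 2 with hp1
  have k0 : x.1 * p0 - x.2.im * p1 = 0 := by rw [hp0, hp1]; linear_combination e0 - a * e2
  have k1 : x.1 * p1 + x.2.im * p0 = 0 := by rw [hp0, hp1]; linear_combination e1 - b * e2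
  have hx1 : x.1 = 0 := by
    have : x.1 * (p0 ^ 2 + p1 ^ 2) = 0 := by linear_combination p0 * k0 + p1 * k1
    exact (mul_eq_zero.1 this).resolve_right h.ne'
  have him : x.2.im = 0 := by
    have : x.2.im * (p0 ^ 2 + p1 ^ 2) = 0 := by linear_combination p0 * k1 - p1 * k0
    exact (mul_eq_zero.1 this).resolve_right h.ne'
  have hre : x.2.re = 0 := by simpa [hx1] using e2
  exact Prod.ext hx1 (Complex.ext hre him)

end Slant

/-! ### Positivity intervals of a periodic function with simple zeros -/

section PosInterval

/-- `(a, b)` is a maximal open interval on which `f` is positive. -/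
def IsPosInterval (f : ℝ → ℝ) (a b : ℝ) : Prop :=
  a < b ∧ f a = 0 ∧ f b = 0 ∧ ∀ s ∈ Ioo a b, 0 < f s

variable {f : ℝ → ℝ} {a b a' b' s : ℝ}

theorem eventually_sign_of_deriv_pos (h0 : f a = 0) (h : 0 < deriv f a) :
    ∀ᶠ s in 𝓝 a, (s < a → f s < 0) ∧ (a < s → 0 < f s) := by
  have hd : HasDerivAt f (deriv f a) a := (differentiableAt_of_deriv_ne_zero h.ne').hasDerivAt
  have := (hasDerivAt_iff_tendsto_slope.1 hd).eventually (lt_mem_nhds h)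
  rw [eventually_nhdsWithin_iff] at this
  filter_upwards [this] with s hs
  constructor
  · intro hsa
    have h1 := hs hsa.ne
    rw [slope_def_field, h0, sub_zero] at h1
    by_contra hc
    have := div_nonpos_of_nonneg_of_nonpos (not_lt.1 hc) (sub_nonpos.2 hsa.le)
    linarith
  · intro hsa
    have h1 := hs hsa.ne'
    rw [slope_def_field, h0, sub_zero] at h1
    by_contra hc
    have := div_nonpos_of_nonpos_of_nonneg (not_lt.1 hc) (sub_nonneg.2 hsa.le)
    linarith

theorem eventually_sign_of_deriv_neg (h0 : f a = 0) (h : deriv f a < 0) :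
    ∀ᶠ s in 𝓝 a, (s < a → 0 < f s) ∧ (a < s → f s < 0) := by
  have h1 : 0 < deriv (fun s => -f s) a := by rw [deriv.fun_neg]; linarith
  filter_upwards [eventually_sign_of_deriv_pos (f := fun s => -f s) (by simp [h0]) h1] with s hs
  exact ⟨fun h => by linarith [hs.1 h], fun h => by linarith [hs.2 h]⟩

theorem IsPosInterval.deriv_left_pos (h : IsPosInterval f a b)
    (hnd : ∀ s, f s = 0 → deriv f s ≠ 0) : 0 < deriv f a := by
  by_contra hc
  have hlt := lt_of_le_of_ne (not_lt.1 hc) (hnd a h.2.1)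
  have h1 : ∀ᶠ s in 𝓝[>] a, f s < 0 := by
    filter_upwards [(eventually_sign_of_deriv_neg h.2.1 hlt).filter_mono nhdsWithin_le_nhds,
      self_mem_nhdsWithin] with s hs hs' using hs.2 hs'
  obtain ⟨s, hs, hs'⟩ := (h1.and (Ioo_mem_nhdsGT h.1)).exists
  linarith [h.2.2.2 s hs']

theorem IsPosInterval.deriv_right_neg (h : IsPosInterval f a b)
    (hnd : ∀ s, f s = 0 → deriv f s ≠ 0) : deriv f b < 0 := by
  by_contra hc
  have hlt := lt_of_le_of_ne (not_lt.1 hc) (hnd b h.2.2.1).symm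
  have h1 : ∀ᶠ s in 𝓝[<] b, f s < 0 := by
    filter_upwards [(eventually_sign_of_deriv_pos h.2.2.1 hlt).filter_mono nhdsWithin_le_nhds,
      self_mem_nhdsWithin] with s hs hs' using hs.1 hs'
  obtain ⟨s, hs, hs'⟩ := (h1.and (Ioo_mem_nhdsLT h.1)).exists
  linarith [h.2.2.2 s hs']

theorem IsPosInterval.not_mem_Ioo (h : IsPosInterval f a b) (hs : f s = 0) : s ∉ Ioo a b :=
  fun hm => (h.2.2.2 s hm).ne' hs

/-- Two maximal positivity intervals whose closures meet coincide. -/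
theorem IsPosInterval.eq (h : IsPosInterval f a b) (h' : IsPosInterval f a' b')
    (hnd : ∀ s, f s = 0 → deriv f s ≠ 0) (hs : s ∈ Icc a b) (hs' : s ∈ Icc a' b') :
    a = a' ∧ b = b' := by
  rcases le_or_gt b a' with h1 | h1
  · have e : b = a' := le_antisymm h1 (hs'.1.trans hs.2)
    have := h.deriv_right_neg hnd
    have := h'.deriv_left_pos hnd
    rw [e] at *; linarith
  rcases le_or_gt b' a with h2 | h2
  · have e : b' = a := le_antisymm h2 (hs.1.trans hs'.2)
    have := h'.deriv_right_neg hnd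
    have := h.deriv_left_pos hnd
    rw [e] at *; linarith
  constructor
  · rcases lt_trichotomy a a' with h3 | h3 | h3
    · exact absurd ⟨h3, h1⟩ (h.not_mem_Ioo h'.2.1)
    · exact h3
    · exact absurd ⟨h3, h2⟩ (h'.not_mem_Ioo h.2.1)
  · rcases lt_trichotomy b b' with h3 | h3 | h3
    · exact absurd ⟨h1, h3⟩ (h'.not_mem_Ioo h.2.2.1)
    · exact h3
    · exact absurd ⟨h2, h3⟩ (h.not_mem_Ioo h'.2.2.1)

/-- Periodicity provides negative values on both sides of s, so there are a last nonpositive point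
before s and a first one after s; these are the ends. -/
theorem exists_isPosInterval_of_pos (hf : Continuous f) (hper : Function.Periodic f (2 * Real.pi))
    (hneg : ∃ t, f t < 0) (hs : 0 < f s) : ∃ a b, IsPosInterval f a b ∧ s ∈ Ioo a b := by
  obtain ⟨t, ht⟩ := hneg
  obtain ⟨n, hn⟩ := exists_int_gt ((s - t) / (2 * Real.pi))
  obtain ⟨k, hk⟩ := exists_int_lt ((s - t) / (2 * Real.pi))
  rw [div_lt_iff₀ Real.two_pi_pos] at hn
  rw [lt_div_iff₀ Real.two_pi_pos] at hk
  have hn' : f (t + n * (2 * Real.pi)) < 0 := by rw [hper.int_mul n t]; exact ht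
  have hk' : f (t + k * (2 * Real.pi)) < 0 := by rw [hper.int_mul k t]; exact ht
  set u := t + n * (2 * Real.pi)
  set l := t + k * (2 * Real.pi)
  have hls : l < s := by simp only [l]; linarith
  have hsu : s < u := by simp only [u]; linarith
  have hcl : IsClosed {x | f x ≤ 0} := isClosed_le hf continuous_const
  obtain ⟨a, ⟨ha, ha0⟩, hamax⟩ := (isCompact_Icc.inter_right hcl (s := Icc l s)).exists_isGreatest
    ⟨l, ⟨le_rfl, hls.le⟩, hk'.le⟩
  obtain ⟨b, ⟨hb, hb0⟩, hbmin⟩ := (isCompact_Icc.inter_right hcl (s := Icc s u)).exists_isLeast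
    ⟨u, ⟨hsu.le, le_rfl⟩, hn'.le⟩
  have has : a < s := lt_of_le_of_ne ha.2 (by rintro rfl; exact absurd ha0 (not_le.2 hs))
  have hsb : s < b := lt_of_le_of_ne hb.1 (by rintro rfl; exact absurd hb0 (not_le.2 hs))
  have hpos : ∀ x ∈ Ioo a b, 0 < f x := by
    intro x hx
    by_contra hc
    rcases le_total x s with h | h
    · exact absurd (hamax ⟨⟨ha.1.trans hx.1.le, h⟩, not_lt.1 hc⟩) (not_le.2 hx.1)
    · exact absurd (hbmin ⟨⟨h, hx.2.le.trans hb.2⟩, not_lt.1 hc⟩) (not_le.2 hx.2)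
  have hnn : ∀ x ∈ Icc a b, 0 ≤ f x := by
    have h1 : closure (Ioo a b) ⊆ {x | 0 ≤ f x} :=
      closure_minimal (fun x hx => (hpos x hx).le) (isClosed_le continuous_const hf)
    rwa [closure_Ioo (has.trans hsb).ne] at h1
  have hab := (has.trans hsb).le
  exact ⟨a, b, ⟨has.trans hsb, le_antisymm ha0 (hnn a (left_mem_Icc.2 hab)),
    le_antisymm hb0 (hnn b (right_mem_Icc.2 hab)), hpos⟩, has, hsb⟩

theorem exists_isPosInterval_left (hf : Continuous f) (hper : Function.Periodic f (2 * Real.pi))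
    (hneg : ∃ t, f t < 0) (hs : f s = 0) (hd : 0 < deriv f s) : ∃ b, IsPosInterval f s b := by
  have h1 : ∀ᶠ x in 𝓝[>] s, 0 < f x := by
    filter_upwards [(eventually_sign_of_deriv_pos hs hd).filter_mono nhdsWithin_le_nhds,
      self_mem_nhdsWithin] with x hx hx' using hx.2 hx'
  obtain ⟨u, hu, hus⟩ := (mem_nhdsGT_iff_exists_Ioo_subset).1 h1
  have hsu : s < u := hu
  have hmid : (s + u) / 2 ∈ Ioo s u := ⟨by linarith, by linarith⟩
  obtain ⟨a, b, hab, hm⟩ := exists_isPosInterval_of_pos hf hper hneg (hus hmid)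
  have : a = s := by
    rcases lt_trichotomy a s with h | h | h
    · exact absurd ⟨h, hmid.1.trans hm.2⟩ (hab.not_mem_Ioo hs)
    · exact h
    · exact absurd hab.2.1 (hus ⟨h, hm.1.trans hmid.2⟩ : 0 < f a).ne'
  exact ⟨b, this ▸ hab⟩

theorem exists_isPosInterval_right (hf : Continuous f) (hper : Function.Periodic f (2 * Real.pi))
    (hneg : ∃ t, f t < 0) (hs : f s = 0) (hd : deriv f s < 0) : ∃ a, IsPosInterval f a s := by
  have h1 : ∀ᶠ x in 𝓝[<] s, 0 < f x := by
    filter_upwards [(eventually_sign_of_deriv_neg hs hd).filter_mono nhdsWithin_le_nhds,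
      self_mem_nhdsWithin] with x hx hx' using hx.1 hx'
  obtain ⟨u, hu, hus⟩ := (mem_nhdsLT_iff_exists_Ioo_subset).1 h1
  have hsu : u < s := hu
  have hmid : (u + s) / 2 ∈ Ioo u s := ⟨by linarith, by linarith⟩
  obtain ⟨a, b, hab, hm⟩ := exists_isPosInterval_of_pos hf hper hneg (hus hmid)
  have : b = s := by
    rcases lt_trichotomy b s with h | h | h
    · exact absurd hab.2.2.1 (hus ⟨hmid.1.trans hm.2, h⟩ : 0 < f b).ne'
    · exact h
    · exact absurd ⟨hm.1.trans hmid.2, h⟩ (hab.not_mem_Ioo hs)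
  exact ⟨a, this ▸ hab⟩

theorem exists_isPosInterval_of_nonneg (hf : Continuous f)
    (hper : Function.Periodic f (2 * Real.pi)) (hneg : ∃ t, f t < 0)
    (hnd : ∀ s, f s = 0 → deriv f s ≠ 0) (hs : 0 ≤ f s) :
    ∃ a b, IsPosInterval f a b ∧ s ∈ Icc a b := by
  rcases hs.eq_or_lt with h | h
  · rcases (hnd s h.symm).lt_or_gt with hd | hd
    · obtain ⟨a, ha⟩ := exists_isPosInterval_right hf hper hneg h.symm hd
      exact ⟨a, s, ha, ha.1.le, le_rfl⟩
    · obtain ⟨b, hb⟩ := exists_isPosInterval_left hf hper hneg h.symm hd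
      exact ⟨s, b, hb, le_rfl, hb.1.le⟩
  · obtain ⟨a, b, hab, hm⟩ := exists_isPosInterval_of_pos hf hper hneg h
    exact ⟨a, b, hab, Ioo_subset_Icc_self hm⟩

/-- The zeros at the ends are simple, so f is negative just outside. Hence distinct closed
positivity intervals cannot accumulate, which is what makes unions of them closed. -/
theorem IsPosInterval.eventually_mem_Icc (h : IsPosInterval f a b)
    (hnd : ∀ s, f s = 0 → deriv f s ≠ 0) (hs : s ∈ Icc a b) :
    ∀ᶠ x in 𝓝 s, 0 ≤ f x → x ∈ Icc a b := by
  have h1 : ∀ᶠ x in 𝓝 s, 0 ≤ f x → a ≤ x := by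
    rcases hs.1.eq_or_lt with e | e
    · subst e
      filter_upwards [eventually_sign_of_deriv_pos h.2.1 (h.deriv_left_pos hnd)] with x hx h0
      by_contra hc
      linarith [hx.1 (not_le.1 hc)]
    · filter_upwards [lt_mem_nhds e] with x hx _ using le_of_lt hx
  have h2 : ∀ᶠ x in 𝓝 s, 0 ≤ f x → x ≤ b := by
    rcases hs.2.eq_or_lt with e | e
    · subst e
      filter_upwards [eventually_sign_of_deriv_neg h.2.2.1 (h.deriv_right_neg hnd)] with x hx h0
      by_contra hc
      linarith [hx.2 (not_le.1 hc)]
    · filter_upwards [gt_mem_nhds e] with x hx _ using le_of_lt hx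
  filter_upwards [h1, h2] with x hx hx' h0 using ⟨hx h0, hx' h0⟩

theorem IsPosInterval.add_int (h : IsPosInterval f a b)
    (hper : Function.Periodic f (2 * Real.pi)) (n : ℤ) :
    IsPosInterval f (a + n * (2 * Real.pi)) (b + n * (2 * Real.pi)) := by
  refine ⟨by linarith [h.1], ?_, ?_, fun s hs => ?_⟩
  · rw [hper.int_mul n a, h.2.1]
  · rw [hper.int_mul n b, h.2.2.1]
  · have := h.2.2.2 (s - n * (2 * Real.pi)) ⟨by linarith [hs.1], by linarith [hs.2]⟩
    rwa [hper.sub_int_mul_eq n] at this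

/-- The union of the closed positivity intervals selected by `J` is closed. -/
theorem isClosed_setOf_posInterval (hf : Continuous f) (hper : Function.Periodic f (2 * Real.pi))
    (hneg : ∃ t, f t < 0) (hnd : ∀ s, f s = 0 → deriv f s ≠ 0) (J : ℝ → ℝ → Prop) :
    IsClosed {s | ∃ a b, IsPosInterval f a b ∧ J a b ∧ s ∈ Icc a b} := by
  have hnn : ∀ {a b s}, IsPosInterval f a b → s ∈ Icc a b → 0 ≤ f s := by
    intro a b s h hs
    rcases hs.1.eq_or_lt with e | e
    · rw [← e, h.2.1]
    rcases hs.2.eq_or_lt with e' | e'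
    · rw [e', h.2.2.1]
    exact (h.2.2.2 s ⟨e, e'⟩).le
  rw [← isOpen_compl_iff, isOpen_iff_mem_nhds]
  intro s hs
  rcases lt_or_ge (f s) 0 with h | h
  · filter_upwards [hf.continuousAt.eventually_lt continuousAt_const h] with x hx
    rintro ⟨a, b, hab, -, hm⟩
    exact absurd (hnn hab hm) (not_le.2 hx)
  · obtain ⟨a, b, hab, hm⟩ := exists_isPosInterval_of_nonneg hf hper hneg hnd h
    filter_upwards [hab.eventually_mem_Icc hnd hm] with x hx
    rintro ⟨a', b', hab', hJ, hm'⟩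
    obtain ⟨rfl, rfl⟩ := hab.eq hab' hnd (hx (hnn hab' hm')) hm'
    exact hs ⟨a, b, hab, hJ, hm⟩

end PosInterval

/-! ### Cauchy data along a curve -/

section CurveData
open MeasureTheory

variable {f q : ℝ → ℝ}

theorem exists_bound_of_periodic {h : ℝ → ℝ} (hc : Continuous h)
    (hper : Function.Periodic h (2 * Real.pi)) : ∃ B, 0 ≤ B ∧ ∀ s, |h s| ≤ B := by
  obtain ⟨B, hB⟩ := isCompact_Icc.exists_bound_of_continuousOn
    (hc.continuousOn (s := Icc 0 (2 * Real.pi)))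
  refine ⟨B, (norm_nonneg _).trans (hB 0 ⟨le_rfl, Real.two_pi_pos.le⟩), fun s => ?_⟩
  obtain ⟨n, hn⟩ := exists_int_add_mem_Icc s
  simpa [hper.int_mul n s] using hB _ hn

theorem exists_pos_le_of_periodic {h : ℝ → ℝ} (hc : Continuous h)
    (hper : Function.Periodic h (2 * Real.pi)) (hpos : ∀ s, 0 < h s) :
    ∃ ε, 0 < ε ∧ ∀ s, ε ≤ h s := by
  obtain ⟨B, hB0, hB⟩ := exists_bound_of_periodic (h := fun s => (h s)⁻¹)
    (hc.inv₀ fun s => (hpos s).ne') (fun s => by simp [hper s])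
  refine ⟨(B + 1)⁻¹, by positivity, fun s => ?_⟩
  rw [inv_le_comm₀ (by positivity) (hpos s)]
  exact (le_abs_self _).trans ((hB s).trans (by linarith))

/-- A nonnegative f with zero integral would vanish on an open interval, against the simplicity of
its zeros. For a height speed this says that every component also descends. -/
theorem exists_neg_of_integral_eq_zero (hf : Continuous f)
    (hint : ∫ s in (0 : ℝ)..(2 * Real.pi), f s = 0) (hnd : ∀ s, f s = 0 → deriv f s ≠ 0) :
    ∃ t, f t < 0 := by
  by_contra! hcon
  have h : ∃ t, 0 < f t := by
    by_contra! h
    have h0 : f = fun _ => 0 := funext fun s => le_antisymm (h s) (hcon s)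
    exact hnd 0 (by rw [h0]) (by rw [h0]; simp)
  obtain ⟨t, ht⟩ := h
  have h1 : ∀ s ∈ Ioo 0 (2 * Real.pi), f s = 0 := by
    by_contra! hc
    obtain ⟨s, hs, hs0⟩ := hc
    exact (intervalIntegral.integral_pos Real.two_pi_pos hf.continuousOn (fun x _ => hcon x)
      ⟨s, Ioo_subset_Icc_self hs, lt_of_le_of_ne (hcon s) hs0.symm⟩).ne' hint
  have hpi : Real.pi ∈ Ioo 0 (2 * Real.pi) := ⟨Real.pi_pos, by linarith [Real.pi_pos]⟩
  have h2 : f =ᶠ[𝓝 Real.pi] fun _ => 0 := by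
    filter_upwards [isOpen_Ioo.mem_nhds hpi] with s hs using h1 s hs
  exact hnd Real.pi (h1 _ hpi) (by rw [h2.deriv_eq]; simp)

theorem contDiff_primitive {h : ℝ → ℝ} (hh : ContDiff ℝ ∞ h) :
    ContDiff ℝ ∞ (fun s => ∫ u in (0 : ℝ)..s, h u) := by
  have hd : ∀ s, HasDerivAt (fun s => ∫ u in (0 : ℝ)..s, h u) (h s) s := fun s =>
    intervalIntegral.integral_hasDerivAt_right (hh.continuous.intervalIntegrable _ _)
      hh.continuous.aestronglyMeasurable.stronglyMeasurableAtFilter hh.continuous.continuousAt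
  rw [contDiff_infty_iff_deriv]
  refine ⟨fun s => (hd s).differentiableAt, ?_⟩
  rwa [show deriv (fun s => ∫ u in (0 : ℝ)..s, h u) = h from funext fun s => (hd s).deriv]

theorem deriv_primitive {h : ℝ → ℝ} (hh : Continuous h) (s : ℝ) :
    HasDerivAt (fun s => ∫ u in (0 : ℝ)..s, h u) (h s) s :=
  intervalIntegral.integral_hasDerivAt_right (hh.intervalIntegrable _ _)
    hh.aestronglyMeasurable.stronglyMeasurableAtFilter hh.continuousAt

theorem primitive_add_two_pi {h : ℝ → ℝ} (hh : Continuous h)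
    (hper : Function.Periodic h (2 * Real.pi)) (s : ℝ) :
    ∫ u in (0 : ℝ)..(s + 2 * Real.pi), h u =
      (∫ u in (0 : ℝ)..s, h u) + ∫ u in (0 : ℝ)..(2 * Real.pi), h u := by
  have h1 := intervalIntegral.integral_add_adjacent_intervals (μ := volume)
    (hh.intervalIntegrable 0 s) (hh.intervalIntegrable s (s + 2 * Real.pi))
  rw [← h1, hper.intervalIntegral_add_eq s 0, zero_add]

/-- A smooth periodic function which is locally constant near `{f ≥ 0}`, with prescribed signs on
the closed positivity intervals. -/
theorem exists_sign_function (hf : Continuous f) (hper : Function.Periodic f (2 * Real.pi))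
    (hneg : ∃ t, f t < 0) (hnd : ∀ s, f s = 0 → deriv f s ≠ 0) {J : ℝ → ℝ → Prop}
    (hJ : ∀ a b (n : ℤ), J a b → J (a + n * (2 * Real.pi)) (b + n * (2 * Real.pi))) :
    ∃ σ : ℝ → ℝ, ContDiff ℝ ∞ σ ∧ Function.Periodic σ (2 * Real.pi) ∧
      (∀ s, 0 ≤ f s → (∀ᶠ x in 𝓝 s, σ x = 1) ∨ ∀ᶠ x in 𝓝 s, σ x = -1) ∧
      ∀ a b, IsPosInterval f a b → ∀ s ∈ Icc a b, (J a b → σ s = -1) ∧ (¬ J a b → σ s = 1) := by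
  -- On the circle the two families of closed positivity intervals become disjoint compact sets,
  -- because one period suffices. A smooth separating function of the plane, pulled back by e, is
  -- automatically periodic.
  set e : ℝ → ℝ × ℝ := fun s => (Real.cos s, Real.sin s) with he
  have hes : ContDiff ℝ ∞ e := Real.contDiff_cos.prodMk Real.contDiff_sin
  have heper : ∀ s (n : ℤ), e (s + n * (2 * Real.pi)) = e s := by
    intro s n; simp [he]
  set A : (ℝ → ℝ → Prop) → Set ℝ := fun J => {s | ∃ a b, IsPosInterval f a b ∧ J a b ∧ s ∈ Icc a b}
    with hA
  have hAcl : ∀ J, IsClosed (A J) := isClosed_setOf_posInterval hf hper hneg hnd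
  have hcl : ∀ J : ℝ → ℝ → Prop,
      (∀ a b (n : ℤ), J a b → J (a + n * (2 * Real.pi)) (b + n * (2 * Real.pi))) →
      IsClosed (e '' A J) := by
    intro J hJ
    have : e '' A J = e '' (Icc 0 (2 * Real.pi) ∩ A J) := by
      refine subset_antisymm ?_ (image_mono inter_subset_right)
      rintro _ ⟨s, ⟨a, b, hab, hj, hs⟩, rfl⟩
      obtain ⟨n, hn⟩ := exists_int_add_mem_Icc s
      exact ⟨_, ⟨hn, _, _, hab.add_int hper n, hJ a b n hj, by linarith [hs.1], by linarith [hs.2]⟩,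
        heper s n⟩
    rw [this]
    exact ((isCompact_Icc.inter_right (hAcl J)).image hes.continuous).isClosed
  have hJ' : ∀ a b (n : ℤ), ¬ J a b → ¬ J (a + n * (2 * Real.pi)) (b + n * (2 * Real.pi)) := by
    intro a b n h hc
    refine h ?_
    have := hJ _ _ (-n) hc
    push_cast at this
    simpa using this
  have hdisj : Disjoint (e '' A J) (e '' A fun a b => ¬ J a b) := by
    rw [Set.disjoint_left]
    rintro _ ⟨s, ⟨a, b, hab, hj, hs⟩, rfl⟩ ⟨s', ⟨a', b', hab', hj', hs'⟩, hss⟩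
    have h1 := Real.Angle.cos_sin_inj (congrArg Prod.fst hss) (congrArg Prod.snd hss)
    obtain ⟨n, hn⟩ := Real.Angle.angle_eq_iff_two_pi_dvd_sub.1 h1
    have e1 : s' = s + n * (2 * Real.pi) := by linarith
    obtain ⟨rfl, rfl⟩ := (hab.add_int hper n).eq hab' hnd
      (s := s') ⟨by linarith [hs.1], by linarith [hs.2]⟩ hs'
    exact hj' (hJ _ _ n hj)
  obtain ⟨S, hS, h0, h1⟩ := exists_contDiff_zero_one_nhds (hcl _ hJ) (hcl _ hJ') hdisj
  refine ⟨fun s => 2 * S (e s) - 1, (contDiff_const.mul (hS.comp hes)).sub contDiff_const,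
    fun s => by simpa using congrArg (fun p => 2 * S p - 1) (heper s 1), fun s hs => ?_,
    fun a b hab s hs => ⟨fun hj => ?_, fun hj => ?_⟩⟩
  · obtain ⟨a, b, hab, hm⟩ := exists_isPosInterval_of_nonneg hf hper hneg hnd hs
    by_cases hj : J a b
    · right
      have := eventually_nhdsSet_iff_forall.1 h0 (e s) ⟨s, ⟨a, b, hab, hj, hm⟩, rfl⟩
      filter_upwards [hes.continuous.continuousAt.eventually this] with x hx
      rw [hx]; norm_num
    · left
      have := eventually_nhdsSet_iff_forall.1 h1 (e s) ⟨s, ⟨a, b, hab, hj, hm⟩, rfl⟩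
      filter_upwards [hes.continuous.continuousAt.eventually this] with x hx
      rw [hx]; norm_num
  · simp only
    rw [h0.self_of_nhdsSet (e s) ⟨s, ⟨a, b, hab, hj, hs⟩, rfl⟩]; norm_num
  · simp only
    rw [h1.self_of_nhdsSet (e s) ⟨s, ⟨a, b, hab, hj, hs⟩, rfl⟩]; norm_num

theorem Function.Periodic.deriv_periodic {E : Type*} [NormedAddCommGroup E] [NormedSpace ℝ E]
    {h : ℝ → E} {T : ℝ} (hper : Function.Periodic h T) : Function.Periodic (deriv h) T := by
  intro s
  rw [← deriv_comp_add_const]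
  congr 1
  ext1 t
  exact hper t

/-- The Cauchy data: `G` will be the time derivative of the solution along the curve, and `κ` the
rate of rotation of its spatial Hessian. -/
theorem exists_curve_data (hf : ContDiff ℝ ∞ f) (hper : Function.Periodic f (2 * Real.pi))
    (hint : ∫ s in (0 : ℝ)..(2 * Real.pi), f s = 0) (hnd : ∀ s, f s = 0 → deriv f s ≠ 0)
    (hq : Continuous q) (hqper : Function.Periodic q (2 * Real.pi)) (hqpos : ∀ s, 0 < q s)
    {J : ℝ → ℝ → Prop}
    (hJ : ∀ a b (n : ℤ), J a b → J (a + n * (2 * Real.pi)) (b + n * (2 * Real.pi))) :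
    ∃ G κ : ℝ → ℝ, ContDiff ℝ ∞ G ∧ ContDiff ℝ ∞ κ ∧ Function.Periodic G (2 * Real.pi) ∧
      Function.Periodic κ (2 * Real.pi) ∧
      (∀ s, q s * (G s * deriv G s) + f s * (deriv G s ^ 2 + κ s ^ 2) < 0) ∧
      (∫ s in (0 : ℝ)..(2 * Real.pi), G s * f s) = 0 ∧
      ∀ a b, IsPosInterval f a b → ∀ s ∈ Icc a b, (J a b → G s < 0) ∧ (¬ J a b → 0 < G s) := by
  have hfc := hf.continuous
  obtain ⟨t, ht⟩ := exists_neg_of_integral_eq_zero hfc hint hnd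
  obtain ⟨σ, hσ, hσper, hσloc, hσJ⟩ := exists_sign_function hfc hper ⟨t, ht⟩ hnd hJ
  set W : Set ℝ := {s | (∀ᶠ x in 𝓝 s, σ x = 1) ∨ ∀ᶠ x in 𝓝 s, σ x = -1} with hW
  -- By compactness σ is still locally constant on the larger set f ≥ -c. The bound f t < -c keeps
  -- the set f < -c nonempty; all adjustments of G take place there.
  have hc : ∃ c, 0 < c ∧ f t < -c ∧ ∀ s, -c ≤ f s → s ∈ W := by
    have h1 : ∀ᶠ c in 𝓝 (0 : ℝ), ∀ s, -c ≤ f s → s ∈ W := by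
      refine eventually_forall_periodic (fun c s n h hcs => ?_) fun s => ?_
      · have hsh : Tendsto (fun x => x + n * (2 * Real.pi)) (𝓝 s) (𝓝 (s + n * (2 * Real.pi))) := by
          have : Continuous fun x : ℝ => x + n * (2 * Real.pi) := by fun_prop
          exact this.tendsto s
        have h2 := h (by rwa [hper.int_mul n s])
        rcases h2 with h2 | h2
        · left
          filter_upwards [hsh.eventually h2] with x hx
          rwa [hσper.int_mul n x] at hx
        · right
          filter_upwards [hsh.eventually h2] with x hx
          rwa [hσper.int_mul n x] at hx
      · rcases lt_or_ge (f s) 0 with h | h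
        · have hcont : Continuous fun p : ℝ × ℝ => f p.2 + p.1 := by fun_prop
          filter_upwards [hcont.continuousAt.eventually_lt (x₀ := ((0 : ℝ), s)) continuousAt_const
            (by simpa using h)] with p hp hp'
          linarith
        · have hWo : ∀ᶠ x in 𝓝 s, x ∈ W := by
            rcases hσloc s h with h2 | h2
            · exact h2.eventually_nhds.mono fun x hx => Or.inl hx
            · exact h2.eventually_nhds.mono fun x hx => Or.inr hx
          have := (continuousAt_snd (p := ((0 : ℝ), s))).eventually hWo
          exact this.mono fun p hp _ => hp
    have h2 : ∀ᶠ c in 𝓝[>] (0 : ℝ), ∀ s, -c ≤ f s → s ∈ W := h1.filter_mono nhdsWithin_le_nhds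
    obtain ⟨c, hc1, hc2⟩ := (h2.and (Ioo_mem_nhdsGT (by linarith : (0 : ℝ) < -f t))).exists
    exact ⟨c, hc2.1, by linarith [hc2.2], hc1⟩
  obtain ⟨c, hc0, hct, hcW⟩ := hc
  have hst : ContDiff ℝ ∞ Real.smoothTransition := Real.smoothTransition.contDiff
  -- β is positive where f < -c and zero elsewhere, so multiples of it do not affect the region
  -- where the sign of G matters.
  set β : ℝ → ℝ := fun s => Real.smoothTransition (-(f s) / c - 1) with hβ
  have hβs : ContDiff ℝ ∞ β := hst.comp ((hf.neg.div_const c).sub contDiff_const)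
  have hβper : Function.Periodic β (2 * Real.pi) := fun s => by simp [hβ, hper s]
  have hβ0 : ∀ s, 0 ≤ β s := fun s => Real.smoothTransition.nonneg _
  have hβz : ∀ s, -c ≤ f s → β s = 0 := by
    intro s hs
    refine Real.smoothTransition.zero_of_nonpos ?_
    rw [sub_nonpos, div_le_one hc0]; linarith
  have hβp : ∀ s, f s < -c → 0 < β s := by
    intro s hs
    refine Real.smoothTransition.pos_of_pos ?_
    rw [sub_pos, one_lt_div hc0]; linarith
  have hβd : ∀ s, -c ≤ f s → deriv β s = 0 := by
    intro s hs
    refine IsLocalMin.deriv_eq_zero (.of_forall fun x => ?_)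
    rw [hβz s hs]; exact hβ0 x
  obtain ⟨k, hk⟩ := exists_int_add_mem_Icc t
  have hft : f (t + k * (2 * Real.pi)) < -c := by rwa [hper.int_mul k t]
  have hM : 0 < ∫ s in (0 : ℝ)..(2 * Real.pi), β s :=
    intervalIntegral.integral_pos Real.two_pi_pos hβs.continuous.continuousOn (fun x _ => hβ0 x)
      ⟨_, hk, hβp _ hft⟩
  have hN : (∫ s in (0 : ℝ)..(2 * Real.pi), β s * f s) < 0 := by
    have : 0 < ∫ s in (0 : ℝ)..(2 * Real.pi), -(β s * f s) := by
      refine intervalIntegral.integral_pos Real.two_pi_pos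
        (hβs.continuous.mul hfc).neg.continuousOn (fun x _ => ?_) ⟨_, hk, ?_⟩
      · rcases le_or_gt (-c) (f x) with h | h
        · simp [hβz x h]
        · nlinarith [hβ0 x]
      · nlinarith [hβp _ hft]
    rw [intervalIntegral.integral_neg] at this
    linarith
  obtain ⟨q₀, hq0, hqq⟩ := exists_pos_le_of_periodic hq hqper hqpos
  obtain ⟨B, hB0, hB⟩ := exists_bound_of_periodic hfc hper
  -- A decay rate so small that lam f < q everywhere: q₀ is a lower bound of q and B a bound of |f|.
  set lam : ℝ := q₀ / (B + 1) with hlam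
  have hlam0 : 0 < lam := by positivity
  have hlamf : ∀ s, lam * f s < q s := by
    intro s
    have h1 : f s ≤ B := (le_abs_self _).trans (hB s)
    have h2 : lam * (B + 1) = q₀ := by rw [hlam]; field_simp
    nlinarith [hqq s]
  set M := ∫ s in (0 : ℝ)..(2 * Real.pi), β s with hMdef
  -- The logarithmic derivative of exp ψ: decay at rate lam, compensated where f < -c. The
  -- coefficient of β makes the mean zero, so that ψ is periodic.
  set θ : ℝ → ℝ := fun s => -lam + (2 * Real.pi * lam / M) * β s with hθ
  have hθs : ContDiff ℝ ∞ θ := contDiff_const.add (contDiff_const.mul hβs)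
  set ψ : ℝ → ℝ := fun s => ∫ u in (0 : ℝ)..s, θ u with hψ
  have hψs : ContDiff ℝ ∞ ψ := contDiff_primitive hθs
  have hψd : ∀ s, HasDerivAt ψ (θ s) s := deriv_primitive hθs.continuous
  have hψper : Function.Periodic ψ (2 * Real.pi) := by
    intro s
    have h1 : ∫ u in (0 : ℝ)..(2 * Real.pi), θ u = 0 := by
      rw [hθ, intervalIntegral.integral_add (by simp)
        ((hβs.continuous.intervalIntegrable _ _).const_mul _),
        intervalIntegral.integral_const_mul, intervalIntegral.integral_const, ← hMdef]
      simp only [sub_zero, smul_eq_mul]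
      field_simp
      ring
    have h2 := primitive_add_two_pi hθs.continuous (fun s => by simp [hθ, hβper s]) s
    rw [h1, add_zero] at h2
    exact h2
  set G₀ : ℝ → ℝ := fun s => σ s * Real.exp (ψ s) with hG₀
  have hG₀s : ContDiff ℝ ∞ G₀ := hσ.mul hψs.exp
  -- The multiple of β for which (G₀ + y β) f has integral zero; the denominator is negative because
  -- β lives where f < -c.
  set y : ℝ := -(∫ s in (0 : ℝ)..(2 * Real.pi), G₀ s * f s) /
    ∫ s in (0 : ℝ)..(2 * Real.pi), β s * f s with hy
  set G : ℝ → ℝ := fun s => G₀ s + y * β s with hG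
  have hGs : ContDiff ℝ ∞ G := hG₀s.add (contDiff_const.mul hβs)
  have hGper : Function.Periodic G (2 * Real.pi) := fun s => by
    simp [hG, hG₀, hσper s, hψper s, hβper s]
  have hGd : ∀ s, deriv G s = deriv σ s * Real.exp (ψ s) + σ s * (Real.exp (ψ s) * θ s) +
      y * deriv β s := by
    intro s
    exact ((((hσ.differentiable (by simp) s).hasDerivAt.mul (hψd s).exp)).add
      ((hβs.differentiable (by simp) s).hasDerivAt.const_mul y)).deriv
  have hdGc : Continuous (deriv G) := hGs.continuous_deriv (by simp)
  -- Here G = ± exp ψ and G' = -lam G, so the expression equals -lam (q - lam f) G².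
  have hGW : ∀ s, -c ≤ f s → q s * (G s * deriv G s) + f s * deriv G s ^ 2 < 0 := by
    intro s hs
    have hσ1 : deriv σ s = 0 ∧ σ s ^ 2 = 1 := by
      rcases hcW s hs with h | h
      · refine ⟨?_, by rw [h.self_of_nhds]; norm_num⟩
        rw [EventuallyEq.deriv_eq (f := fun _ => (1 : ℝ)) h]; simp
      · refine ⟨?_, by rw [h.self_of_nhds]; norm_num⟩
        rw [EventuallyEq.deriv_eq (f := fun _ => (-1 : ℝ)) h]; simp
    have e1 : G s = σ s * Real.exp (ψ s) := by simp [hG, hG₀, hβz s hs]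
    have e2 : deriv G s = -lam * (σ s * Real.exp (ψ s)) := by
      rw [hGd, hσ1.1, hβd s hs]
      simp only [hθ, hβz s hs]
      ring
    rw [e1, e2]
    have h3 : 0 < Real.exp (ψ s) ^ 2 := by positivity
    have h4 : q s * (σ s * Real.exp (ψ s) * (-lam * (σ s * Real.exp (ψ s)))) +
        f s * (-lam * (σ s * Real.exp (ψ s))) ^ 2 =
        -(lam * (q s - lam * f s) * Real.exp (ψ s) ^ 2) * σ s ^ 2 := by ring
    rw [h4, hσ1.2, mul_one, neg_lt_zero]
    exact mul_pos (mul_pos hlam0 (sub_pos.2 (hlamf s))) h3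
  obtain ⟨B', hB'0, hB'⟩ := exists_bound_of_periodic
    (h := fun s => q s * (G s * deriv G s) + f s * deriv G s ^ 2)
    ((hq.mul (hGs.continuous.mul hdGc)).add (hfc.mul (hdGc.pow 2)))
    (fun s => by simp only [hqper s, hGper s, hGper.deriv_periodic s, hper s])
  -- Where f < -c the term f K² is below -(B' + 1), which beats the bound B' of the remaining terms
  -- whatever G does there.
  set K : ℝ := √((B' + 1) / c) with hK
  have hK2 : K ^ 2 * c = B' + 1 := by
    rw [hK, Real.sq_sqrt (by positivity)]; field_simp
  -- κ is K for f ≤ -c and 0 for f ≥ -c/2. In the transition zone f is negative, so f κ² only helps.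
  set κ : ℝ → ℝ := fun s => K * Real.smoothTransition (2 * -(f s) / c - 1) with hκ
  refine ⟨G, κ, hGs, ?_, hGper, fun s => by simp [hκ, hper s], fun s => ?_, ?_, ?_⟩
  · exact contDiff_const.mul
      (hst.comp (((contDiff_const.mul hf.neg).div_const c).sub contDiff_const))
  · rcases lt_or_ge (f s) (-c) with h | h
    · have e1 : κ s = K := by
        simp only [hκ]
        rw [Real.smoothTransition.one_of_one_le, mul_one]
        rw [le_sub_iff_add_le, le_div_iff₀ hc0]; linarith
      rw [e1]
      have := (le_abs_self _).trans (hB' s)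
      have hK0 : 0 ≤ K ^ 2 := sq_nonneg K
      nlinarith
    · have h1 : f s * κ s ^ 2 ≤ 0 := by
        rcases lt_or_ge (f s) 0 with h2 | h2
        · exact mul_nonpos_of_nonpos_of_nonneg h2.le (sq_nonneg _)
        · have : κ s = 0 := by
            simp only [hκ]
            rw [Real.smoothTransition.zero_of_nonpos, mul_zero]
            rw [sub_nonpos, div_le_one hc0]; linarith
          simp [this]
      linarith [hGW s h]
  · have e1 : ∀ s, G s * f s = G₀ s * f s + y * (β s * f s) := fun s => by simp only [hG]; ring
    simp_rw [e1]
    have i1 : IntervalIntegrable (fun s => G₀ s * f s) MeasureTheory.volume 0 (2 * Real.pi) :=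
      (hG₀s.continuous.mul hfc).intervalIntegrable _ _
    have i2 : IntervalIntegrable (fun s => y * (β s * f s)) MeasureTheory.volume 0 (2 * Real.pi) :=
      ((hβs.continuous.mul hfc).intervalIntegrable _ _).const_mul y
    rw [intervalIntegral.integral_add i1 i2,
      intervalIntegral.integral_const_mul, hy, div_mul_cancel₀ _ hN.ne]
    ring
  · intro a b hab s hs
    have hfs : 0 ≤ f s := by
      rcases hs.1.eq_or_lt with e | e
      · rw [← e, hab.2.1]
      rcases hs.2.eq_or_lt with e' | e'
      · rw [e', hab.2.2.1]
      exact (hab.2.2.2 s ⟨e, e'⟩).le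
    have e1 : G s = σ s * Real.exp (ψ s) := by simp [hG, hG₀, hβz s (by linarith)]
    refine ⟨fun h => ?_, fun h => ?_⟩
    · rw [e1, (hσJ a b hab s hs).1 h]; linarith [Real.exp_pos (ψ s)]
    · rw [e1, (hσJ a b hab s hs).2 h]; linarith [Real.exp_pos (ψ s)]

end CurveData

/-! ### Approximate solutions of the heat equation near a link -/

section Jet

theorem eq_sum_single (v : Spacetime) : v = v 0 • EuclideanSpace.single 0 (1 : ℝ) +
    v 1 • EuclideanSpace.single 1 (1 : ℝ) + v 2 • EuclideanSpace.single 2 (1 : ℝ) := by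
  ext i
  fin_cases i <;> simp

theorem fderiv_apply_eq (u : Spacetime → ℝ) (ξ v : Spacetime) :
    fderiv ℝ u ξ v = v 0 * pderiv 0 u ξ + v 1 * pderiv 1 u ξ + v 2 * pderiv 2 u ξ := by
  conv_lhs => rw [eq_sum_single v]
  simp [pderiv]

theorem pderiv_comm {u : Spacetime → ℝ} (hu : ContDiff ℝ 2 u) (i j : Fin 3) (ξ : Spacetime) :
    pderiv i (pderiv j u) ξ = pderiv j (pderiv i u) ξ := by
  have hd : DifferentiableAt ℝ (fderiv ℝ u) ξ :=
    (hu.fderiv_right (m := 1) (by norm_num)).differentiable (by norm_num) ξ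
  have h := (hu.contDiffAt (x := ξ)).isSymmSndFDerivAt (by simp)
  have e : ∀ i j : Fin 3, pderiv i (pderiv j u) ξ =
      fderiv ℝ (fderiv ℝ u) ξ (EuclideanSpace.single i 1) (EuclideanSpace.single j 1) := by
    intro i j
    have : pderiv j u = fun ξ => fderiv ℝ u ξ (EuclideanSpace.single j 1) := rfl
    rw [pderiv, this, fderiv_clm_apply hd (differentiableAt_const _)]
    simp
  rw [e, e]
  exact h _ _

/-- The determinant of the vector `p` and the spacetime gradients of `v_x` and `v_y`. -/
noncomputable def jetDet (v : Spacetime → ℝ) (ξ p : Spacetime) : ℝ :=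
  p 0 * (pderiv 1 (pderiv 0 v) ξ * pderiv 2 (pderiv 1 v) ξ -
      pderiv 2 (pderiv 0 v) ξ * pderiv 1 (pderiv 1 v) ξ) +
    p 1 * (pderiv 2 (pderiv 0 v) ξ * pderiv 0 (pderiv 1 v) ξ -
      pderiv 0 (pderiv 0 v) ξ * pderiv 2 (pderiv 1 v) ξ) +
    p 2 * spatialHessianDet v ξ

/-- Here (p0 + a f, p1 + b f, f) is the tangent, A, B, C are the entries of the spatial Hessian, and
(k1, k2) is the spatial gradient of the slanted derivative. The five linear equations determine
these unknowns: two come from prescribing the slanted derivative, two from w_x = w_y = 0 along the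
curve, one from the heat equation. Solving them shows that ∇w_x × ∇w_y is -X/q² times the tangent,
so the determinant is -X/q² times the squared length of the tangent. -/
theorem jet_det_pos {p0 p1 f a b G G' κ A B C k1 k2 : ℝ} (hq : 0 < p0 ^ 2 + p1 ^ 2)
    (hX : (p0 ^ 2 + p1 ^ 2) * (G * G') + f * (G' ^ 2 + κ ^ 2) < 0)
    (h1 : p0 * k1 + p1 * k2 = G') (h2 : -p1 * k1 + p0 * k2 = κ) (h3 : p0 * A + p1 * B + f * k1 = 0)
    (h4 : p0 * B + p1 * C + f * k2 = 0) (h5 : A + C = G) :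
    0 < (p0 + a * f) * (B * (k2 - a * B - b * C) - (k1 - a * A - b * B) * C) +
      (p1 + b * f) * ((k1 - a * A - b * B) * B - A * (k2 - a * B - b * C)) +
      f * (A * C - B * B) := by
  set q := p0 ^ 2 + p1 ^ 2 with hqd
  have e1 : q * k1 = p0 * G' - p1 * κ := by rw [hqd, ← h1, ← h2]; ring
  have e2 : q * k2 = p1 * G' + p0 * κ := by rw [hqd, ← h1, ← h2]; ring
  have hA : q ^ 2 * A = -p0 ^ 2 * (f * G') + 2 * p0 * p1 * (f * κ) +
      p1 ^ 2 * (q * G + f * G') := by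
    rw [← h1, ← h2, ← h5, hqd]
    linear_combination (p0 ^ 3 + p0 * p1 ^ 2) * h3 - (p1 ^ 3 + p0 ^ 2 * p1) * h4
  have hC : q ^ 2 * C = -p1 ^ 2 * (f * G') - 2 * p0 * p1 * (f * κ) +
      p0 ^ 2 * (q * G + f * G') := by
    rw [← h1, ← h2, ← h5, hqd]
    linear_combination (p1 ^ 3 + p1 * p0 ^ 2) * h4 - (p0 ^ 3 + p0 * p1 ^ 2) * h3
  have hB : q ^ 2 * B = -p0 * p1 * (f * G') - (p0 ^ 2 - p1 ^ 2) * (f * κ) -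
      p0 * p1 * (q * G + f * G') := by
    rw [← h1, ← h2, ← h5, hqd]
    linear_combination (p1 ^ 3 + p0 ^ 2 * p1) * h3 + (p0 ^ 3 + p0 * p1 ^ 2) * h4
  set X := q * (G * G') + f * (G' ^ 2 + κ ^ 2) with hXd
  have n2 : q ^ 4 * (A * C - B * B) = q ^ 2 * -X * f := by
    have : q ^ 4 * (A * C - B * B) = (q ^ 2 * A) * (q ^ 2 * C) - (q ^ 2 * B) * (q ^ 2 * B) := by
      ring
    rw [this, hA, hB, hC, hXd, hqd]
    ring
  have n0 : q ^ 4 * (B * k2 - k1 * C) = q ^ 2 * -X * p0 := by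
    have : q ^ 4 * (B * k2 - k1 * C) =
        q * ((q ^ 2 * B) * (q * k2) - (q * k1) * (q ^ 2 * C)) := by ring
    rw [this, e1, e2, hB, hC, hXd, hqd]
    ring
  have n1 : q ^ 4 * (k1 * B - A * k2) = q ^ 2 * -X * p1 := by
    have : q ^ 4 * (k1 * B - A * k2) =
        q * ((q * k1) * (q ^ 2 * B) - (q ^ 2 * A) * (q * k2)) := by ring
    rw [this, e1, e2, hA, hB, hXd, hqd]
    ring
  have hpos : 0 < (p0 + a * f) ^ 2 + (p1 + b * f) ^ 2 + f ^ 2 := by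
    rcases eq_or_ne f 0 with hf | hf
    · simpa [hf, hqd] using hq
    · positivity
  have key : q ^ 4 * ((p0 + a * f) * (B * (k2 - a * B - b * C) - (k1 - a * A - b * B) * C) +
      (p1 + b * f) * ((k1 - a * A - b * B) * B - A * (k2 - a * B - b * C)) +
      f * (A * C - B * B)) =
      q ^ 2 * -X * ((p0 + a * f) ^ 2 + (p1 + b * f) ^ 2 + f ^ 2) := by
    linear_combination (p0 + a * f) * n0 + (p1 + b * f) * n1 +
      ((p0 + a * f) * a + (p1 + b * f) * b + f) * n2
  have hX' : 0 < -X := neg_pos.2 hX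
  exact pos_of_mul_pos_right (key ▸ by positivity) (by positivity : (0 : ℝ) ≤ q ^ 4)

end Jet

/-! ### The 2-jet on the curve determined by the Cauchy data -/

section CurveJet

theorem fderiv_apply_of_eventuallyEq {u : Spacetime → ℝ} (hu : Differentiable ℝ u)
    {x : ℝ → Spacetime} {v : Spacetime} {t : ℝ} (hx : HasDerivAt x v t) {g : ℝ → ℝ} {g' : ℝ}
    (hg : HasDerivAt g g' t) (h : ∀ᶠ t' in 𝓝 t, u (x t') = g t') : fderiv ℝ u (x t) v = g' :=
  ((((hu (x t)).hasFDerivAt).comp_hasDerivAt t hx).congr_of_eventuallyEq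
    (h.mono fun _ h => h.symm)).unique hg

theorem hasDerivAt_add_smul (x v : Spacetime) (t : ℝ) : HasDerivAt (fun t : ℝ => x + t • v) v t := by
  simpa using ((hasDerivAt_id t).smul_const v).const_add x

theorem ContDiff.deriv_infty {E : Type*} [NormedAddCommGroup E] [NormedSpace ℝ E] {f : ℝ → E}
    (hf : ContDiff ℝ ∞ f) : ContDiff ℝ ∞ (deriv f) := ContDiff.iterate_deriv 1 hf

variable {c : ℝ → Spacetime} {a b ρ : ℝ} {F G κ : ℝ → ℝ} {w Q : Spacetime → ℝ}

theorem slantTube_add_ofReal (s : ℝ) (ζ : ℂ) (t : ℝ) :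
    slantTube c a b (s, ζ + t) = slantTube c a b (s, ζ) + t • slantDir a b := by
  simp [slantTube, add_smul]; abel

theorem slantTube_mul_I (s t : ℝ) :
    slantTube c a b (s, t * Complex.I) = c s + t • slantNormal c a b s := by
  simp [slantTube]

/-- A step in the slanted direction changes only the real part of the tube coordinate, so the
expansion is differentiated in that variable with s and Im ζ fixed. -/
theorem fderiv_slantDir (hw : ContDiff ℝ ∞ w) (hQ : ContDiff ℝ ∞ Q)
    (hY : ∀ p : ℝ × ℂ, ‖p.2‖ < ρ → w (slantTube c a b p) =
      F p.1 + G p.1 * p.2.re + κ p.1 * (p.2.re * p.2.im) + p.2.im ^ 2 * Q (slantTube c a b p))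
    {s : ℝ} {ζ : ℂ} (hζ : ‖ζ‖ < ρ) : fderiv ℝ w (slantTube c a b (s, ζ)) (slantDir a b) =
      G s + κ s * ζ.im + ζ.im ^ 2 * fderiv ℝ Q (slantTube c a b (s, ζ)) (slantDir a b) := by
  have hx := hasDerivAt_add_smul (slantTube c a b (s, ζ)) (slantDir a b) 0
  have hQd : HasDerivAt (fun t : ℝ => Q (slantTube c a b (s, ζ) + t • slantDir a b))
      (fderiv ℝ Q (slantTube c a b (s, ζ)) (slantDir a b)) 0 := by
    have := (hQ.differentiable_infty (slantTube c a b (s, ζ) +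
      (0 : ℝ) • slantDir a b)).hasFDerivAt.comp_hasDerivAt 0 hx
    simpa [Function.comp_def] using this
  have hre : HasDerivAt (fun t : ℝ => ζ.re + t) 1 0 := (hasDerivAt_id (0 : ℝ)).const_add ζ.re
  have hg := (((hre.const_mul (G s)).const_add (F s)).add
    ((hre.mul_const ζ.im).const_mul (κ s))).add (hQd.const_mul (ζ.im ^ 2))
  have := fderiv_apply_of_eventuallyEq (t := 0) hw.differentiable_infty hx hg ?_
  · simpa using this
  · have hc : ContinuousAt (fun t : ℝ => ‖ζ + t‖) 0 := by fun_prop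
    filter_upwards [hc.eventually_lt continuousAt_const (by simpa using hζ)] with t ht
    have := hY (s, ζ + t) ht
    rw [slantTube_add_ofReal] at this
    simpa using this

/-- The derivatives of w in the tangent, slanted and normal directions are G f, G and 0, where f is
the time component of the tangent; the only gradient compatible with them is (0, 0, G). This is why
F' must be G f. Differentiating the slanted derivative in the same three directions then supplies
the hypotheses of `jet_det_pos`. -/
theorem jet_of_slantTube (hc : ContDiff ℝ ∞ c)
    (hq : ∀ s, 0 < (deriv c s 0 - a * deriv c s 2) ^ 2 + (deriv c s 1 - b * deriv c s 2) ^ 2)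
    (hF : ∀ s, HasDerivAt F (G s * deriv c s 2) s) (hG : ContDiff ℝ ∞ G)
    (hw : ContDiff ℝ ∞ w) (hQ : ContDiff ℝ ∞ Q) (hρ : 0 < ρ)
    (hY : ∀ p : ℝ × ℂ, ‖p.2‖ < ρ → w (slantTube c a b p) =
      F p.1 + G p.1 * p.2.re + κ p.1 * (p.2.re * p.2.im) + p.2.im ^ 2 * Q (slantTube c a b p))
    (hheat : ∀ s, heatOp w (c s) = 0)
    (hX : ∀ s, ((deriv c s 0 - a * deriv c s 2) ^ 2 + (deriv c s 1 - b * deriv c s 2) ^ 2) *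
      (G s * deriv G s) + deriv c s 2 * (deriv G s ^ 2 + κ s ^ 2) < 0) (s : ℝ) :
    pderiv 0 w (c s) = 0 ∧ pderiv 1 w (c s) = 0 ∧ pderiv 2 w (c s) = G s ∧
      0 < jetDet w (c s) (deriv c s) := by
  have hcd : ∀ s, HasDerivAt c (deriv c s) s := fun s => (hc.differentiable_infty s).hasDerivAt
  have hnorm : ∀ᶠ t : ℝ in 𝓝 0, ‖(t * Complex.I : ℂ)‖ < ρ := by
    have hc : ContinuousAt (fun t : ℝ => ‖(t * Complex.I : ℂ)‖) 0 := by fun_prop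
    exact hc.eventually_lt continuousAt_const (by simpa using hρ)
  -- first derivatives along the curve
  have grad : ∀ s, pderiv 0 w (c s) = 0 ∧ pderiv 1 w (c s) = 0 ∧ pderiv 2 w (c s) = G s := by
    intro s
    have d1 : fderiv ℝ w (c s) (deriv c s) = G s * deriv c s 2 :=
      fderiv_apply_of_eventuallyEq hw.differentiable_infty (hcd s) (hF s)
        (.of_forall fun t => by simpa [slantTube_zero] using hY (t, 0) (by simpa))
    have d2 : fderiv ℝ w (c s) (slantDir a b) = G s := by
      simpa [slantTube_zero] using fderiv_slantDir hw hQ hY (s := s) (ζ := 0) (by simpa)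
    have hx := hasDerivAt_add_smul (c s) (slantNormal c a b s) 0
    have hQd := (hQ.differentiable_infty (c s +
      (0 : ℝ) • slantNormal c a b s)).hasFDerivAt.comp_hasDerivAt 0 hx
    have d3 := fderiv_apply_of_eventuallyEq hw.differentiable_infty hx
      ((((hasDerivAt_id (0 : ℝ)).fun_pow 2).mul hQd).const_add (F s)) (by
        filter_upwards [hnorm] with t ht
        simpa [slantTube_mul_I] using hY (s, t * Complex.I) ht)
    rw [fderiv_apply_eq] at d1 d2 d3
    simp [slantDir, slantNormal] at d2 d3
    set p0 := deriv c s 0 - a * deriv c s 2 with hp0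
    set p1 := deriv c s 1 - b * deriv c s 2 with hp1
    have k0 : p0 * pderiv 0 w (c s) + p1 * pderiv 1 w (c s) = 0 := by
      rw [hp0, hp1]; linear_combination d1 - deriv c s 2 * d2
    have k1 : -p1 * pderiv 0 w (c s) + p0 * pderiv 1 w (c s) = 0 := by
      rw [hp0, hp1]; linear_combination d3
    have e0 : pderiv 0 w (c s) = 0 := by
      have : (p0 ^ 2 + p1 ^ 2) * pderiv 0 w (c s) = 0 := by linear_combination p0 * k0 - p1 * k1
      exact (mul_eq_zero.1 this).resolve_left (hq s).ne'
    have e1 : pderiv 1 w (c s) = 0 := by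
      have : (p0 ^ 2 + p1 ^ 2) * pderiv 1 w (c s) = 0 := by linear_combination p1 * k0 + p0 * k1
      exact (mul_eq_zero.1 this).resolve_left (hq s).ne'
    exact ⟨e0, e1, by rw [e0, e1] at d2; linarith⟩
  refine ⟨(grad s).1, (grad s).2.1, (grad s).2.2, ?_⟩
  -- derivatives of the slanted derivative
  set D : Spacetime → ℝ := fun ξ => fderiv ℝ w ξ (slantDir a b) with hD
  have hDs : ContDiff ℝ ∞ D := contDiff_fderiv_dir hw (by simp) _
  have hDe : D = fun ξ => a * pderiv 0 w ξ + b * pderiv 1 w ξ + pderiv 2 w ξ := by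
    ext ξ; simp [hD, fderiv_apply_eq, slantDir]
  have hdi : ∀ i, Differentiable ℝ (pderiv i w) := fun i => (hw.pderiv i).differentiable_infty
  have hDi : ∀ i, pderiv i D (c s) = a * pderiv i (pderiv 0 w) (c s) +
      b * pderiv i (pderiv 1 w) (c s) + pderiv i (pderiv 2 w) (c s) := by
    intro i
    rw [hDe, pderiv_add (((hdi 0).const_mul a).fun_add ((hdi 1).const_mul b)) (hdi 2),
      pderiv_add ((hdi 0).const_mul a) ((hdi 1).const_mul b), pderiv_const_mul (hdi 0),
      pderiv_const_mul (hdi 1)]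
  have D1 : fderiv ℝ D (c s) (deriv c s) = deriv G s :=
    fderiv_apply_of_eventuallyEq hDs.differentiable_infty (hcd s)
      (hG.differentiable_infty s).hasDerivAt
      (.of_forall fun t => by
        simpa [slantTube_zero] using fderiv_slantDir hw hQ hY (s := t) (ζ := 0) (by simpa))
  -- The data are affine in Re ζ on the strip z = 0, so the slanted derivative is constantly G s
  -- along the slanted line through c s.
  have D2 : fderiv ℝ D (c s) (slantDir a b) = deriv G s * 0 := by
    have hdir : ∀ᶠ t : ℝ in 𝓝 0, ‖(t : ℂ)‖ < ρ := by
      have hc : ContinuousAt (fun t : ℝ => ‖(t : ℂ)‖) 0 := by fun_prop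
      exact hc.eventually_lt continuousAt_const (by simpa using hρ)
    have := fderiv_apply_of_eventuallyEq (t := 0) hDs.differentiable_infty
      (hasDerivAt_add_smul (c s) (slantDir a b) 0) (hasDerivAt_const 0 (G s)) (by
        filter_upwards [hdir] with t ht
        have h1 := fderiv_slantDir hw hQ hY (s := s) (ζ := 0 + t) (by simpa using ht)
        rw [slantTube_add_ofReal, slantTube_zero] at h1
        simpa using h1)
    simpa using this
  have hx := hasDerivAt_add_smul (c s) (slantNormal c a b s) 0
  have hBd := ((contDiff_fderiv_dir hQ (m := (∞ : ℕ∞ω)) (by simp)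
    (slantDir a b)).differentiable_infty
    (c s + (0 : ℝ) • slantNormal c a b s)).hasFDerivAt.comp_hasDerivAt 0 hx
  -- In the normal direction only the mixed term of the data contributes, with derivative κ s; the
  -- unknown Q enters at second order in z.
  have D3 := fderiv_apply_of_eventuallyEq hDs.differentiable_infty hx
    ((((hasDerivAt_id (0 : ℝ)).const_mul (κ s)).const_add (G s)).add
      (((hasDerivAt_id (0 : ℝ)).fun_pow 2).mul hBd)) (by
      filter_upwards [hnorm] with t ht
      simpa [slantTube_mul_I] using fderiv_slantDir hw hQ hY (s := s) ht)
  have W : ∀ i, (i = 0 ∨ i = 1) → fderiv ℝ (pderiv i w) (c s) (deriv c s) = 0 := by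
    rintro i hi
    refine fderiv_apply_of_eventuallyEq (hdi i) (hcd s) (hasDerivAt_const s 0)
      (.of_forall fun t => ?_)
    rcases hi with rfl | rfl
    exacts [(grad t).1, (grad t).2.1]
  have W0 := W 0 (.inl rfl)
  have W1 := W 1 (.inr rfl)
  rw [fderiv_apply_eq] at D1 D2 D3 W0 W1
  simp [slantDir, slantNormal] at D2 D3
  have hw2 : ContDiff ℝ 2 w := hw.of_le ENat.LEInfty.out
  have c10 := pderiv_comm hw2 1 0 (c s)
  have c20 := pderiv_comm hw2 2 0 (c s)
  have c21 := pderiv_comm hw2 2 1 (c s)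
  have hh := hheat s
  rw [heatOp, (grad s).2.2] at hh
  have i0 := hDi 0
  have i1 := hDi 1
  rw [c10, c20] at W0
  rw [c21] at W1
  rw [c10] at i1
  have := jet_det_pos (hq s) (hX s) (f := deriv c s 2) (a := a) (b := b) (κ := κ s)
    (A := pderiv 0 (pderiv 0 w) (c s)) (B := pderiv 0 (pderiv 1 w) (c s))
    (C := pderiv 1 (pderiv 1 w) (c s)) (k1 := pderiv 0 D (c s)) (k2 := pderiv 1 D (c s))
    (by linear_combination D1 - deriv c s 2 * D2) (by linear_combination D3)
    (by rw [i0]; linear_combination W0) (by rw [i1]; linear_combination W1) (by linarith)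
  refine this.trans_eq ?_
  rw [jetDet, spatialHessianDet, c20, c21, c10, i0, i1]
  ring

end CurveJet

/-! ### Construction of the approximate solution -/

section ApproxSolution

variable {m : ℕ}

theorem isCompact_linkSet {γ : Fin m → ℝ → Spacetime} (hγ : IsOrientedLink γ) :
    IsCompact (linkSet γ) :=
  isCompact_iUnion fun i =>
    (hγ.periodic i).compact_of_continuous Real.two_pi_pos.ne' (hγ.smooth i).continuous

theorem deriv_heightAlong {c : ℝ → Spacetime} {s : ℝ} (hc : DifferentiableAt ℝ c s) :
    deriv (heightAlong c) s = deriv c s 2 :=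
  (((EuclideanSpace.proj (𝕜 := ℝ) (2 : Fin 3)).hasFDerivAt).comp_hasDerivAt s hc.hasDerivAt).deriv

theorem exists_tube_of_eventually {Y : Fin m → ℝ × ℂ → Spacetime} {γ : Fin m → ℝ → Spacetime}
    (hY : ∀ i, Continuous (Y i))
    (hper : ∀ i s ζ (n : ℤ), Y i (s + n * (2 * Real.pi), ζ) = Y i (s, ζ))
    (hcore : ∀ i s, Y i (s, 0) = γ i s) {P : Spacetime → Prop}
    (hP : ∀ᶠ ξ in 𝓝ˢ (linkSet γ), P ξ) :
    ∃ ρ, 0 < ρ ∧ ∀ i p, ‖p.2‖ < ρ → P (Y i p) := by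
  have h : ∀ᶠ ζ in 𝓝 (0 : ℂ), ∀ i s, P (Y i (s, ζ)) := by
    refine eventually_all.2 fun i => eventually_forall_periodic (fun ζ s n h => ?_) fun s => ?_
    · rwa [hper] at h
    · have hc : ContinuousAt (fun q : ℂ × ℝ => Y i (q.2, q.1)) (0, s) :=
        ((hY i).comp (by fun_prop)).continuousAt
      refine hc.eventually (hP.filter_mono (nhds_le_nhdsSet ?_))
      simp only [hcore]
      exact mem_iUnion.2 ⟨i, mem_range_self s⟩
  obtain ⟨ρ, hρ, h⟩ := Metric.eventually_nhds_iff.1 h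
  exact ⟨ρ, hρ, fun i p hp => h (by simpa using hp) i p.1⟩

theorem eventually_nhdsSet_linkSet {γ : Fin m → ℝ → Spacetime} {P : Spacetime → Prop}
    (h : ∀ i s, ∀ᶠ ξ in 𝓝 (γ i s), P ξ) : ∀ᶠ ξ in 𝓝ˢ (linkSet γ), P ξ := by
  rw [eventually_nhdsSet_iff_forall]
  intro ξ hξ
  obtain ⟨i, s, rfl⟩ := mem_iUnion.1 hξ
  exact h i s

/-- An approximate solution `w` of the heat equation near a link all of whose points are critical
points of the prescribed type, with an error of order `k` along the surface `z = 0` which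
contains the link. -/
structure IsApproxSolution (γ : Fin m → ℝ → Spacetime) (Lmax : Set (Set Spacetime)) (k : ℕ)
    (Y : Fin m → ℝ × ℂ → Spacetime) (ρ : ℝ) (w z R : Spacetime → ℝ) : Prop where
  tube : IsTube Y ρ
  core : ∀ i s, Y i (s, 0) = γ i s
  contDiff_w : ContDiff ℝ ∞ w
  contDiff_z : ContDiff ℝ ∞ z
  contDiff_R : ContDiff ℝ ∞ R
  hasCompactSupport_R : HasCompactSupport R
  z_apply : ∀ i p, ‖p.2‖ < ρ → z (Y i p) = p.2.im
  heat : ∀ i p, ‖p.2‖ < ρ → heatOp w (Y i p) = p.2.im ^ k * R (Y i p)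
  mem_positiveTimes : ∀ i p, ‖p.2‖ < ρ → Y i p ∈ positiveTimes
  critical : ∀ i s, pderiv 0 w (γ i s) = 0 ∧ pderiv 1 w (γ i s) = 0
  jet : ∀ i s, 0 < jetDet w (γ i s) (deriv (γ i) s)
  sign : ∀ i a b, IsPosInterval (deriv (heightAlong (γ i))) a b → ∀ s ∈ Icc a b,
    (γ i '' Ioo a b ∈ Lmax → pderiv 2 w (γ i s) < 0) ∧
      (γ i '' Ioo a b ∉ Lmax → 0 < pderiv 2 w (γ i s))

/-- The height speed has integral zero because the curve closes up, as `exists_curve_data` requires.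
F is a primitive of G times the height speed, periodic by the integral condition on G. -/
theorem exists_component_data {c : ℝ → Spacetime} (hc : ContDiff ℝ ∞ c)
    (hper : Function.Periodic c (2 * Real.pi)) (hreg : ∀ s, deriv c s ≠ 0)
    (hnd : ∀ s, deriv (heightAlong c) s = 0 → deriv (deriv (heightAlong c)) s ≠ 0)
    (Lmax : Set (Set Spacetime)) :
    ∃ (a b : ℝ) (F G κ : ℝ → ℝ),
      (∀ s, 0 < (deriv c s 0 - a * deriv c s 2) ^ 2 + (deriv c s 1 - b * deriv c s 2) ^ 2) ∧
      ContDiff ℝ ∞ F ∧ ContDiff ℝ ∞ G ∧ ContDiff ℝ ∞ κ ∧ Function.Periodic F (2 * Real.pi) ∧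
      Function.Periodic G (2 * Real.pi) ∧ Function.Periodic κ (2 * Real.pi) ∧
      (∀ s, HasDerivAt F (G s * deriv c s 2) s) ∧
      (∀ s, ((deriv c s 0 - a * deriv c s 2) ^ 2 + (deriv c s 1 - b * deriv c s 2) ^ 2) *
        (G s * deriv G s) + deriv c s 2 * (deriv G s ^ 2 + κ s ^ 2) < 0) ∧
      ∀ a b, IsPosInterval (deriv (heightAlong c)) a b → ∀ s ∈ Icc a b,
        (c '' Ioo a b ∈ Lmax → G s < 0) ∧ (c '' Ioo a b ∉ Lmax → 0 < G s) := by
  obtain ⟨a, b, hab⟩ := exists_slope_ne hc hreg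
  have hdi : ∀ i, Continuous (fun s => deriv c s i) := fun i =>
    (contDiff_euclidean.1 hc.deriv_infty i).continuous
  have hf : deriv (heightAlong c) = fun s => deriv c s 2 :=
    funext fun s => deriv_heightAlong (hc.differentiable_infty s)
  have hfs : ContDiff ℝ ∞ (fun s => deriv c s 2) := contDiff_euclidean.1 hc.deriv_infty 2
  have hdper := hper.deriv_periodic
  have hint : ∫ s in (0 : ℝ)..(2 * Real.pi), deriv c s 2 = 0 := by
    have := intervalIntegral.integral_eq_sub_of_hasDerivAt (f := fun s => c s 2)
      (f' := fun s => deriv c s 2) (a := 0) (b := 2 * Real.pi) (fun s _ =>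
      ((EuclideanSpace.proj (𝕜 := ℝ) (2 : Fin 3)).hasFDerivAt).comp_hasDerivAt s
        (hc.differentiable_infty s).hasDerivAt) (hfs.continuous.intervalIntegrable _ _)
    rw [this, hper.eq, sub_self]
  have himage : ∀ (a b : ℝ) (n : ℤ), c '' Ioo a b ∈ Lmax →
      c '' Ioo (a + n * (2 * Real.pi)) (b + n * (2 * Real.pi)) ∈ Lmax := by
    intro a b n h
    rw [← Set.image_add_const_Ioo, image_image]
    simpa only [hper.int_mul n _] using h
  obtain ⟨G, κ, hG, hκ, hGper, hκper, hX, hGf, hsign⟩ := exists_curve_data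
    (q := fun s => (deriv c s 0 - a * deriv c s 2) ^ 2 + (deriv c s 1 - b * deriv c s 2) ^ 2)
    (J := fun a b => c '' Ioo a b ∈ Lmax) hfs (fun s => by simp only [hdper s]) hint
    (by rwa [hf] at hnd) ((((hdi 0).sub ((hdi 2).const_mul a)).pow 2).add
      (((hdi 1).sub ((hdi 2).const_mul b)).pow 2)) (fun s => by simp only [hdper s]) hab himage
  refine ⟨a, b, fun s => ∫ u in (0 : ℝ)..s, G u * deriv c u 2, G, κ, hab,
    contDiff_primitive (hG.mul hfs), hG, hκ, fun s => ?_, hGper, hκper,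
    deriv_primitive (hG.mul hfs).continuous, hX, by rwa [hf]⟩
  have := primitive_add_two_pi (hG.mul hfs).continuous
    (fun s => by simp only [hdper s, hGper s]) s
  rwa [hGf, add_zero] at this

/-- The Cauchy data and z are written in tube coordinates, descended to spacetime and cut off, and
then fed to the formal solution. With k ≠ 0 the heat equation holds exactly on the link, which is
needed to identify the trace of the Hessian with w_t there. -/
theorem exists_isApproxSolution {γ : Fin m → ℝ → Spacetime} (hγ : IsOrientedLink γ)
    (hgen : InGeneralPosition γ) (Lmax : Set (Set Spacetime)) {k : ℕ} (hk : k ≠ 0) :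
    ∃ Y ρ w z R, IsApproxSolution γ Lmax k Y ρ w z R := by
  choose a b F G κ hab hF hG hκ hFper hGper hκper hFG hX hsign using fun i =>
    exists_component_data (hγ.smooth i) (hγ.periodic i) (hγ.regular i) (hgen i) Lmax
  set Y : Fin m → ℝ × ℂ → Spacetime := fun i => slantTube (γ i) (a i) (b i) with hYdef
  have hY : ∀ i, ContDiff ℝ ∞ (Y i) := fun i => contDiff_slantTube (hγ.smooth i)
  have hper : ∀ i s ζ (n : ℤ), Y i (s + n * (2 * Real.pi), ζ) = Y i (s, ζ) := fun i s ζ n =>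
    slantTube_periodic (hγ.periodic i) s ζ n
  have hcore : ∀ i s, Y i (s, 0) = γ i s := fun i s => slantTube_zero s
  have hL := isCompact_linkSet hγ
  obtain ⟨ρ₁, hT⟩ := (exists_isTube hY hper
    (fun i s => isInvertible_fderiv_slantTube (hγ.smooth i) (hab i s))
    (fun i j s s' h => hγ.simple i j s s' (by rwa [hcore, hcore] at h))).exists
  have hmem : ∀ i s, γ i s ∈ ⋃ i, Y i '' {p | ‖p.2‖ < ρ₁} := fun i s =>
    mem_iUnion.2 ⟨i, (s, 0), by simpa using hT.pos, hcore i s⟩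
  have hU : IsOpen (⋃ i, Y i '' {p | ‖p.2‖ < ρ₁}) := isOpen_iUnion fun i =>
    hT.isOpen_image i (isOpen_lt (by fun_prop) continuous_const) fun p hp => hp
  have hLU : linkSet γ ⊆ ⋃ i, Y i '' {p | ‖p.2‖ < ρ₁} := by
    rintro ξ hξ
    obtain ⟨i, s, rfl⟩ := mem_iUnion.1 hξ
    exact hmem i s
  -- descent of functions of the tube coordinates
  have desc : ∀ H : Fin m → ℝ × ℂ → ℝ, (∀ i, ContDiff ℝ ∞ (H i)) →
      (∀ i s ζ, H i (s + 2 * Real.pi, ζ) = H i (s, ζ)) →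
      ∃ g : Spacetime → ℝ, ContDiff ℝ ∞ g ∧
        ∃ ρ, 0 < ρ ∧ ∀ i p, ‖p.2‖ < ρ → g (Y i p) = H i p := by
    intro H hH hHper
    have hHper' : ∀ i s ζ (n : ℤ), H i (s + n * (2 * Real.pi), ζ) = H i (s, ζ) := fun i s ζ n =>
      (show Function.Periodic (fun s => H i (s, ζ)) (2 * Real.pi) from
        fun s => hHper i s ζ).int_mul n s
    obtain ⟨g, hg, -, h⟩ := exists_contDiff_hasCompactSupport_eventuallyEq hL hU hLU
      (f := tubeDesc Y ρ₁ H) (by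
        rintro ξ hξ
        obtain ⟨i, p, hp, rfl⟩ := mem_iUnion.1 hξ
        exact (hT.contDiffAt_tubeDesc' hHper' le_rfl hp (hH i).contDiffAt).contDiffWithinAt)
    obtain ⟨ρ, hρ, h⟩ := exists_tube_of_eventually (fun i => (hY i).continuous) hper hcore h
    refine ⟨g, hg, min ρ ρ₁, lt_min hρ hT.pos, fun i p hp => ?_⟩
    rw [h i p (hp.trans_le (min_le_left _ _)), hT.tubeDesc_apply hHper' i
      (hp.trans_le (min_le_right _ _))]
  have hre : ContDiff ℝ ∞ fun p : ℝ × ℂ => p.2.re := Complex.reCLM.contDiff.comp contDiff_snd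
  have him : ContDiff ℝ ∞ fun p : ℝ × ℂ => p.2.im := Complex.imCLM.contDiff.comp contDiff_snd
  obtain ⟨z, hz, ρ₂, hρ₂, hzY⟩ := desc (fun _ p => p.2.im) (fun _ => him) (fun _ _ _ => rfl)
  obtain ⟨w₀, hw₀, ρ₃, hρ₃, hwY⟩ := desc
    (fun i p => F i p.1 + G i p.1 * p.2.re + κ i p.1 * (p.2.re * p.2.im))
    (fun i => (((hF i).comp contDiff_fst).add (((hG i).comp contDiff_fst).mul hre)).add
      (((hκ i).comp contDiff_fst).mul (hre.mul him)))
    (fun i s ζ => by simp only [hFper i s, hGper i s, hκper i s])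
  -- the surface `z = 0` is not characteristic
  have hgrad : ∀ i s, pderiv 0 z (γ i s) ^ 2 + pderiv 1 z (γ i s) ^ 2 ≠ 0 := by
    intro i s h0
    have hx := hasDerivAt_add_smul (γ i s) (slantNormal (γ i) (a i) (b i) s) 0
    have h1 := fderiv_apply_of_eventuallyEq (g := fun t => t) hz.differentiable_infty hx
      (hasDerivAt_id 0) (by
      have hc : ContinuousAt (fun t : ℝ => ‖(t * Complex.I : ℂ)‖) 0 := by fun_prop
      filter_upwards [hc.eventually_lt continuousAt_const (by simpa using hρ₂)] with t ht
      have := hzY i (s, t * Complex.I) ht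
      rw [hYdef] at this
      simpa [slantTube_mul_I] using this)
    rw [fderiv_apply_eq] at h1
    have e0 : pderiv 0 z (γ i s) = 0 := by nlinarith
    have e1 : pderiv 1 z (γ i s) = 0 := by nlinarith
    simp [slantNormal, e0, e1] at h1
  have hgc : ContDiff ℝ ∞ fun ξ => pderiv 0 z ξ ^ 2 + pderiv 1 z ξ ^ 2 :=
    ((hz.pderiv 0).pow 2).add ((hz.pderiv 1).pow 2)
  obtain ⟨α, hα, -, hαz⟩ := exists_contDiff_hasCompactSupport_eventuallyEq hL
    (U := {ξ | pderiv 0 z ξ ^ 2 + pderiv 1 z ξ ^ 2 ≠ 0})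
    (isOpen_ne_fun hgc.continuous continuous_const) (by
      rintro ξ hξ
      obtain ⟨i, s, rfl⟩ := mem_iUnion.1 hξ
      exact hgrad i s)
    (f := fun ξ => (pderiv 0 z ξ ^ 2 + pderiv 1 z ξ ^ 2)⁻¹)
    (hgc.contDiffOn.inv fun ξ hξ => hξ)
  obtain ⟨Q, R₀, hQ, hR₀, hheat⟩ := exists_formal_heatSolution hw₀ hz hα
    (V := {ξ | α ξ * (pderiv 0 z ξ ^ 2 + pderiv 1 z ξ ^ 2) = 1}) (fun ξ hξ => hξ) k
  obtain ⟨R, hR, hRc, hRR⟩ := exists_contDiff_hasCompactSupport_eventuallyEq hL isOpen_univ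
    (subset_univ _) hR₀.contDiffOn
  have hev : ∀ᶠ ξ in 𝓝ˢ (linkSet γ), heatOp (fun ξ => w₀ ξ + z ξ ^ 2 * Q ξ) ξ = z ξ ^ k * R ξ ∧
      ξ ∈ positiveTimes := by
    have h1 : ∀ᶠ ξ in 𝓝ˢ (linkSet γ), pderiv 0 z ξ ^ 2 + pderiv 1 z ξ ^ 2 ≠ 0 :=
      eventually_nhdsSet_linkSet fun i s => hgc.continuous.continuousAt.eventually_ne (hgrad i s)
    have h2 : ∀ᶠ ξ in 𝓝ˢ (linkSet γ), ξ ∈ positiveTimes :=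
      eventually_nhdsSet_linkSet fun i s =>
        ((EuclideanSpace.proj (𝕜 := ℝ) (2 : Fin 3)).continuous.continuousAt).eventually
          (lt_mem_nhds (hγ.positive i s))
    filter_upwards [h1, hαz, hRR, h2] with ξ h1 h2 h3 h4
    exact ⟨by rw [hheat ξ (by simp [h2, h1]), h3], h4⟩
  obtain ⟨ρ₄, hρ₄, hev⟩ := exists_tube_of_eventually (fun i => (hY i).continuous) hper hcore hev
  set ρ := min (min ρ₁ ρ₂) (min ρ₃ ρ₄) with hρdef
  have hρ : 0 < ρ := lt_min (lt_min hT.pos hρ₂) (lt_min hρ₃ hρ₄)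
  have l1 : ρ ≤ ρ₁ := (min_le_left _ _).trans (min_le_left _ _)
  have l2 : ρ ≤ ρ₂ := (min_le_left _ _).trans (min_le_right _ _)
  have l3 : ρ ≤ ρ₃ := (min_le_right _ _).trans (min_le_left _ _)
  have l4 : ρ ≤ ρ₄ := (min_le_right _ _).trans (min_le_right _ _)
  have hw : ContDiff ℝ ∞ fun ξ => w₀ ξ + z ξ ^ 2 * Q ξ := hw₀.add ((hz.pow 2).mul hQ)
  have hz' : ∀ i p, ‖p.2‖ < ρ → z (Y i p) = p.2.im := fun i p hp => hzY i p (hp.trans_le l2)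
  have hheat' : ∀ i p, ‖p.2‖ < ρ → heatOp (fun ξ => w₀ ξ + z ξ ^ 2 * Q ξ) (Y i p) =
      p.2.im ^ k * R (Y i p) := fun i p hp => by
    rw [(hev i p (hp.trans_le l4)).1, hz' i p hp]
  have hjet := fun i => jet_of_slantTube (hγ.smooth i) (hab i) (hFG i) (hG i) hw hQ hρ
    (fun p hp => by
      have e1 := hwY i p (hp.trans_le l3)
      have e2 := hz' i p hp
      rw [hYdef] at e1 e2
      simp only [e1, e2])
    (fun s => by
      have := hheat' i (s, 0) (by simpa)
      simpa [hcore, hk] using this) (hX i)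
  refine ⟨Y, ρ, _, z, R, hT.mono hρ l1, hcore, hw, hz, hR, hRc, hz', hheat',
    fun i p hp => (hev i p (hp.trans_le l4)).2, fun i s => ⟨(hjet i s).1, (hjet i s).2.1⟩,
    fun i s => (hjet i s).2.2.2, fun i a b h s hs => ?_⟩
  rw [(hjet i s).2.2.1]
  exact hsign i a b h s hs

end ApproxSolution

/-! ### Correction to an exact solution near the surface z = 0 -/

section Family

variable {m : ℕ} {γ : Fin m → ℝ → Spacetime} {Lmax : Set (Set Spacetime)} {k : ℕ}
  {Y : Fin m → ℝ × ℂ → Spacetime} {ρ₀ : ℝ} {w z R : Spacetime → ℝ}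

/-- A family of corrections of the approximate solution, of finite regularity jointly in the
parameters `θ = (l, ρ)` and smooth for `ρ > 0`, which for `l = ρ ^ 2` solves the heat equation at
distance at most `ρ` from the surface `z = 0`. -/
theorem IsApproxSolution.exists_family (h : IsApproxSolution γ Lmax (k + 2) Y ρ₀ w z R) {n : ℕ}
    (hn : 2 ≤ n) (hnk : n + 1 ≤ k) : ∃ V : ℝ × ℝ → Spacetime → ℝ,
      ContDiff ℝ n (fun q : (ℝ × ℝ) × Spacetime => V q.1 q.2) ∧
      (∀ ρ, V (0, ρ) = w) ∧
      (∀ θ ξ, 0 < θ.2 → ContDiffAt ℝ ∞ (fun q : (ℝ × ℝ) × Spacetime => V q.1 q.2) (θ, ξ)) ∧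
      ∀ ρ, 0 < ρ → ∀ i p, ‖p.2‖ < ρ₀ → |p.2.im| ≤ ρ → heatOp (V (ρ ^ 2, ρ)) (Y i p) = 0 := by
  obtain ⟨φ, hφ, hφc, hφk⟩ := exists_profile (k + 2)
  have hzR : ContDiff ℝ ∞ fun q : ℝ × Spacetime => (q.1, z q.2) :=
    contDiff_fst.prodMk (h.contDiff_z.comp contDiff_snd)
  set f : ℝ × Spacetime → ℝ := fun q => scaledProfile k φ (q.1, z q.2) * R q.2 with hf
  have hfn : ContDiff ℝ n f := ((contDiff_scaledProfile n hnk hφ hφc).comp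
    (hzR.of_le ENat.LEInfty.out)).mul ((h.contDiff_R.comp contDiff_snd).of_le ENat.LEInfty.out)
  have hfs : ContDiffOn ℝ ∞ f (Ioi 0 ×ˢ univ) := by
    rintro ⟨ρ, ξ⟩ ⟨hρ, -⟩
    have hρ' : (0 : ℝ) < ρ := hρ
    exact (((contDiffAt_scaledProfile k hφ (p := (ρ, z ξ)) hρ'.ne').comp (ρ, ξ)
      hzR.contDiffAt).mul
      (h.contDiff_R.comp contDiff_snd).contDiffAt).contDiffWithinAt
  obtain ⟨c, hc, hceq, hcs⟩ := exists_heatPotential hn hfn h.hasCompactSupport_R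
    (fun p ξ hξ => by simp [hf, image_eq_zero_of_notMem_tsupport hξ])
  have hcs := hcs (Ioi 0) isOpen_Ioi hfs
  have hπ : ContDiff ℝ (∞ : ℕ∞ω) fun q : (ℝ × ℝ) × Spacetime => (q.1.2, q.2) := by fun_prop
  -- For |z| ≤ ρ the error z ^ (k + 2) R is ρ² times ρ ^ k (z/ρ) ^ (k + 2) R, that is, ρ² times the
  -- source of c, so l = ρ² cancels it. Keeping l independent of ρ lets the critical curve be
  -- estimated by |l|, a full order better than the radius ρ.
  refine ⟨fun θ ξ => w ξ - θ.1 * c (θ.2, ξ), ?_, fun ρ => by ext ξ; simp, fun θ ξ hθ => ?_,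
    fun ρ hρ i p hp hpρ => ?_⟩
  · exact ((h.contDiff_w.comp contDiff_snd).of_le ENat.LEInfty.out).sub
      (contDiff_fst.fst.mul (hc.comp (hπ.of_le ENat.LEInfty.out)))
  · refine (h.contDiff_w.comp contDiff_snd).contDiffAt.sub (contDiff_fst.fst.contDiffAt.mul ?_)
    have h1 : ContDiffAt ℝ ∞ c (θ.2, ξ) :=
      hcs.contDiffAt ((isOpen_Ioi.prod isOpen_univ).mem_nhds ⟨hθ, mem_univ _⟩)
    exact h1.comp (θ, ξ) hπ.contDiffAt
  · have hc2 : ContDiff ℝ 2 fun ξ => c (ρ, ξ) :=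
      (hc.comp (contDiff_prodMk_right ρ)).of_le (by exact_mod_cast hn)
    have e : (fun ξ => w ξ - ρ ^ 2 * c (ρ, ξ)) = fun ξ => w ξ + -ρ ^ 2 * c (ρ, ξ) := by
      ext ξ; ring
    have e2 : heatOp (fun ξ => c (ρ, ξ)) (Y i p) = f (ρ, Y i p) := by
      rw [heatOp, hceq]; ring
    change heatOp (fun ξ => w ξ - ρ ^ 2 * c (ρ, ξ)) (Y i p) = 0
    rw [e, heatOp_add (h.contDiff_w.of_le ENat.LEInfty.out) (contDiff_const.mul hc2),
      heatOp_const_mul hc2, h.heat i p hp, e2, hf]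
    simp only [scaledProfile, h.z_apply i p hp]
    rw [hφk _ (by rwa [abs_div, abs_of_pos hρ, div_le_one hρ])]
    have e3 : p.2.im ^ (k + 2) = ρ ^ 2 * (ρ ^ k * (p.2.im / ρ) ^ (k + 2)) := by
      rw [← mul_assoc, ← pow_add, add_comm 2 k, ← mul_pow, mul_div_cancel₀ _ hρ.ne']
    rw [e3]
    ring

end Family

/-! ### Zero sections of periodic families -/

section ZeroSection

variable {E F : Type*} [NormedAddCommGroup E] [NormedSpace ℝ E] [CompleteSpace E]
  [NormedAddCommGroup F] [NormedSpace ℝ F] [CompleteSpace F]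

theorem fderiv_add_of_periodic {G H : Type*} [NormedAddCommGroup G] [NormedSpace ℝ G]
    [NormedAddCommGroup H] [NormedSpace ℝ H] {M : G → H} {v : G} (h : ∀ p, M (p + v) = M p)
    (p : G) : fderiv ℝ M (p + v) = fderiv ℝ M p := by
  rw [← fderiv_comp_add_right]
  congr 1
  ext1 p
  exact h p

/-- The implicit function theorem along a whole circle, with a common radius of uniqueness by
compactness. Regularity of d is asserted pointwise, from regularity of M at the same point, because
M will be smooth only for some of the parameters. -/
theorem exists_zero_section {M : (E × ℝ) × F → F} (hM : ContDiff ℝ 1 M)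
    (hper : ∀ θ s ζ (k : ℤ), M ((θ, s + k * (2 * Real.pi)), ζ) = M ((θ, s), ζ))
    (h0 : ∀ s, M ((0, s), 0) = 0)
    (hinv : ∀ s, (fderiv ℝ M ((0, s), 0) ∘L .inr ℝ (E × ℝ) F).IsInvertible) {r₀ : ℝ}
    (hr₀ : 0 < r₀) :
    ∃ r, 0 < r ∧ r ≤ r₀ ∧ ∃ d : E × ℝ → F, (∀ s, d (0, s) = 0) ∧
      (∀ θ s (k : ℤ), d (θ, s + k * (2 * Real.pi)) = d (θ, s)) ∧ ∀ᶠ θ in 𝓝 (0 : E), ∀ s,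
      ‖d (θ, s)‖ < r ∧ (∀ ζ, ‖ζ‖ < r → (M ((θ, s), ζ) = 0 ↔ ζ = d (θ, s))) ∧
      ∀ n : ℕ∞ω, n ≠ 0 → ContDiffAt ℝ n M ((θ, s), d (θ, s)) → ContDiffAt ℝ n d (θ, s) := by
  have hfper : ∀ θ s ζ (k : ℤ), fderiv ℝ M ((θ, s + k * (2 * Real.pi)), ζ) =
      fderiv ℝ M ((θ, s), ζ) := by
    intro θ s ζ k
    have h := fderiv_add_of_periodic (M := M) (v := ((0, k * (2 * Real.pi)), 0))
      (fun ⟨⟨θ, s⟩, ζ⟩ => by simpa using hper θ s ζ k) ((θ, s), ζ)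
    simpa using h
  have cdf : ∀ q, ContDiffAt ℝ 1 M q := fun q => hM.contDiffAt
  -- invertibility of the derivative near the zero section
  have e1 : ∀ᶠ x : E × F in 𝓝 0, ∀ s,
      (fderiv ℝ M ((x.1, s), x.2) ∘L .inr ℝ (E × ℝ) F).IsInvertible := by
    refine eventually_forall_periodic (fun x s k h => by rwa [hfper] at h) fun s => ?_
    have hc : Continuous fun q : (E × F) × ℝ =>
        fderiv ℝ M ((q.1.1, q.2), q.1.2) ∘L ContinuousLinearMap.inr ℝ (E × ℝ) F :=
      ((hM.continuous_fderiv (by norm_num)).comp (by fun_prop)).clm_comp_const _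
    exact eventually_isInvertible hc.continuousAt (hinv s)
  -- uniqueness
  have e2 : ∀ᶠ x : E × F × F in 𝓝 0, ∀ s, M ((x.1, s), x.2.1) = 0 → M ((x.1, s), x.2.2) = 0 →
      x.2.1 = x.2.2 := by
    refine eventually_forall_periodic (fun x s k h => by rwa [hper, hper] at h) fun s => ?_
    have h := (cdf ((0, s), 0)).eventually_apply_eq_iff_implicitFunction one_ne_zero (hinv s)
    have c1 : ContinuousAt (fun q : (E × F × F) × ℝ => ((q.1.1, q.2), q.1.2.1)) (0, s) := by
      fun_prop
    have c2 : ContinuousAt (fun q : (E × F × F) × ℝ => ((q.1.1, q.2), q.1.2.2)) (0, s) := by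
      fun_prop
    filter_upwards [c1.eventually h, c2.eventually h] with q h1 h2 h3 h4
    rw [h0] at h1 h2
    exact (h1.1 h3).symm.trans (h2.1 h4)
  obtain ⟨r1, hr1, H1⟩ := Metric.eventually_nhds_iff.1 e1
  obtain ⟨r2, hr2, H2⟩ := Metric.eventually_nhds_iff.1 e2
  set r := min (min r1 r2) r₀ with hrdef
  have hr : 0 < r := lt_min (lt_min hr1 hr2) hr₀
  have l1 : r ≤ r1 := (min_le_left _ _).trans (min_le_left _ _)
  have l2 : r ≤ r2 := (min_le_left _ _).trans (min_le_right _ _)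
  -- existence
  have e3 : ∀ᶠ θ in 𝓝 (0 : E), ∀ s, ∃ ζ, ‖ζ‖ < r ∧ M ((θ, s), ζ) = 0 := by
    refine eventually_forall_periodic (fun x s k h => by simpa only [hper] using h) fun s => ?_
    have h := (cdf ((0, s), 0)).eventually_apply_implicitFunction one_ne_zero (hinv s)
    have h' := ((cdf ((0, s), 0)).contDiffAt_implicitFunction one_ne_zero
      (hinv s)).continuousAt.norm.eventually_lt continuousAt_const (g := fun _ => r) (by
        rw [(cdf ((0, s), 0)).implicitFunction_apply_self one_ne_zero (hinv s)]
        simpa)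
    filter_upwards [h, h'] with q h1 h2
    exact ⟨_, h2, by rw [h1, h0]⟩
  classical
  -- The choice depends only on the function M (q, ·), so d inherits periodicity in s even where no
  -- zero exists and the default value 0 is taken.
  set d : E × ℝ → F := fun q =>
    if h : ∃ ζ, ‖ζ‖ < r ∧ M (q, ζ) = 0 then h.choose else 0 with hd
  have hdspec : ∀ q, (∃ ζ, ‖ζ‖ < r ∧ M (q, ζ) = 0) → ‖d q‖ < r ∧ M (q, d q) = 0 := by
    intro q h
    simp only [hd, dif_pos h]
    exact h.choose_spec
  have huniq : ∀ θ : E, ‖θ‖ < r → ∀ s ζ, ‖ζ‖ < r → M ((θ, s), ζ) = 0 → ζ = d (θ, s) := by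
    intro θ hθ s ζ hζ hz
    obtain ⟨h1, h2⟩ := hdspec (θ, s) ⟨ζ, hζ, hz⟩
    refine H2 (y := (θ, ζ, d (θ, s))) ?_ s hz h2
    rw [dist_zero_right]
    exact (max_lt hθ (max_lt hζ h1)).trans_le l2
  refine ⟨r, hr, min_le_right _ _, d, fun s => ?_, fun θ s k => ?_, ?_⟩
  · exact (huniq 0 (by simpa) s 0 (by simpa) (h0 s)).symm
  · simp only [hd, hper]
  · filter_upwards [e3.eventually_nhds, Metric.ball_mem_nhds 0 hr] with θ h1 h2 s
    rw [mem_ball_zero_iff] at h2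
    obtain ⟨h3, h4⟩ := hdspec (θ, s) (h1.self_of_nhds s)
    refine ⟨h3, fun ζ hζ => ⟨huniq θ h2 s ζ hζ, fun h => h ▸ h4⟩, fun n hn hMn => ?_⟩
    have hI : (fderiv ℝ M ((θ, s), d (θ, s)) ∘L .inr ℝ (E × ℝ) F).IsInvertible := by
      refine H1 (y := (θ, d (θ, s))) ?_ s
      rw [dist_zero_right]
      exact (max_lt h2 h3).trans_le l1
    have hψ := hMn.contDiffAt_implicitFunction hn hI
    refine hψ.congr_of_eventuallyEq ?_
    have h5 := hMn.eventually_apply_implicitFunction hn hI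
    have h6 := hψ.continuousAt.norm.eventually_lt continuousAt_const (g := fun _ => r) (by
      rw [hMn.implicitFunction_apply_self hn hI]; exact h3)
    have h7 : ∀ᶠ q : E × ℝ in 𝓝 (θ, s), ‖q.1‖ < r :=
      (continuousAt_fst.norm.eventually_lt continuousAt_const (g := fun _ => r) h2)
    filter_upwards [h5, h6, h7] with q h5 h6 h7
    exact (huniq q.1 h7 q.2 _ h6 (by rw [h5, h4])).symm

end ZeroSection

theorem eventually_norm_le_of_eq_zero {F : Type*} [NormedAddCommGroup F]
    [NormedSpace ℝ F] {d : (ℝ × ℝ) × ℝ → F}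
    (hd : ∀ s, ContDiffAt ℝ 1 d (0, s))
    (hper : ∀ θ s (k : ℤ), d (θ, s + k * (2 * Real.pi)) = d (θ, s))
    (h0 : ∀ᶠ ρ in 𝓝 (0 : ℝ), ∀ s, d ((0, ρ), s) = 0) :
    ∃ C, 0 < C ∧ ∀ᶠ θ in 𝓝 (0 : ℝ × ℝ), ∀ s, ‖d (θ, s)‖ ≤ C * |θ.1| := by
  -- The Lipschitz constant depends on s. Its reciprocal is carried as an additional small variable
  -- x.2, so that the compactness argument for periodic statements makes it uniform; x.2 = δ / 2
  -- then gives C = 2 / δ.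
  have key : ∀ᶠ x : (ℝ × ℝ) × ℝ in 𝓝 0, ∀ s,
      |x.2| * ‖d (x.1, s)‖ ≤ |x.1.1| := by
    refine eventually_forall_periodic (fun x s k h => by rwa [hper] at h) fun s => ?_
    obtain ⟨K, t, ht, hK⟩ := (hd s).exists_lipschitzOnWith
    have c1 : ContinuousAt (fun q : ((ℝ × ℝ) × ℝ) × ℝ => (q.1.1, q.2)) (0, s) := by fun_prop
    have c2 : ContinuousAt (fun q : ((ℝ × ℝ) × ℝ) × ℝ => (((0, q.1.1.2), q.2) : (ℝ × ℝ) × ℝ))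
      (0, s) := by fun_prop
    have c3 : ContinuousAt (fun q : ((ℝ × ℝ) × ℝ) × ℝ => q.1.1.2) (0, s) := by fun_prop
    have c4 : ContinuousAt (fun q : ((ℝ × ℝ) × ℝ) × ℝ => K * |q.1.2|) (0, s) := by fun_prop
    filter_upwards [c1.eventually ht, c2.eventually ht, c3.eventually h0,
      c4.eventually_lt continuousAt_const (g := fun _ => 1) (by simp)] with q h1 h2 h3 h4
    have h5 := hK.norm_sub_le h1 h2
    rw [h3, sub_zero] at h5
    have h6 : ‖((q.1.1, q.2) - ((0, q.1.1.2), q.2) : (ℝ × ℝ) × ℝ)‖ = |q.1.1.1| := by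
      simp [Prod.norm_def]
    rw [h6] at h5
    calc |q.1.2| * ‖d (q.1.1, q.2)‖ ≤ |q.1.2| * (K * |q.1.1.1|) :=
          mul_le_mul_of_nonneg_left h5 (abs_nonneg _)
      _ = K * |q.1.2| * |q.1.1.1| := by ring
      _ ≤ 1 * |q.1.1.1| := mul_le_mul_of_nonneg_right h4.le (abs_nonneg _)
      _ = _ := one_mul _
  obtain ⟨δ, hδ, H⟩ := Metric.eventually_nhds_iff.1 key
  refine ⟨2 / δ, by positivity, ?_⟩
  filter_upwards [Metric.ball_mem_nhds 0 hδ] with θ h2 s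
  have := H (y := (θ, δ / 2)) (by
    rw [dist_zero_right]
    rw [mem_ball_zero_iff] at h2
    exact max_lt h2 (by rw [Real.norm_eq_abs, abs_of_pos (by positivity)]; linarith)) s
  rw [abs_of_pos (by positivity : 0 < δ / 2)] at this
  rw [div_mul_eq_mul_div, le_div_iff₀ hδ]
  linarith

/-! ### The critical set of the corrected solutions -/

section Parametric

variable {E : Type*} [NormedAddCommGroup E] [NormedSpace ℝ E]

theorem ContDiffAt.pderiv_param {V : E → Spacetime → ℝ} {θ : E} {ξ : Spacetime} {n m : ℕ∞ω}
    (hV : ContDiffAt ℝ n (fun q : E × Spacetime => V q.1 q.2) (θ, ξ)) (h : m + 1 ≤ n) (i : Fin 3) :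
    ContDiffAt ℝ m (fun q : E × Spacetime => pderiv i (V q.1) q.2) (θ, ξ) := by
  have h1 : ContDiffAt ℝ n (Function.uncurry fun (q : E × Spacetime) η => V q.1 η)
      ((θ, ξ), ξ) :=
    ContDiffAt.comp (g := fun q : E × Spacetime => V q.1 q.2)
      (f := fun q : (E × Spacetime) × Spacetime => (q.1.1, q.2)) ((θ, ξ), ξ) hV (by fun_prop)
  exact (h1.fderiv (g := fun q : E × Spacetime => q.2) contDiffAt_snd h).clm_apply contDiffAt_const

theorem ContDiffAt.iteratedFDeriv_param {F : Type*} [NormedAddCommGroup F] [NormedSpace ℝ F]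
    {V : E → Spacetime → F} {θ : E} {ξ : Spacetime} (k : ℕ) :
    ∀ {m : ℕ}, ContDiffAt ℝ (m + k : ℕ) (fun q : E × Spacetime => V q.1 q.2) (θ, ξ) →
      ContDiffAt ℝ m (fun q : E × Spacetime => iteratedFDeriv ℝ k (V q.1) q.2) (θ, ξ) := by
  induction k with
  | zero =>
    intro m h
    simp only [iteratedFDeriv_zero_eq_comp, Function.comp_def]
    exact (LinearIsometryEquiv.contDiff _).contDiffAt.comp (θ, ξ) h
  | succ k ih =>
    intro m h
    have h0 := ih (m := m + 1) (by convert h using 2; lia)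
    have h1 : ContDiffAt ℝ (m + 1 : ℕ)
        (Function.uncurry fun (q : E × Spacetime) η => iteratedFDeriv ℝ k (V q.1) η)
        ((θ, ξ), ξ) :=
      ContDiffAt.comp (g := fun q : E × Spacetime => iteratedFDeriv ℝ k (V q.1) q.2)
        (f := fun q : (E × Spacetime) × Spacetime => (q.1.1, q.2)) ((θ, ξ), ξ) h0 (by fun_prop)
    simp only [iteratedFDeriv_succ_eq_comp_left, Function.comp_def]
    exact (LinearIsometryEquiv.contDiff _).contDiffAt.comp (θ, ξ)
      (h1.fderiv (g := fun q : E × Spacetime => q.2) contDiffAt_snd (by norm_cast))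

end Parametric

/-! ### The cross product of the gradients of v_x and v_y -/

section JetDet

/-- Both gradients are orthogonal to p, so for p ≠ 0 their cross product is λ p; then `jetDet` is λ
|p|², while the time coordinate of the cross product is the Hessian determinant, λ p 2. Hence the
Hessian determinant has the sign of the height speed when `jetDet` is positive. -/
theorem jetDet_mul {v : Spacetime → ℝ} {ξ p : Spacetime}
    (h0 : fderiv ℝ (pderiv 0 v) ξ p = 0) (h1 : fderiv ℝ (pderiv 1 v) ξ p = 0) :
    (p 0 ^ 2 + p 1 ^ 2 + p 2 ^ 2) * spatialHessianDet v ξ = jetDet v ξ p * p 2 := by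
  rw [fderiv_apply_eq] at h0 h1
  rw [jetDet, spatialHessianDet]
  linear_combination (p 0 * pderiv 1 (pderiv 1 v) ξ - p 1 * pderiv 0 (pderiv 1 v) ξ) * h0 -
    (p 0 * pderiv 1 (pderiv 0 v) ξ - p 1 * pderiv 0 (pderiv 0 v) ξ) * h1

/-- A nonzero determinant forces the two gradients to be independent, so their common kernel is the
line of p. -/
theorem exists_smul_of_jetDet {v : Spacetime → ℝ} {ξ p u : Spacetime} (hp : 0 < jetDet v ξ p)
    (h0 : fderiv ℝ (pderiv 0 v) ξ p = 0) (h1 : fderiv ℝ (pderiv 1 v) ξ p = 0)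
    (k0 : fderiv ℝ (pderiv 0 v) ξ u = 0) (k1 : fderiv ℝ (pderiv 1 v) ξ u = 0) :
    u = (jetDet v ξ u / jetDet v ξ p) • p := by
  rw [fderiv_apply_eq] at h0 h1 k0 k1
  have key : ∀ i, jetDet v ξ p * u i = jetDet v ξ u * p i := by
    simp only [jetDet, spatialHessianDet]
    set a0 := pderiv 0 (pderiv 0 v) ξ
    set a1 := pderiv 1 (pderiv 0 v) ξ
    set a2 := pderiv 2 (pderiv 0 v) ξ
    set b0 := pderiv 0 (pderiv 1 v) ξ
    set b1 := pderiv 1 (pderiv 1 v) ξ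
    set b2 := pderiv 2 (pderiv 1 v) ξ
    intro i
    fin_cases i
    · show _ * u 0 = _ * p 0
      linear_combination (p 2 * b1 - p 1 * b2) * k0 - (p 2 * a1 - p 1 * a2) * k1 +
        (u 1 * b2 - u 2 * b1) * h0 - (u 1 * a2 - u 2 * a1) * h1
    · show _ * u 1 = _ * p 1
      linear_combination (p 0 * b2 - p 2 * b0) * k0 - (p 0 * a2 - p 2 * a0) * k1 +
        (u 2 * b0 - u 0 * b2) * h0 - (u 2 * a0 - u 0 * a2) * h1
    · show _ * u 2 = _ * p 2
      linear_combination (p 1 * b0 - p 0 * b1) * k0 - (p 1 * a0 - p 0 * a1) * k1 +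
        (u 0 * b1 - u 1 * b0) * h0 - (u 0 * a1 - u 1 * a0) * h1
  ext i
  rw [PiLp.smul_apply, smul_eq_mul, div_mul_eq_mul_div, eq_div_iff hp.ne', ← key i, mul_comm]

/-- A transverse vector in the kernel is mapped by the derivative of Y into the common kernel of the
gradients, hence to a multiple of the tangent, the image of (1, 0). Injectivity of the derivative of
Y makes it zero. -/
theorem isInvertible_of_jetDet {v : Spacetime → ℝ} (hv : ContDiff ℝ 2 v)
    {Y : ℝ × ℂ → Spacetime} {s : ℝ} (hY : DifferentiableAt ℝ Y (s, 0))
    (hinv : (fderiv ℝ Y (s, 0)).IsInvertible)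
    (hp : 0 < jetDet v (Y (s, 0)) (fderiv ℝ Y (s, 0) (1, 0)))
    (h0 : fderiv ℝ (pderiv 0 v) (Y (s, 0)) (fderiv ℝ Y (s, 0) (1, 0)) = 0)
    (h1 : fderiv ℝ (pderiv 1 v) (Y (s, 0)) (fderiv ℝ Y (s, 0) (1, 0)) = 0)
    {L : ℂ →L[ℝ] ℂ} (hL : HasFDerivAt (fun ζ : ℂ =>
      (⟨pderiv 0 v (Y (s, ζ)), pderiv 1 v (Y (s, ζ))⟩ : ℂ)) L 0) : L.IsInvertible := by
  refine isInvertible_of_injective L rfl fun ζ hζ => ?_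
  have hd : ∀ i, DifferentiableAt ℝ (pderiv i v) (Y (s, 0)) := fun i =>
    (hv.pderiv' (m := 1) (by norm_num) i).differentiable (by norm_num) _
  have hYζ : HasFDerivAt (fun ζ : ℂ => Y (s, ζ)) _ 0 :=
    HasFDerivAt.comp (g := Y) (0 : ℂ) hY.hasFDerivAt (hasFDerivAt_prodMk_right s 0)
  have k0 := ((hd 0).hasFDerivAt.comp (0 : ℂ) hYζ).unique (Complex.reCLM.hasFDerivAt.comp (0 : ℂ) hL)
  have k1 := ((hd 1).hasFDerivAt.comp (0 : ℂ) hYζ).unique (Complex.imCLM.hasFDerivAt.comp (0 : ℂ) hL)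
  replace k0 := DFunLike.congr_fun k0 ζ
  replace k1 := DFunLike.congr_fun k1 ζ
  simp [hζ] at k0 k1
  have e := exists_smul_of_jetDet hp h0 h1 k0 k1
  rw [← map_smul] at e
  have := hinv.injective e
  simp only [Prod.smul_mk, smul_eq_mul, mul_one, smul_zero, Prod.mk.injEq] at this
  exact this.2

end JetDet

/-! ### The critical curves as graphs over the link -/

section CriticalSection

variable {m : ℕ} {γ : Fin m → ℝ → Spacetime} {Lmax : Set (Set Spacetime)} {k : ℕ}
  {Y : Fin m → ℝ × ℂ → Spacetime} {ρ₀ : ℝ} {w z R : Spacetime → ℝ}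

theorem exists_pos_le_forall {ρ₀ : ℝ} (h₀ : 0 < ρ₀) {r : Fin m → ℝ} (hr : ∀ i, 0 < r i) :
    ∃ ρ, 0 < ρ ∧ ρ ≤ ρ₀ ∧ ∀ i, ρ ≤ r i := by
  have h1 : ∀ᶠ ρ in 𝓝[>] (0 : ℝ), ∀ i, ρ ≤ r i := eventually_all.2 fun i =>
    mem_of_superset (Ioc_mem_nhdsGT (hr i)) fun _ h => h.2
  obtain ⟨ρ, h, h'⟩ := (h1.and (eventually_mem_set.2 (Ioc_mem_nhdsGT h₀))).exists
  exact ⟨ρ, h'.1, h'.2, h⟩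

theorem IsApproxSolution.fderiv_core (h : IsApproxSolution γ Lmax k Y ρ₀ w z R) (i : Fin m)
    (s : ℝ) : fderiv ℝ (Y i) (s, 0) (1, 0) = deriv (γ i) s := by
  have h1 : HasDerivAt (fun s : ℝ => (s, (0 : ℂ))) (1, 0) s :=
    (hasDerivAt_id s).prodMk (hasDerivAt_const s 0)
  have h2 := (((h.tube.smooth i).differentiable_infty (s, 0)).hasFDerivAt).comp_hasDerivAt s h1
  have h3 : (Y i ∘ fun s : ℝ => (s, (0 : ℂ))) = γ i := funext fun s => h.core i s
  rw [h3] at h2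
  exact h2.deriv.symm

theorem IsApproxSolution.contDiff_curve (h : IsApproxSolution γ Lmax k Y ρ₀ w z R)
    (i : Fin m) : ContDiff ℝ ∞ (γ i) := by
  have h3 : (Y i ∘ fun s : ℝ => (s, (0 : ℂ))) = γ i := funext fun s => h.core i s
  rw [← h3]
  exact (h.tube.smooth i).comp (contDiff_id.prodMk contDiff_const)

theorem IsApproxSolution.fderiv_pderiv_deriv (h : IsApproxSolution γ Lmax k Y ρ₀ w z R)
    (i : Fin m) (s : ℝ) : fderiv ℝ (pderiv 0 w) (γ i s) (deriv (γ i) s) = 0 ∧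
      fderiv ℝ (pderiv 1 w) (γ i s) (deriv (γ i) s) = 0 := by
  have hd := ((h.contDiff_curve i).differentiable_infty s).hasDerivAt
  exact ⟨fderiv_apply_of_eventuallyEq (h.contDiff_w.pderiv 0).differentiable_infty hd
    (hasDerivAt_const s 0) (.of_forall fun t => (h.critical i t).1),
    fderiv_apply_of_eventuallyEq (h.contDiff_w.pderiv 1).differentiable_infty hd
    (hasDerivAt_const s 0) (.of_forall fun t => (h.critical i t).2)⟩

/-- The zero section theorem is applied to (v_x, v_y) in tube coordinates, which costs one
derivative. Since V (0, ρ) = w for every ρ, the section vanishes identically at l = 0, whence the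
bound by |l|. -/
theorem IsApproxSolution.exists_critical_section (h : IsApproxSolution γ Lmax k Y ρ₀ w z R)
    {n : ℕ} (hn : 1 ≤ n) {V : ℝ × ℝ → Spacetime → ℝ}
    (hV : ContDiff ℝ (n + 1 : ℕ) fun q : (ℝ × ℝ) × Spacetime => V q.1 q.2)
    (hV0 : ∀ ρ, V (0, ρ) = w)
    (hVs : ∀ θ ξ, 0 < θ.2 → ContDiffAt ℝ ∞ (fun q : (ℝ × ℝ) × Spacetime => V q.1 q.2) (θ, ξ)) :
    ∃ r, 0 < r ∧ r ≤ ρ₀ ∧ ∃ d : Fin m → (ℝ × ℝ) × ℝ → ℂ, (∀ i s, d i (0, s) = 0) ∧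
      (∀ i θ s (k : ℤ), d i (θ, s + k * (2 * Real.pi)) = d i (θ, s)) ∧
      ∃ C, 0 < C ∧ ∀ᶠ θ in 𝓝 (0 : ℝ × ℝ), ∀ i s, ‖d i (θ, s)‖ ≤ C * |θ.1| ∧
        ContDiffAt ℝ n (d i) (θ, s) ∧ (0 < θ.2 → ContDiffAt ℝ ∞ (d i) (θ, s)) ∧
        ∀ ζ, ‖ζ‖ < r → (IsSpatialCritical (V θ) (Y i (s, ζ)) ↔ ζ = d i (θ, s)) := by
  set M : Fin m → ((ℝ × ℝ) × ℝ) × ℂ → ℂ := fun i q =>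
    ⟨pderiv 0 (V q.1.1) (Y i (q.1.2, q.2)), pderiv 1 (V q.1.1) (Y i (q.1.2, q.2))⟩ with hM
  have hMc : ∀ i (n m : ℕ∞ω) q, m ≤ (∞ : ℕ∞ω) → m + 1 ≤ n →
      ContDiffAt ℝ n (fun q : (ℝ × ℝ) × Spacetime => V q.1 q.2) (q.1.1, Y i (q.1.2, q.2)) →
      ContDiffAt ℝ m (M i) q := by
    intro i n m q hm hmn hq
    have hY : ContDiffAt ℝ m (fun q : ((ℝ × ℝ) × ℝ) × ℂ => (q.1.1, Y i (q.1.2, q.2))) q := by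
      refine contDiffAt_fst.fst.prodMk (((h.tube.smooth i).of_le hm).contDiffAt.comp q ?_)
      fun_prop
    have h1 := fun j => ContDiffAt.comp (g := fun p : (ℝ × ℝ) × Spacetime => pderiv j (V p.1) p.2)
      q (hq.pderiv_param hmn j) hY
    exact Complex.equivRealProdCLM.symm.contDiff.contDiffAt.comp q ((h1 0).prodMk (h1 1))
  have hMn : ∀ i, ContDiff ℝ n (M i) := fun i => contDiff_iff_contDiffAt.2 fun q =>
    hMc i _ _ q ENat.LEInfty.out (by norm_cast) hV.contDiffAt
  have hM1 : ∀ i, ContDiff ℝ 1 (M i) := fun i => (hMn i).of_le (by exact_mod_cast hn)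
  have hM0 : ∀ i ρ s, M i (((0, ρ), s), 0) = 0 := by
    intro i ρ s
    simp only [hM, hV0, h.core, h.critical]
    rfl
  have hMz : ∀ i θ s ζ, M i ((θ, s), ζ) = 0 ↔ IsSpatialCritical (V θ) (Y i (s, ζ)) := by
    intro i θ s ζ
    rw [Complex.ext_iff]; rfl
  choose r hr hrρ d hd0 hdper hd using fun i => exists_zero_section (hM1 i)
    (fun θ s ζ k => by simp only [hM, h.tube.periodic]) (fun s => hM0 i 0 s) (fun s => by
      refine isInvertible_of_jetDet (v := w) (Y := Y i) (s := s)
        (h.contDiff_w.of_le ENat.LEInfty.out) ((h.tube.smooth i).differentiable_infty _)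
        (h.tube.invertible i _ (by simpa using h.tube.pos)) ?_ ?_ ?_ ?_
      · rw [h.fderiv_core, h.core]; exact h.jet i s
      · rw [h.fderiv_core, h.core]; exact (h.fderiv_pderiv_deriv i s).1
      · rw [h.fderiv_core, h.core]; exact (h.fderiv_pderiv_deriv i s).2
      · have h1 := HasFDerivAt.comp (g := M i) (0 : ℂ)
          (((hM1 i).differentiable one_ne_zero ((0, s), 0)).hasFDerivAt)
          (hasFDerivAt_prodMk_right (𝕜 := ℝ) ((0 : ℝ × ℝ), s) (0 : ℂ))
        refine h1.congr_of_eventuallyEq (.of_forall fun ζ => ?_)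
        simp only [hM, Function.comp_def]
        rw [show (0 : ℝ × ℝ) = (0, 0) from rfl, hV0]) h.tube.pos
  have hdn : ∀ᶠ θ in 𝓝 (0 : ℝ × ℝ), ∀ i s, ContDiffAt ℝ n (d i) (θ, s) :=
    eventually_all.2 fun i => (hd i).mono fun θ h s =>
      (h s).2.2 n (by exact_mod_cast (by lia : n ≠ 0)) (hMn i).contDiffAt
  have hC : ∀ i, ∃ C, 0 < C ∧ ∀ᶠ θ in 𝓝 (0 : ℝ × ℝ), ∀ s, ‖d i (θ, s)‖ ≤ C * |θ.1| := by
    intro i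
    refine eventually_norm_le_of_eq_zero (fun s =>
      (hdn.self_of_nhds i s).of_le (by exact_mod_cast hn)) (hdper i) ?_
    have hc : ContinuousAt (fun ρ : ℝ => ((0 : ℝ), ρ)) 0 := by fun_prop
    filter_upwards [hc.eventually (hd i)] with ρ hρ s
    exact (((hρ s).2.1 0 (by simpa using hr i)).1 (hM0 i ρ s)).symm
  choose C hC0 hC using hC
  obtain ⟨C', hC'⟩ := (finite_range C).bddAbove
  obtain ⟨r', hr', hr'ρ, hr'i⟩ := exists_pos_le_forall h.tube.pos hr
  refine ⟨r', hr', hr'ρ, d, hd0, hdper, max C' 1, lt_max_of_lt_right one_pos, ?_⟩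
  filter_upwards [hdn, eventually_all.2 hC, eventually_all.2 hd] with θ h1 h2 h3 i s
  refine ⟨(h2 i s).trans (mul_le_mul_of_nonneg_right
    ((hC' (mem_range_self i)).trans (le_max_left _ _)) (abs_nonneg _)), h1 i s, fun hθ => ?_,
    fun ζ hζ => ?_⟩
  · exact (h3 i s).2.2 (∞ : ℕ∞ω) (by simp) (hMc i (∞ : ℕ∞ω) _ _ le_rfl (by simp) (hVs _ _ hθ))
  · rw [← hMz]
    exact (h3 i s).2.1 ζ (hζ.trans_le (hr'i i))

end CriticalSection

/-! ### Rotations of a solid torus and its parametrization with a given core -/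

section Mobius

/-- The Möbius transformation of the unit disc which maps `a` to `0`. -/
noncomputable def mobius (a u : ℂ) : ℂ := (u - a) * (1 - (starRingEnd ℂ) a * u)⁻¹

variable {a u : ℂ}

theorem one_sub_conj_mul_ne_zero (ha : ‖a‖ < 1) (hu : ‖u‖ < 1) :
    1 - (starRingEnd ℂ) a * u ≠ 0 := by
  intro h
  have h1 : ‖(starRingEnd ℂ) a * u‖ = 1 := by rw [← sub_eq_zero.1 h]; simp
  rw [norm_mul, RCLike.norm_conj] at h1
  nlinarith [norm_nonneg a, norm_nonneg u]

/-- This is the identity |1 - ā u|² - |u - a|² = (1 - |a|²)(1 - |u|²). -/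
theorem norm_mobius_lt (ha : ‖a‖ < 1) (hu : ‖u‖ < 1) : ‖mobius a u‖ < 1 := by
  have h0 := one_sub_conj_mul_ne_zero ha hu
  rw [mobius, norm_mul, norm_inv, mul_inv_lt_iff₀ (norm_pos_iff.2 h0), one_mul]
  refine lt_of_pow_lt_pow_left₀ 2 (norm_nonneg _) ?_
  have ha' : ‖a‖ ^ 2 < 1 := by nlinarith [norm_nonneg a]
  have hu' : ‖u‖ ^ 2 < 1 := by nlinarith [norm_nonneg u]
  rw [← Complex.normSq_eq_norm_sq] at *
  rw [← Complex.normSq_eq_norm_sq]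
  simp only [Complex.normSq_apply, Complex.sub_re, Complex.sub_im, Complex.mul_re, Complex.mul_im,
    Complex.conj_re, Complex.conj_im, Complex.one_re, Complex.one_im] at *
  nlinarith [mul_pos (sub_pos.2 ha') (sub_pos.2 hu')]

theorem mobius_neg_mobius (ha : ‖a‖ < 1) (hu : ‖u‖ < 1) : mobius (-a) (mobius a u) = u := by
  have h0 := one_sub_conj_mul_ne_zero ha hu
  have h2 : 1 + (starRingEnd ℂ) a * mobius a u ≠ 0 := by
    have := one_sub_conj_mul_ne_zero (a := -a) (by rwa [norm_neg]) (norm_mobius_lt ha hu)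
    simpa using this
  have e : 1 - (starRingEnd ℂ) (-a) * mobius a u = 1 + (starRingEnd ℂ) a * mobius a u := by
    simp
  have h3 : mobius a u * (1 - (starRingEnd ℂ) a * u) = u - a := by
    rw [mobius, mul_assoc, inv_mul_cancel₀ h0, mul_one]
  rw [mobius, e, mul_inv_eq_iff_eq_mul₀ h2]
  linear_combination h3

theorem mobius_zero_right (a : ℂ) : mobius a 0 = -a := by simp [mobius]

theorem ContDiffAt.mobius {E : Type*} [NormedAddCommGroup E] [NormedSpace ℝ E] {f g : E → ℂ}
    {x : E} {n : ℕ∞ω} (hf : ContDiffAt ℝ n f x) (hg : ContDiffAt ℝ n g x) (h1 : ‖f x‖ < 1)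
    (h2 : ‖g x‖ < 1) : ContDiffAt ℝ n (fun y => mobius (f y) (g y)) x := by
  have hc : ContDiffAt ℝ n (fun y => (starRingEnd ℂ) (f y)) x :=
    Complex.conjCLE.contDiff.contDiffAt.comp x hf
  exact (hg.sub hf).mul ((contDiffAt_const.sub (hc.mul hg)).inv (one_sub_conj_mul_ne_zero h1 h2))

end Mobius

/-! ### Solid tori about a displaced centre curve -/

section DiscTube

variable {m : ℕ}

/-- The union of the solid tori with centre curves `c i` and radius `R` in the tube coordinates. -/
def discTube (Y : Fin m → ℝ × ℂ → Spacetime) (c : Fin m → ℝ → ℂ) (R : ℝ) : Set Spacetime :=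
  ⋃ i, Y i '' {p | ‖p.2 - c i p.1‖ < R}

variable {Y : Fin m → ℝ × ℂ → Spacetime} {c : Fin m → ℝ → ℂ} {ρ R : ℝ}

/-- Coordinates on a solid torus around the curve `c` in which the core is the zero section. -/
noncomputable def discChart (c : ℝ → ℂ) (R : ℝ) (p : ℝ × ℂ) : ℝ × ℂ :=
  (p.1, c p.1 + R * mobius (c p.1 / R) p.2)

/-- The inverse of `discChart`. -/
noncomputable def discChartInv (c : ℝ → ℂ) (R : ℝ) (p : ℝ × ℂ) : ℝ × ℂ :=
  (p.1, mobius (-(c p.1 / R)) ((p.2 - c p.1) / R))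

theorem norm_div_lt_one {ζ : ℂ} (h : ‖ζ‖ < R) : ‖ζ / R‖ < 1 := by
  have hR : 0 < R := (norm_nonneg _).trans_lt h
  rwa [norm_div, Complex.norm_real, Real.norm_eq_abs, abs_of_pos hR, div_lt_one hR]

section Chart

variable {c : ℝ → ℂ} (hc : ContDiff ℝ ∞ c) {p : ℝ × ℂ} (hcR : ‖c p.1‖ < R)
include hcR

theorem discChart_mem (hp : ‖p.2‖ < 1) : ‖(discChart c R p).2 - c (discChart c R p).1‖ < R := by
  have hR : 0 < R := (norm_nonneg _).trans_lt hcR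
  have := norm_mobius_lt (norm_div_lt_one hcR) hp
  simp only [discChart, add_sub_cancel_left, norm_mul, Complex.norm_real, Real.norm_eq_abs,
    abs_of_pos hR]
  nlinarith

theorem discChartInv_discChart (hp : ‖p.2‖ < 1) : discChartInv c R (discChart c R p) = p := by
  have hR : (R : ℂ) ≠ 0 := by exact_mod_cast ((norm_nonneg _).trans_lt hcR).ne'
  simp only [discChart, discChartInv, add_sub_cancel_left, mul_div_cancel_left₀ _ hR,
    mobius_neg_mobius (norm_div_lt_one hcR) hp]

theorem discChartInv_mem (hp : ‖p.2 - c p.1‖ < R) : ‖(discChartInv c R p).2‖ < 1 :=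
  norm_mobius_lt (by rw [norm_neg]; exact norm_div_lt_one hcR) (norm_div_lt_one hp)

theorem discChart_discChartInv (hp : ‖p.2 - c p.1‖ < R) :
    discChart c R (discChartInv c R p) = p := by
  have hR : (R : ℂ) ≠ 0 := by exact_mod_cast ((norm_nonneg _).trans_lt hcR).ne'
  have h1 := mobius_neg_mobius (a := -(c p.1 / R)) (by rw [norm_neg]; exact norm_div_lt_one hcR)
    (norm_div_lt_one hp)
  rw [neg_neg] at h1
  simp only [discChart, discChartInv, h1, mul_div_cancel₀ _ hR, add_sub_cancel]

include hc

theorem contDiffAt_discChart (hp : ‖p.2‖ < 1) : ContDiffAt ℝ ∞ (discChart c R) p := by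
  have h1 : ContDiffAt ℝ ∞ (fun q : ℝ × ℂ => c q.1) p := (hc.comp contDiff_fst).contDiffAt
  have h2 : ContDiffAt ℝ ∞ (fun q : ℝ × ℂ => c q.1 / R) p := by
    simp only [div_eq_mul_inv]; exact h1.mul contDiffAt_const
  exact contDiffAt_fst.prodMk (h1.add (contDiffAt_const.mul
    (h2.mobius contDiffAt_snd (norm_div_lt_one hcR) hp)))

theorem contDiffAt_discChartInv (hp : ‖p.2 - c p.1‖ < R) :
    ContDiffAt ℝ ∞ (discChartInv c R) p := by
  have h1 : ContDiffAt ℝ ∞ (fun q : ℝ × ℂ => c q.1) p := (hc.comp contDiff_fst).contDiffAt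
  have h2 : ContDiffAt ℝ ∞ (fun q : ℝ × ℂ => c q.1 / R) p := by
    simp only [div_eq_mul_inv]; exact h1.mul contDiffAt_const
  have h3 : ContDiffAt ℝ ∞ (fun q : ℝ × ℂ => (q.2 - c q.1) / R) p := by
    simp only [div_eq_mul_inv]; exact (contDiffAt_snd.sub h1).mul contDiffAt_const
  exact contDiffAt_fst.prodMk (h2.neg.mobius h3 (by rw [norm_neg]; exact norm_div_lt_one hcR)
    (norm_div_lt_one hp))

theorem injective_fderiv_discChart (hp : ‖p.2‖ < 1) :
    Function.Injective (fderiv ℝ (discChart c R) p) := by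
  have hd := ((contDiffAt_discChart hc hcR hp).differentiableAt (by simp)).hasFDerivAt
  have hi := ((contDiffAt_discChartInv hc (p := discChart c R p) hcR
    (discChart_mem hcR hp)).differentiableAt (by simp)).hasFDerivAt
  have h2 := (hi.comp p hd).congr_of_eventuallyEq (f₁ := id) (by
    have c1 : ContinuousAt (fun q : ℝ × ℂ => ‖q.2‖) p := by fun_prop
    have c2 : ContinuousAt (fun q : ℝ × ℂ => ‖c q.1‖) p :=
      (hc.continuous.comp continuous_fst).norm.continuousAt
    filter_upwards [c1.eventually_lt continuousAt_const hp,
      c2.eventually_lt continuousAt_const hcR] with q h1 h2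
    exact (discChartInv_discChart h2 h1).symm)
  have h3 := h2.unique (hasFDerivAt_id p)
  intro x y hxy
  have := congrArg (fderiv ℝ (discChartInv c R) (discChart c R p)) hxy
  rw [← ContinuousLinearMap.comp_apply, ← ContinuousLinearMap.comp_apply, h3] at this
  exact this

end Chart

variable (hT : IsTube Y ρ) (hc : ∀ i, ContDiff ℝ ∞ (c i))
  (hper : ∀ i, Function.Periodic (c i) (2 * Real.pi)) (hcR : ∀ i s, ‖c i s‖ < R)
  (hR : 2 * R ≤ ρ)

theorem norm_lt_of_mem_disc (hcR : ∀ i s, ‖c i s‖ < R) (hR : 2 * R ≤ ρ) {i : Fin m} {p : ℝ × ℂ}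
    (hp : ‖p.2 - c i p.1‖ < R) : ‖p.2‖ < ρ := by
  have := norm_add_le (p.2 - c i p.1) (c i p.1)
  rw [sub_add_cancel] at this
  linarith [hcR i p.1]

include hT hc hper hcR hR

/-- The discs are centred at c, but the core has to be the zero section. Since ‖c‖ < R, zero lies
inside each disc, and a fibrewise Möbius transformation carries the centre of the unit disc to it.
The condition 2 R ≤ ρ keeps the discs inside the tube. -/
theorem isTubularNeighborhood_discTube :
    IsTubularNeighborhood (fun i s => Y i (s, 0)) (discTube Y c R) := by
  set e : EuclideanSpace ℝ (Fin 2) ≃ₗᵢ[ℝ] ℂ := Complex.orthonormalBasisOneI.repr.symm with he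
  set T : (ℝ × EuclideanSpace ℝ (Fin 2)) ≃L[ℝ] (ℝ × ℂ) :=
    (ContinuousLinearEquiv.refl ℝ ℝ).prodCongr e.toContinuousLinearEquiv with hTd
  have hTa : ∀ s z, T (s, z) = (s, e z) := fun _ _ => rfl
  have hball : ∀ z ∈ Metric.ball (0 : EuclideanSpace ℝ (Fin 2)) 1, ‖e z‖ < 1 := by
    intro z hz
    rwa [e.norm_map, ← mem_ball_zero_iff]
  have hlt : ∀ i s z, ‖z‖ < 1 → ‖(discChart (c i) R (s, z)).2‖ < ρ := fun i s z hz =>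
    norm_lt_of_mem_disc hcR hR (discChart_mem (p := (s, z)) (hcR i s) hz)
  -- For the empty link nothing forces R to be positive.
  have hRC : (R : ℂ) ≠ 0 ∨ m = 0 := by
    rcases Nat.eq_zero_or_pos m with h | h
    · exact .inr h
    · exact .inl (by exact_mod_cast ((norm_nonneg _).trans_lt (hcR ⟨0, h⟩ 0)).ne')
  refine ⟨fun i p => Y i (discChart (c i) R (T p)), ?_, ?_, ?_, ?_, ?_, ?_⟩
  · rintro i ⟨s, z⟩ ⟨-, hz⟩
    exact ((hT.smooth i).contDiffAt.comp (s, z) (ContDiffAt.comp (g := discChart (c i) R) (s, z)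
      (contDiffAt_discChart (hc i) (hcR i s) (hball z hz))
      T.contDiff.contDiffAt)).contDiffWithinAt
  · intro i s z hz
    simp only [hTa, discChart, hper i s]
    simpa using hT.periodic i s (c i s + R * mobius (c i s / R) (e z)) 1
  · intro i s
    have : (R : ℂ) ≠ 0 := hRC.resolve_right fun h => by subst h; exact i.elim0
    simp only [hTa, discChart, map_zero, mobius_zero_right]
    rw [mul_neg, mul_div_cancel₀ _ this, add_neg_cancel]
  · intro i s z hz
    have h1 := contDiffAt_discChart (hc i) (p := T (s, z)) (hcR i s) (hball z hz)
    have h2 : HasFDerivAt (fun p => Y i (discChart (c i) R (T p))) _ (s, z) :=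
      ((hT.smooth i).differentiable_infty _).hasFDerivAt.comp (s, z)
        ((h1.differentiableAt (by simp)).hasFDerivAt.comp (s, z) T.hasFDerivAt)
    rw [h2.fderiv]
    have hinj : Function.Injective ((fderiv ℝ (Y i) (discChart (c i) R (T (s, z)))).comp
        ((fderiv ℝ (discChart (c i) R) (T (s, z))).comp
          (T : ℝ × EuclideanSpace ℝ (Fin 2) →L[ℝ] ℝ × ℂ))) :=
      (hT.invertible i _ (hlt i s _ (hball z hz))).injective.comp
        ((injective_fderiv_discChart (hc i) (hcR i s) (hball z hz)).comp T.injective)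
    exact ⟨hinj, (LinearMap.injective_iff_surjective_of_finrank_eq_finrank
      (f := (((fderiv ℝ (Y i) (discChart (c i) R (T (s, z)))).comp
        ((fderiv ℝ (discChart (c i) R) (T (s, z))).comp
          (T : ℝ × EuclideanSpace ℝ (Fin 2) →L[ℝ] ℝ × ℂ)) :
          ℝ × EuclideanSpace ℝ (Fin 2) →L[ℝ] Spacetime) :
          ℝ × EuclideanSpace ℝ (Fin 2) →ₗ[ℝ] Spacetime))
      (by simp [Module.finrank_prod])).1 hinj⟩
  · intro i j s s' z hz z' hz' h
    obtain ⟨rfl, h2, n, hn⟩ := hT.inj i j _ _ (hlt i s _ (hball z hz))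
      (hlt j s' _ (hball z' hz')) h
    refine ⟨rfl, ?_, n, hn⟩
    have hs' : s' = s + n * (2 * Real.pi) := hn
    have hcs : c i s' = c i s := by rw [hs']; exact (hper i).int_mul n s
    have h3 : discChart (c i) R (s, e z) = discChart (c i) R (s, e z') :=
      Prod.ext rfl (by simpa only [hTa, discChart, hcs] using h2)
    have h4 := congrArg (discChartInv (c i) R) h3
    rw [discChartInv_discChart (hcR i _) (hball z hz),
      discChartInv_discChart (hcR i _) (hball z' hz')] at h4
    exact e.injective (Prod.ext_iff.1 h4).2
  · refine iUnion_congr fun i => Subset.antisymm ?_ ?_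
    · rintro _ ⟨p, hp, rfl⟩
      refine ⟨T.symm (discChartInv (c i) R p), ⟨mem_univ _, ?_⟩, ?_⟩
      · have := discChartInv_mem (hcR i p.1) hp
        rw [mem_ball_zero_iff]
        have e1 : (T.symm (discChartInv (c i) R p)).2 = e.symm (discChartInv (c i) R p).2 := rfl
        rwa [e1, e.symm.norm_map]
      · simp only [T.apply_symm_apply]
        rw [discChart_discChartInv (hcR i p.1) hp]
    · rintro _ ⟨⟨s, z⟩, ⟨-, hz⟩, rfl⟩
      exact ⟨_, discChart_mem (p := (s, e z)) (hcR i s) (hball z hz), rfl⟩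

/-- The rotation of the solid tori about their centre curves. -/
theorem isDiffeoOn_discTube {η : ℂ} (hη : ‖η‖ = 1) :
    IsDiffeoOn (tubeDesc Y ρ fun i p => Y i (p.1, c i p.1 + η * (p.2 - c i p.1)))
      (discTube Y c R) := by
  have hHper : ∀ η : ℂ, ∀ i s ζ (n : ℤ),
      Y i (s + n * (2 * Real.pi), c i (s + n * (2 * Real.pi)) +
        η * (ζ - c i (s + n * (2 * Real.pi)))) = Y i (s, c i s + η * (ζ - c i s)) := by
    intro η i s ζ n
    rw [(hper i).int_mul n s, hT.periodic]
  have hlt : ∀ {i} {p : ℝ × ℂ}, ‖p.2 - c i p.1‖ < R → ‖p.2‖ < ρ := norm_lt_of_mem_disc hcR hR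
  have happ : ∀ η : ℂ, ∀ i p, ‖p.2 - c i p.1‖ < R →
      tubeDesc Y ρ (fun i p => Y i (p.1, c i p.1 + η * (p.2 - c i p.1))) (Y i p) =
        Y i (p.1, c i p.1 + η * (p.2 - c i p.1)) := fun η i p hp =>
    hT.tubeDesc_apply (hHper η) i (hlt hp)
  have hmem : ∀ η : ℂ, ‖η‖ = 1 → ∀ i (p : ℝ × ℂ), ‖p.2 - c i p.1‖ < R →
      ‖c i p.1 + η * (p.2 - c i p.1) - c i p.1‖ < R := by
    intro η hη i p hp
    rwa [add_sub_cancel_left, norm_mul, hη, one_mul]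
  have hsm : ∀ η : ℂ, ContDiffOn ℝ ∞
      (tubeDesc Y ρ fun i p => Y i (p.1, c i p.1 + η * (p.2 - c i p.1))) (discTube Y c R) := by
    intro η ξ hξ
    obtain ⟨i, p, hp, rfl⟩ := mem_iUnion.1 hξ
    refine (hT.contDiffAt_tubeDesc' (hHper η) le_rfl (hlt hp) ?_).contDiffWithinAt
    have h1 : ContDiff ℝ ∞ fun q : ℝ × ℂ => c i q.1 := (hc i).comp contDiff_fst
    exact ((hT.smooth i).comp (contDiff_fst.prodMk
      (h1.add (contDiff_const.mul (contDiff_snd.sub h1))))).contDiffAt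
  have hmaps : ∀ η : ℂ, ‖η‖ = 1 → MapsTo
      (tubeDesc Y ρ fun i p => Y i (p.1, c i p.1 + η * (p.2 - c i p.1)))
      (discTube Y c R) (discTube Y c R) := by
    intro η hη ξ hξ
    obtain ⟨i, p, hp, rfl⟩ := mem_iUnion.1 hξ
    rw [happ η i p hp]
    exact mem_iUnion.2 ⟨i, _, hmem η hη i p hp, rfl⟩
  have hinv : ∀ η η' : ℂ, ‖η‖ = 1 → η' * η = 1 → LeftInvOn
      (tubeDesc Y ρ fun i p => Y i (p.1, c i p.1 + η' * (p.2 - c i p.1)))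
      (tubeDesc Y ρ fun i p => Y i (p.1, c i p.1 + η * (p.2 - c i p.1))) (discTube Y c R) := by
    intro η η' hη h ξ hξ
    obtain ⟨i, p, hp, rfl⟩ := mem_iUnion.1 hξ
    rw [happ η i p hp, happ η' i _ (hmem η hη i p hp)]
    congr 1
    refine Prod.ext rfl ?_
    simp only [add_sub_cancel_left]
    rw [← mul_assoc, h, one_mul, add_sub_cancel]
  have hη0 : η ≠ 0 := by rintro rfl; simp at hη
  exact ⟨hsm η, hmaps η hη, _, hsm η⁻¹, hmaps η⁻¹ (by rw [norm_inv, hη, inv_one]),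
    hinv η η⁻¹ hη (inv_mul_cancel₀ hη0),
    hinv η⁻¹ η (by rw [norm_inv, hη, inv_one]) (mul_inv_cancel₀ hη0)⟩

end DiscTube

/-! ### Smallness of the displacement in C^r -/

section CrNorm

/-- There are r + 1 terms, and a supremum preserves only ≤; dividing by r + 2 restores the strict
inequality. -/
theorem crNorm_lt {r : ℕ} {Ω : Set Spacetime} {F : Spacetime → Spacetime} {ε : ℝ} (hε : 0 < ε)
    (h : ∀ ξ ∈ Ω, ∀ k ≤ r, ‖iteratedFDeriv ℝ k F ξ‖ < ε / (r + 2)) :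
    crNorm r Ω F < ENNReal.ofReal ε := by
  have h1 : crNorm r Ω F ≤ ∑ _k ∈ Finset.range (r + 1), ENNReal.ofReal (ε / (r + 2)) := by
    refine Finset.sum_le_sum fun k hk => iSup₂_le fun ξ hξ => ?_
    rw [← ofReal_norm]
    exact ENNReal.ofReal_le_ofReal (h ξ hξ k (Nat.lt_succ_iff.1 (Finset.mem_range.1 hk))).le
  refine h1.trans_lt ?_
  rw [← ENNReal.ofReal_sum_of_nonneg (fun _ _ => by positivity)]
  refine (ENNReal.ofReal_lt_ofReal_iff hε).2 ?_
  simp only [Finset.sum_const, Finset.card_range, nsmul_eq_mul]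
  rw [mul_div_assoc', div_lt_iff₀ (by positivity)]
  push_cast
  linarith

variable {m : ℕ} {Y : Fin m → ℝ × ℂ → Spacetime} {ρ : ℝ} {E : Type*} [NormedAddCommGroup E]
  [NormedSpace ℝ E]

/-- The displacement is C^r jointly in the angle, the parameter and the point, and vanishes
identically when angle and parameter are zero. The transverse coordinate is also a small variable,
so the estimate holds on thin tubes with no factor depending on their radius. -/
theorem eventually_iteratedFDeriv_tubeDesc_lt (hT : IsTube Y ρ) {d : Fin m → E × ℝ → ℂ} {r : ℕ}
    (hd : ∀ i s, ContDiffAt ℝ r (d i) (0, s)) (hd0 : ∀ i s, d i (0, s) = 0)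
    (hper : ∀ i θ s (k : ℤ), d i (θ, s + k * (2 * Real.pi)) = d i (θ, s)) {ε : ℝ} (hε : 0 < ε) :
    ∀ᶠ x : (ℝ × E) × ℂ in 𝓝 0, ∀ i s, ∀ k ≤ r, ‖iteratedFDeriv ℝ k (tubeDesc Y ρ fun i p =>
      Y i (p.1, Complex.exp (x.1.1 * Complex.I) * p.2 + d i (x.1.2, p.1)) - Y i p)
        (Y i (s, x.2))‖ < ε := by
  set H : ℝ × E → Fin m → ℝ × ℂ → Spacetime := fun η i p =>
    Y i (p.1, Complex.exp (η.1 * Complex.I) * p.2 + d i (η.2, p.1)) - Y i p with hH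
  have hHper : ∀ η i s ζ (n : ℤ), H η i (s + n * (2 * Real.pi), ζ) = H η i (s, ζ) := by
    intro η i s ζ n
    simp only [hH, hper, hT.periodic]
  have hH0 : tubeDesc Y ρ (H 0) = fun _ => 0 := by
    ext1 ξ
    simp only [tubeDesc, hH, hd0, Prod.fst_zero, Prod.snd_zero, Complex.ofReal_zero, zero_mul,
      Complex.exp_zero, one_mul, add_zero, Prod.mk.eta, sub_self, dite_eq_ite, ite_self]
  refine eventually_all.2 fun i => ?_
  have key : ∀ k ∈ Finset.range (r + 1), ∀ᶠ x : (ℝ × E) × ℂ in 𝓝 0, ∀ s,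
      ‖iteratedFDeriv ℝ k (tubeDesc Y ρ (H x.1)) (Y i (s, x.2))‖ < ε := by
    intro k hk
    refine eventually_forall_periodic (fun x s n h => by rwa [hT.periodic] at h) fun s => ?_
    have h0 : ‖((s, (0 : ℂ)) : ℝ × ℂ).2‖ < ρ := by simpa using hT.pos
    have h1 : ContDiffAt ℝ r (fun q : (ℝ × E) × (ℝ × ℂ) => H q.1 i q.2) (0, (s, 0)) := by
      have hY : ∀ q, ContDiffAt ℝ r (Y i) q := fun q =>
        ((hT.smooth i).of_le ENat.LEInfty.out).contDiffAt
      have hexp : ContDiff ℝ r (fun q : (ℝ × E) × (ℝ × ℂ) =>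
          Complex.exp (q.1.1 * Complex.I) * q.2.2) :=
        (((Complex.ofRealCLM.contDiff.comp contDiff_fst.fst).mul contDiff_const).cexp).mul
          contDiff_snd.snd
      have hdc : ContDiffAt ℝ r (fun q : (ℝ × E) × (ℝ × ℂ) => d i (q.1.2, q.2.1)) (0, (s, 0)) :=
        ContDiffAt.comp (g := d i) (f := fun q : (ℝ × E) × (ℝ × ℂ) => (q.1.2, q.2.1))
          (0, (s, 0)) (hd i s) (by fun_prop)
      exact ((hY _).comp (0, (s, 0)) (contDiffAt_snd.fst.prodMk
        (hexp.contDiffAt.add hdc))).sub ((hY _).comp (0, (s, 0)) contDiffAt_snd)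
    have h2 := (hT.contDiffAt_tubeDesc hHper ENat.LEInfty.out h0 h1).of_le
      (show ((0 + k : ℕ) : ℕ∞ω) ≤ (r : ℕ∞ω) by
        exact_mod_cast (by have := Finset.mem_range.1 hk; lia))
    have h3 := (ContDiffAt.iteratedFDeriv_param (V := fun η => tubeDesc Y ρ (H η)) k h2).continuousAt
    have c1 : ContinuousAt (fun q : ((ℝ × E) × ℂ) × ℝ => (q.1.1, Y i (q.2, q.1.2))) (0, s) := by
      have := (hT.smooth i).continuous
      fun_prop
    have h4 : ‖iteratedFDeriv ℝ k (tubeDesc Y ρ (H (0, Y i (s, 0)).1)) (0, Y i (s, 0)).2‖ < ε := by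
      simpa only [hH0, iteratedFDeriv_fun_zero, Pi.zero_apply, norm_zero] using hε
    exact c1.eventually (h3.norm.eventually_lt continuousAt_const h4)
  filter_upwards [(Finset.range (r + 1)).eventually_all.2 key] with x hx s k hk
  exact hx k (Finset.mem_range.2 (Nat.lt_succ_iff.2 hk)) s

end CrNorm

/-! ### Stability of the partition into intervals -/

section Partition

section Real

variable {f g : ℝ → ℝ} {c a b a' b' : ℝ}

/-- At its maximum over the interval g is critical, hence exceeds c there, and f, being c-close, is
positive. -/
theorem IsPosInterval.exists_pos_of_close (hg : Continuous g)
    (hgn : ∀ s, |g s| ≤ c → deriv g s ≠ 0) (hfg : ∀ s, |f s - g s| < c)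
    (h : IsPosInterval g a' b') : ∃ t ∈ Ioo a' b', 0 < f t := by
  obtain ⟨t, ht, hmax⟩ := isCompact_Icc.exists_isMaxOn (nonempty_Icc.2 h.1.le) hg.continuousOn
  have hmid : (a' + b') / 2 ∈ Ioo a' b' := ⟨by linarith [h.1], by linarith [h.1]⟩
  have hpos : 0 < g t := (h.2.2.2 _ hmid).trans_le (hmax (Ioo_subset_Icc_self hmid))
  have ht' : t ∈ Ioo a' b' := by
    refine ⟨ht.1.lt_of_ne fun e => ?_, ht.2.lt_of_ne fun e => ?_⟩
    · rw [← e, h.2.1] at hpos; exact hpos.false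
    · rw [e, h.2.2.1] at hpos; exact hpos.false
  have hd := (hmax.isLocalMax (Icc_mem_nhds ht'.1 ht'.2)).deriv_eq_zero
  have hc : c < |g t| := not_le.1 fun hle => hgn t hle hd
  rw [abs_of_pos hpos] at hc
  exact ⟨t, ht', by linarith [(abs_lt.1 (hfg t)).1]⟩

/-- A nonpositive minimum of f would be interior and critical, hence below -c, which would make g
negative there. -/
theorem pos_of_close (hf : Continuous f) (hfn : ∀ s, |f s| ≤ c → deriv f s ≠ 0)
    (hfg : ∀ s, |f s - g s| < c) {s₁ s₂ : ℝ} (h1 : 0 < f s₁) (h2 : 0 < f s₂)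
    (hpos : ∀ s ∈ Icc s₁ s₂, 0 < g s) : ∀ s ∈ Icc s₁ s₂, 0 < f s := by
  intro s hs
  obtain ⟨t, ht, hmin⟩ := isCompact_Icc.exists_isMinOn ⟨s, hs⟩ hf.continuousOn
  refine lt_of_lt_of_le ?_ (hmin hs)
  by_contra hneg
  have ht' : t ∈ Ioo s₁ s₂ := by
    refine ⟨ht.1.lt_of_ne fun e => ?_, ht.2.lt_of_ne fun e => ?_⟩
    · rw [e] at h1; exact hneg h1
    · rw [← e] at h2; exact hneg h2
  have hd := (hmin.isLocalMin (Icc_mem_nhds ht'.1 ht'.2)).deriv_eq_zero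
  have hc : c < |f t| := not_le.1 fun hle => hfn t hle hd
  rw [abs_of_nonpos (not_lt.1 hneg)] at hc
  linarith [(abs_lt.1 (hfg t)).1, hpos t ht]

/-- Between points of the two overlaps g is positive, hence so is f by `pos_of_close`, and the two
intervals of f cannot be separated by a zero. -/
theorem IsPosInterval.eq_of_close (hf : Continuous f) (hc : 0 ≤ c)
    (hfn : ∀ s, |f s| ≤ c → deriv f s ≠ 0)
    (hfg : ∀ s, |f s - g s| < c) (h' : IsPosInterval g a' b') {a₁ b₁ a₂ b₂ : ℝ}
    (h₁ : IsPosInterval f a₁ b₁) (h₂ : IsPosInterval f a₂ b₂)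
    (k₁ : (Ioo a₁ b₁ ∩ Ioo a' b').Nonempty) (k₂ : (Ioo a₂ b₂ ∩ Ioo a' b').Nonempty) :
    a₁ = a₂ ∧ b₁ = b₂ := by
  obtain ⟨s₁, hs₁, hs₁'⟩ := k₁
  obtain ⟨s₂, hs₂, hs₂'⟩ := k₂
  have hnd : ∀ s, f s = 0 → deriv f s ≠ 0 := fun s h => hfn s (by simpa [h] using hc)
  wlog hle : s₁ ≤ s₂ generalizing a₁ b₁ a₂ b₂ s₁ s₂
  · obtain ⟨e1, e2⟩ := this h₂ h₁ s₂ hs₂ hs₂' s₁ hs₁ hs₁' (not_le.1 hle).le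
    exact ⟨e1.symm, e2.symm⟩
  have hp := pos_of_close hf hfn hfg (h₁.2.2.2 _ hs₁) (h₂.2.2.2 _ hs₂) fun s hs =>
    h'.2.2.2 s ⟨hs₁'.1.trans_le hs.1, hs.2.trans_lt hs₂'.2⟩
  have hb : s₂ ≤ b₁ := by
    by_contra hlt
    have := hp b₁ ⟨hs₁.2.le, (not_le.1 hlt).le⟩
    rw [h₁.2.2.1] at this
    exact this.false
  exact h₁.eq h₂ hnd ⟨(hs₁.1.trans_le hle).le, hb⟩ (Ioo_subset_Icc_self hs₂)

end Real

variable {m : ℕ} {γ : Fin m → ℝ → Spacetime} {Φ : Spacetime → Spacetime}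

theorem mem_positiveIntervals {I : Set Spacetime} : I ∈ positiveIntervals γ ↔
    ∃ i a b, IsPosInterval (deriv (heightAlong (γ i))) a b ∧ I = γ i '' Ioo a b := by
  simp only [positiveIntervals, IsPosInterval, and_assoc]; rfl

theorem image_Ioo_add_int {c : ℝ → Spacetime} (hper : Function.Periodic c (2 * Real.pi))
    (a b : ℝ) (n : ℤ) :
    c '' Ioo (a + n * (2 * Real.pi)) (b + n * (2 * Real.pi)) = c '' Ioo a b := by
  rw [← Set.image_add_const_Ioo, image_image]
  simp only [hper.int_mul n _]

theorem Function.Periodic.deriv_heightAlong {c : ℝ → Spacetime}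
    (hper : Function.Periodic c (2 * Real.pi)) :
    Function.Periodic (deriv (heightAlong c)) (2 * Real.pi) :=
  Function.Periodic.deriv_periodic fun s => by simp only [heightAlong, hper s]

theorem exists_deriv_heightAlong_neg {c : ℝ → Spacetime} (hc : ContDiff ℝ ∞ c)
    (hper : Function.Periodic c (2 * Real.pi))
    (hnd : ∀ s, deriv (heightAlong c) s = 0 → deriv (deriv (heightAlong c)) s ≠ 0) :
    ∃ t, deriv (heightAlong c) t < 0 := by
  have hh : ContDiff ℝ ∞ (heightAlong c) := contDiff_euclidean.1 hc 2
  refine exists_neg_of_integral_eq_zero hh.deriv_infty.continuous ?_ hnd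
  rw [intervalIntegral.integral_deriv_eq_sub (fun s _ => hh.differentiable_infty s)
    (hh.deriv_infty.continuous.intervalIntegrable _ _), sub_eq_zero]
  simp only [heightAlong, hper.eq]

/-- Two links whose height functions are `C ^ 1`-close relative to the nondegeneracy of their
critical points have the same partition into intervals. -/
theorem partition_descends {c : Fin m → ℝ} (hc : ∀ i, 0 < c i) (hγ : ∀ i, ContDiff ℝ ∞ (γ i))
    (hγ₁ : ∀ i, ContDiff ℝ ∞ (imageLink Φ γ i)) (hper : ∀ i, Function.Periodic (γ i) (2 * Real.pi))
    (hinj : ∀ i j s s', imageLink Φ γ i s = imageLink Φ γ j s' →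
      i = j ∧ ∃ n : ℤ, s' = s + n * (2 * Real.pi))
    (hf : ∀ i s, |deriv (heightAlong (γ i)) s| ≤ c i → deriv (deriv (heightAlong (γ i))) s ≠ 0)
    (hg : ∀ i s, |deriv (heightAlong (imageLink Φ γ i)) s| ≤ c i →
      deriv (deriv (heightAlong (imageLink Φ γ i))) s ≠ 0)
    (hfg : ∀ i s, |deriv (heightAlong (γ i)) s - deriv (heightAlong (imageLink Φ γ i)) s| < c i) :
    InGeneralPosition (imageLink Φ γ) ∧
      (∀ I' ∈ positiveIntervals (imageLink Φ γ),
        ∃! I, I ∈ positiveIntervals γ ∧ (Φ '' I ∩ I').Nonempty) ∧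
      (∀ I ∈ positiveIntervals γ,
        ∃! I', I' ∈ positiveIntervals (imageLink Φ γ) ∧ (Φ '' I ∩ I').Nonempty) := by
  have hper₁ : ∀ i, Function.Periodic (imageLink Φ γ i) (2 * Real.pi) := fun i s => by
    simp only [imageLink, hper i s]
  have hnd : ∀ i s, deriv (heightAlong (γ i)) s = 0 → deriv (deriv (heightAlong (γ i))) s ≠ 0 :=
    fun i s h => hf i s (by simpa [h] using (hc i).le)
  have hnd₁ : InGeneralPosition (imageLink Φ γ) := fun i s h => hg i s (by simpa [h] using (hc i).le)
  have hfc : ∀ i, Continuous (deriv (heightAlong (γ i))) := fun i =>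
    (contDiff_euclidean.1 (hγ i) 2).deriv_infty.continuous
  have hgc : ∀ i, Continuous (deriv (heightAlong (imageLink Φ γ i))) := fun i =>
    (contDiff_euclidean.1 (hγ₁ i) 2).deriv_infty.continuous
  have hgf : ∀ i s, |deriv (heightAlong (imageLink Φ γ i)) s - deriv (heightAlong (γ i)) s| < c i :=
    fun i s => by rw [abs_sub_comm]; exact hfg i s
  -- overlapping intervals can be shifted to overlapping parameter intervals
  have hmeet : ∀ i j a b a' b',
      (Φ '' (γ i '' Ioo a b) ∩ imageLink Φ γ j '' Ioo a' b').Nonempty → i = j ∧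
        ∃ n : ℤ, (Ioo (a + n * (2 * Real.pi)) (b + n * (2 * Real.pi)) ∩ Ioo a' b').Nonempty := by
    rintro i j a b a' b' ⟨_, ⟨_, ⟨s, hs, rfl⟩, rfl⟩, s', hs', h⟩
    obtain ⟨hij, n, hn⟩ := hinj i j s s' h.symm
    exact ⟨hij, n, s', ⟨by linarith [hs.1], by linarith [hs.2]⟩, hs'⟩
  refine ⟨hnd₁, fun I' hI' => ?_, fun I hI => ?_⟩
  · obtain ⟨i, a', b', h', rfl⟩ := mem_positiveIntervals.1 hI'
    obtain ⟨t, ht, hft⟩ := h'.exists_pos_of_close (hgc i) (hg i) (hfg i)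
    obtain ⟨a, b, hab, htab⟩ := exists_isPosInterval_of_pos (hfc i) (hper i).deriv_heightAlong
      (exists_deriv_heightAlong_neg (hγ i) (hper i) (hnd i)) hft
    refine ⟨γ i '' Ioo a b, ⟨mem_positiveIntervals.2 ⟨i, a, b, hab, rfl⟩,
      ⟨_, ⟨_, ⟨t, htab, rfl⟩, rfl⟩, t, ht, rfl⟩⟩, ?_⟩
    rintro _ ⟨hI, hmt⟩
    obtain ⟨j, a₁, b₁, h₁, rfl⟩ := mem_positiveIntervals.1 hI
    obtain ⟨rfl, n, hn⟩ := hmeet _ _ _ _ _ _ hmt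
    obtain ⟨e1, e2⟩ := h'.eq_of_close (hfc j) (hc j).le (hf j) (hfg j)
      (h₁.add_int (hper j).deriv_heightAlong n) hab hn ⟨t, htab, ht⟩
    rw [← e1, ← e2, image_Ioo_add_int (hper j)]
  · obtain ⟨i, a, b, h, rfl⟩ := mem_positiveIntervals.1 hI
    obtain ⟨t, ht, hft⟩ := h.exists_pos_of_close (hfc i) (hf i) (hgf i)
    obtain ⟨a', b', hab', htab⟩ := exists_isPosInterval_of_pos (hgc i)
      (hper₁ i).deriv_heightAlong
      (exists_deriv_heightAlong_neg (hγ₁ i) (hper₁ i) (hnd₁ i)) hft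
    refine ⟨imageLink Φ γ i '' Ioo a' b', ⟨mem_positiveIntervals.2 ⟨i, a', b', hab', rfl⟩,
      ⟨_, ⟨_, ⟨t, ht, rfl⟩, rfl⟩, t, htab, rfl⟩⟩, ?_⟩
    rintro _ ⟨hI', hmt⟩
    obtain ⟨j, a₁, b₁, h₁, rfl⟩ := mem_positiveIntervals.1 hI'
    obtain ⟨rfl, n, hn⟩ := hmeet _ _ _ _ _ _ hmt
    obtain ⟨e1, e2⟩ := (h.add_int (hper i).deriv_heightAlong n).eq_of_close (hgc i) (hc i).le (hg i)
      (hgf i) h₁ (hab'.add_int (hper₁ i).deriv_heightAlong n) (by rwa [inter_comm])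
      ⟨t + n * (2 * Real.pi), ⟨by linarith [htab.1], by linarith [htab.2]⟩,
        by linarith [ht.1], by linarith [ht.2]⟩
    rw [e1, e2, image_Ioo_add_int (hper₁ i)]

end Partition

/-! ### The types of spatial critical points -/

section Types

variable {v : Spacetime → ℝ} {ξ : Spacetime}

/-- Both sign conditions persist on a ball, so the Hessian is negative definite along every segment
from ξ inside the time slice. The derivative of v along the segment starts at 0 and does not
increase, so v does not increase either. -/
theorem isLocalMaxOn_of_spatialHessian (hv : ContDiff ℝ 2 v) (h0 : IsSpatialCritical v ξ)
    (hdet : 0 < spatialHessianDet v ξ)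
    (htr : pderiv 0 (pderiv 0 v) ξ + pderiv 1 (pderiv 1 v) ξ < 0) :
    IsLocalMaxOn v {η | η 2 = ξ 2} ξ := by
  have hd : ∀ i, ContDiff ℝ 1 (pderiv i v) := fun i => hv.pderiv' (by norm_num) i
  have hd0 : Differentiable ℝ v := hv.differentiable (by norm_num)
  have hd1 : ∀ i, Differentiable ℝ (pderiv i v) := fun i => (hd i).differentiable one_ne_zero
  have hcd : ∀ i j, Continuous (pderiv j (pderiv i v)) := fun i j =>
    ((hd i).pderiv' (m := 0) (by norm_num) j).continuous
  have c1 : Continuous (spatialHessianDet v) :=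
    ((hcd 0 0).mul (hcd 1 1)).sub ((hcd 0 1).mul (hcd 1 0))
  have c2 : Continuous fun η => pderiv 0 (pderiv 0 v) η + pderiv 1 (pderiv 1 v) η :=
    (hcd 0 0).add (hcd 1 1)
  have hev := (c1.continuousAt.eventually (lt_mem_nhds hdet)).and
    (c2.continuousAt.eventually (gt_mem_nhds htr))
  obtain ⟨δ, hδ, H⟩ := Metric.eventually_nhds_iff.1 hev
  filter_upwards [mem_nhdsWithin_of_mem_nhds (Metric.ball_mem_nhds ξ hδ),
    self_mem_nhdsWithin] with η hη hη2
  set h : Spacetime := η - ξ with hh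
  have h2 : h 2 = 0 := by rw [hh, PiLp.sub_apply, show η 2 = ξ 2 from hη2, sub_self]
  have hline : ∀ (u : Spacetime → ℝ), Differentiable ℝ u → ∀ t : ℝ,
      HasDerivAt (fun t : ℝ => u (ξ + t • h))
        (h 0 * pderiv 0 u (ξ + t • h) + h 1 * pderiv 1 u (ξ + t • h)) t := by
    intro u hu t
    have := (hu (ξ + t • h)).hasFDerivAt.comp_hasDerivAt t (hasDerivAt_add_smul ξ h t)
    rw [fderiv_apply_eq, h2, zero_mul, add_zero] at this
    exact this
  have hball : ∀ t ∈ Icc (0 : ℝ) 1, dist (ξ + t • h) ξ < δ := by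
    intro t ht
    rw [dist_eq_norm, add_sub_cancel_left, norm_smul, Real.norm_eq_abs, abs_of_nonneg ht.1]
    rw [mem_ball_iff_norm] at hη
    exact (mul_le_of_le_one_left (norm_nonneg _) ht.2).trans_lt hη
  set φ' : ℝ → ℝ := fun t => h 0 * pderiv 0 v (ξ + t • h) + h 1 * pderiv 1 v (ξ + t • h) with hφ'
  have hφ'd := fun t => ((hline _ (hd1 0) t).const_mul (h 0)).add
    ((hline _ (hd1 1) t).const_mul (h 1))
  have hanti : AntitoneOn φ' (Icc 0 1) := by
    refine antitoneOn_of_deriv_nonpos (convex_Icc 0 1)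
      (fun t _ => (hφ'd t).continuousAt.continuousWithinAt)
      (fun t _ => (hφ'd t).differentiableAt.differentiableWithinAt) fun t ht => ?_
    rw [interior_Icc] at ht
    obtain ⟨k1, k2⟩ := H (hball t (Ioo_subset_Icc_self ht))
    have k3 := pderiv_comm hv 0 1 (ξ + t • h)
    have e : deriv φ' t = _ := (hφ'd t).deriv
    rw [e]
    rw [spatialHessianDet] at k1
    set A := pderiv 0 (pderiv 0 v) (ξ + t • h)
    set C := pderiv 1 (pderiv 1 v) (ξ + t • h)
    set B := pderiv 1 (pderiv 0 v) (ξ + t • h)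
    rw [k3] at k1 ⊢
    have hA : A < 0 := by nlinarith [sq_nonneg B, sq_nonneg A]
    have hform : 0 ≤ A * (h 0 * (h 0 * A + h 1 * B) + h 1 * (h 0 * B + h 1 * C)) := by
      have : A * (h 0 * (h 0 * A + h 1 * B) + h 1 * (h 0 * B + h 1 * C)) =
        (A * h 0 + B * h 1) ^ 2 + (A * C - B * B) * h 1 ^ 2 := by ring
      rw [this]
      positivity
    exact nonpos_of_mul_nonneg_right hform hA
  have hφ0 : φ' 0 = 0 := by simp [hφ', h0.1, h0.2]
  have hanti' : AntitoneOn (fun t : ℝ => v (ξ + t • h)) (Icc 0 1) := by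
    refine antitoneOn_of_deriv_nonpos (convex_Icc 0 1)
      (fun t _ => (hline v hd0 t).continuousAt.continuousWithinAt)
      (fun t _ => (hline v hd0 t).differentiableAt.differentiableWithinAt) fun t ht => ?_
    rw [interior_Icc] at ht
    rw [(hline v hd0 t).deriv, ← hφ0]
    exact hanti (left_mem_Icc.2 zero_le_one) (Ioo_subset_Icc_self ht) ht.1.le
  have := hanti' (left_mem_Icc.2 zero_le_one) (right_mem_Icc.2 zero_le_one) zero_le_one
  simpa [hh] using this

theorem isSpatialMax_of_spatialHessian (hv : ContDiff ℝ 2 v) (h0 : IsSpatialCritical v ξ)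
    (hdet : 0 < spatialHessianDet v ξ)
    (htr : pderiv 0 (pderiv 0 v) ξ + pderiv 1 (pderiv 1 v) ξ < 0) : IsSpatialMax v ξ :=
  ⟨h0, hdet.ne', isLocalMaxOn_of_spatialHessian hv h0 hdet htr⟩

theorem isSpatialMin_of_spatialHessian (hv : ContDiff ℝ 2 v) (h0 : IsSpatialCritical v ξ)
    (hdet : 0 < spatialHessianDet v ξ)
    (htr : 0 < pderiv 0 (pderiv 0 v) ξ + pderiv 1 (pderiv 1 v) ξ) : IsSpatialMin v ξ := by
  have e : ∀ (u : Spacetime → ℝ) i, pderiv i (-u) = -pderiv i u := fun u i => by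
    ext ξ; simp [pderiv, fderiv_neg]
  have hdet' : spatialHessianDet (-v) ξ = spatialHessianDet v ξ := by
    simp only [spatialHessianDet, e, Pi.neg_apply]; ring
  refine ⟨h0, hdet.ne', ?_⟩
  have := isLocalMaxOn_of_spatialHessian (v := -v) hv.neg (by simpa [IsSpatialCritical, e] using h0)
    (by rwa [hdet']) (by simp only [e, Pi.neg_apply]; linarith)
  simpa using this.neg

/-- A linear relation between the rows would make the 3 × 3 determinant with p vanish. -/
theorem rank_stabilityMatrix {p : Spacetime} (hp : jetDet v ξ p ≠ 0) :
    (stabilityMatrix v ξ).rank = 2 := by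
  have hli : LinearIndependent ℝ (stabilityMatrix v ξ).row := by
    have hrow : (stabilityMatrix v ξ).row = ![fun j => pderiv j (pderiv 0 v) ξ,
      fun j => pderiv j (pderiv 1 v) ξ] := rfl
    rw [hrow, LinearIndependent.pair_iff]
    intro a b hab
    have k : ∀ j, a * pderiv j (pderiv 0 v) ξ + b * pderiv j (pderiv 1 v) ξ = 0 := fun j => by
      simpa using congrFun hab j
    have k0 := k 0
    have k1 := k 1
    have k2 := k 2
    rw [jetDet, spatialHessianDet] at hp
    constructor
    · refine (mul_eq_zero.1 (?_ : a * _ = 0)).resolve_right hp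
      linear_combination (p 2 * pderiv 1 (pderiv 1 v) ξ - p 1 * pderiv 2 (pderiv 1 v) ξ) * k0 +
        (p 0 * pderiv 2 (pderiv 1 v) ξ - p 2 * pderiv 0 (pderiv 1 v) ξ) * k1 +
        (p 1 * pderiv 0 (pderiv 1 v) ξ - p 0 * pderiv 1 (pderiv 1 v) ξ) * k2
    · refine (mul_eq_zero.1 (?_ : b * _ = 0)).resolve_right hp
      linear_combination (p 1 * pderiv 2 (pderiv 0 v) ξ - p 2 * pderiv 1 (pderiv 0 v) ξ) * k0 +
        (p 2 * pderiv 0 (pderiv 0 v) ξ - p 0 * pderiv 2 (pderiv 0 v) ξ) * k1 +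
        (p 0 * pderiv 1 (pderiv 0 v) ξ - p 1 * pderiv 0 (pderiv 0 v) ξ) * k2
  simpa using hli.rank_matrix

end Types

/-! ### Persistence under small changes of the parameters -/

section Persistence

variable {E : Type*} [NormedAddCommGroup E]

/-- Used with T the time derivative of the solution along the curve and g the height speed. Where g
is negative at parameter 0 both conclusions are vacuous nearby; elsewhere T is nonzero at parameter
0 and keeps its sign. -/
theorem eventually_sign_persists {T g : E → ℝ → ℝ}
    (hT : ∀ s, ContinuousAt (fun q : E × ℝ => T q.1 q.2) (0, s))
    (hg : ∀ s, ContinuousAt (fun q : E × ℝ => g q.1 q.2) (0, s))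
    (hTper : ∀ θ, Function.Periodic (T θ) (2 * Real.pi))
    (hgper : ∀ θ, Function.Periodic (g θ) (2 * Real.pi)) (h : ∀ s, 0 ≤ g 0 s → T 0 s ≠ 0) :
    ∀ᶠ θ in 𝓝 (0 : E), ∀ s, (0 ≤ g θ s → T θ s ≠ 0) ∧ (0 ≤ g 0 s → 0 < T 0 s * T θ s) := by
  refine eventually_forall_periodic (fun θ s n hs => ?_) fun s => ?_
  · rwa [(hTper _).int_mul n s, (hTper _).int_mul n s, (hgper _).int_mul n s,
      (hgper _).int_mul n s] at hs
  · have c0 : ContinuousAt (fun q : E × ℝ => ((0 : E), q.2)) (0, s) := by fun_prop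
    have hT0 := ContinuousAt.comp (g := fun q : E × ℝ => T q.1 q.2) (f := fun q : E × ℝ => ((0 : E), q.2))
        (x := (0, s)) (hT s) c0
    have hg0 := ContinuousAt.comp (g := fun q : E × ℝ => g q.1 q.2) (f := fun q : E × ℝ => ((0 : E), q.2))
        (x := (0, s)) (hg s) c0
    rcases lt_or_ge (g 0 s) 0 with hs | hs
    · filter_upwards [(hg s).eventually (gt_mem_nhds hs), hg0.eventually (gt_mem_nhds hs)]
        with q h1 h2
      exact ⟨fun h => absurd h1 (not_lt.2 h), fun h => absurd h2 (not_lt.2 h)⟩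
    · filter_upwards [(hT s).eventually_ne (h s hs), (hT0.mul (hT s)).eventually
        (lt_mem_nhds (mul_self_pos.2 (h s hs)))] with q h1 h2
      exact ⟨fun _ => h1, fun _ => h2⟩

theorem neg_of_ne_zero_of_mem_Ioo {T : ℝ → ℝ} {a b s t : ℝ} (hT : Continuous T)
    (h : ∀ x ∈ Ioo a b, T x ≠ 0) (hs : s ∈ Ioo a b) (ht : t ∈ Ioo a b) (hneg : T s < 0) :
    T t < 0 := by
  by_contra hc
  obtain ⟨x, hx, hx0⟩ := (isPreconnected_Ioo (a := a) (b := b)).intermediate_value hs ht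
    hT.continuousOn ⟨hneg.le, not_lt.1 hc⟩
  exact h x hx hx0

variable [NormedSpace ℝ E]

theorem ContDiffAt.deriv_param {F : Type*} [NormedAddCommGroup F] [NormedSpace ℝ F]
    {G : E → ℝ → F} {θ : E} {s : ℝ} {n m : ℕ∞ω}
    (hG : ContDiffAt ℝ n (fun q : E × ℝ => G q.1 q.2) (θ, s)) (h : m + 1 ≤ n) :
    ContDiffAt ℝ m (fun q : E × ℝ => deriv (G q.1) q.2) (θ, s) := by
  have h1 : ContDiffAt ℝ n (Function.uncurry fun (q : E × ℝ) t => G q.1 t) ((θ, s), s) :=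
    ContDiffAt.comp (g := fun q : E × ℝ => G q.1 q.2)
      (f := fun q : (E × ℝ) × ℝ => (q.1.1, q.2)) ((θ, s), s) hG (by fun_prop)
  exact (h1.fderiv (g := fun q : E × ℝ => q.2) contDiffAt_snd h).clm_apply contDiffAt_const

theorem eventually_jetDet_pos {V : E → Spacetime → ℝ}
    (hV : ContDiff ℝ 2 fun q : E × Spacetime => V q.1 q.2) {G : E → ℝ → Spacetime}
    (hG : ∀ s, ContDiffAt ℝ 1 (fun q : E × ℝ => G q.1 q.2) (0, s))
    (hper : ∀ θ, Function.Periodic (G θ) (2 * Real.pi))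
    (h : ∀ s, 0 < jetDet (V 0) (G 0 s) (deriv (G 0) s)) :
    ∀ᶠ θ in 𝓝 (0 : E), ∀ s, 0 < jetDet (V θ) (G θ s) (deriv (G θ) s) := by
  refine eventually_forall_periodic (fun θ s n hs => ?_) fun s => ?_
  · rwa [(hper θ).int_mul n s, (hper θ).deriv_periodic.int_mul n s] at hs
  · have c1 : ContinuousAt (fun q : E × ℝ => (q.1, G q.1 q.2)) (0, s) :=
      continuousAt_fst.prodMk (hG s).continuousAt
    have c2 : ContinuousAt (fun q : E × ℝ => deriv (G q.1) q.2) (0, s) :=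
      ((hG s).deriv_param (m := 0) (by norm_num)).continuousAt
    have c3 : ∀ j, ContinuousAt (fun q : E × ℝ => deriv (G q.1) q.2 j) (0, s) := fun j =>
      (EuclideanSpace.proj (𝕜 := ℝ) j).continuous.continuousAt.comp c2
    have c4 : ∀ i j, ContinuousAt (fun q : E × ℝ => pderiv j (pderiv i (V q.1)) (G q.1 q.2))
        (0, s) := fun i j => by
      have h1 : ContDiffAt ℝ 1 (fun q : E × Spacetime => pderiv i (V q.1) q.2) (0, G 0 s) :=
        hV.contDiffAt.pderiv_param (by norm_num) i
      have h2 : ContDiffAt ℝ 0 (fun q : E × Spacetime => pderiv j (pderiv i (V q.1)) q.2)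
        (0, G 0 s) := ContDiffAt.pderiv_param (V := fun θ => pderiv i (V θ)) h1 (by norm_num) j
      exact ContinuousAt.comp (f := fun q : E × ℝ => (q.1, G q.1 q.2)) (x := ((0, s) : E × ℝ))
        h2.continuousAt c1
    have c5 : ContinuousAt (fun q : E × ℝ => jetDet (V q.1) (G q.1 q.2) (deriv (G q.1) q.2))
        (0, s) :=
      (((c3 0).mul (((c4 0 1).mul (c4 1 2)).sub ((c4 0 2).mul (c4 1 1)))).add
        ((c3 1).mul (((c4 0 2).mul (c4 1 0)).sub ((c4 0 0).mul (c4 1 2))))).add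
        ((c3 2).mul (((c4 0 0).mul (c4 1 1)).sub ((c4 0 1).mul (c4 1 0))))
    exact c5.eventually (lt_mem_nhds (h s))

/-- One constant c serves both as the width of the band of small slopes without critical points of
the derivative and as the bound on its change; `partition_descends` needs them equal. It is found by
treating the width as an additional small parameter. -/
theorem exists_nondegenerate_height {G : E → ℝ → ℝ}
    (hG : ∀ s, ContDiffAt ℝ 2 (fun q : E × ℝ => G q.1 q.2) (0, s))
    (hper : ∀ θ, Function.Periodic (G θ) (2 * Real.pi))
    (h : ∀ s, deriv (G 0) s = 0 → deriv (deriv (G 0)) s ≠ 0) :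
    ∃ c, 0 < c ∧ ∀ᶠ θ in 𝓝 (0 : E), ∀ s, (|deriv (G θ) s| ≤ c → deriv (deriv (G θ)) s ≠ 0) ∧
      |deriv (G 0) s - deriv (G θ) s| < c := by
  have hd : ∀ s, ContDiffAt ℝ 1 (fun q : E × ℝ => deriv (G q.1) q.2) (0, s) := fun s =>
    (hG s).deriv_param (by norm_num)
  have c1 := fun s => (hd s).continuousAt
  have c2 : ∀ s, ContinuousAt (fun q : E × ℝ => deriv (deriv (G q.1)) q.2) (0, s) := fun s =>
    (ContDiffAt.deriv_param (G := fun θ => deriv (G θ)) (hd s) (m := 0)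
      (by norm_num)).continuousAt
  have e1 : ∀ᶠ x : E × ℝ in 𝓝 0, ∀ s, |deriv (G x.1) s| ≤ x.2 → deriv (deriv (G x.1)) s ≠ 0 := by
    refine eventually_forall_periodic (fun x s n hs => ?_) fun s => ?_
    · rwa [(hper x.1).deriv_periodic.int_mul n s,
        (hper x.1).deriv_periodic.deriv_periodic.int_mul n s] at hs
    · have c0 : ContinuousAt (fun q : (E × ℝ) × ℝ => (q.1.1, q.2)) (0, s) := by fun_prop
      by_cases hs : deriv (G 0) s = 0
      · have := ContinuousAt.comp (g := fun q : E × ℝ => deriv (deriv (G q.1)) q.2) (f := fun q : (E × ℝ) × ℝ => (q.1.1, q.2))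
          (x := (0, s)) (c2 s) c0
        filter_upwards [this.eventually_ne (h s hs)] with q hq _ using hq
      · have h1 := (ContinuousAt.comp (g := fun q : E × ℝ => deriv (G q.1) q.2) (f := fun q : (E × ℝ) × ℝ => (q.1.1, q.2))
          (x := (0, s)) (c1 s) c0).abs
        have h2 : ContinuousAt (fun q : (E × ℝ) × ℝ => q.1.2) (0, s) := by fun_prop
        filter_upwards [h2.eventually_lt h1 (by simpa using hs)] with q hq hle
        exact absurd hq (not_lt.2 hle)
  obtain ⟨δ, hδ, H⟩ := Metric.eventually_nhds_iff.1 e1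
  refine ⟨δ / 2, by positivity, ?_⟩
  have e2 : ∀ᶠ θ in 𝓝 (0 : E), ∀ s, |deriv (G 0) s - deriv (G θ) s| < δ / 2 := by
    refine eventually_forall_periodic (fun θ s n hs => ?_) fun s => ?_
    · rwa [(hper _).deriv_periodic.int_mul n s, (hper _).deriv_periodic.int_mul n s] at hs
    · have c0 : ContinuousAt (fun q : E × ℝ => ((0 : E), q.2)) (0, s) := by fun_prop
      have := ((ContinuousAt.comp (g := fun q : E × ℝ => deriv (G q.1) q.2) (f := fun q : E × ℝ => ((0 : E), q.2))
        (x := (0, s)) (c1 s) c0).sub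
        (c1 s)).abs
      exact this.eventually (gt_mem_nhds (by simpa using hδ))
  filter_upwards [e2, Metric.ball_mem_nhds 0 hδ] with θ h2 h3 s
  refine ⟨H (y := (θ, δ / 2)) ?_ s, h2 s⟩
  rw [mem_ball_zero_iff] at h3
  rw [dist_zero_right]
  exact max_lt h3 (by rw [Real.norm_eq_abs, abs_of_pos (by positivity)]; linarith)

end Persistence

/-! ### Choice of parameters and assembly of the theorem -/

section Assembly

variable {m : ℕ} {γ : Fin m → ℝ → Spacetime} {Lmax : Set (Set Spacetime)} {k : ℕ}
  {Y : Fin m → ℝ × ℂ → Spacetime} {ρ₀ : ℝ} {w z R : Spacetime → ℝ}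

/-- With κ = |1 - η| for an already fixed rotation, the quadratic bound C ρ² on the displacement
beats κ ρ / 2, so the centre of the rotation lies within ρ / 2 of the core. -/
theorem exists_parameters {C r δ κ : ℝ} (hr : 0 < r) (hδ : 0 < δ) (hκ : 0 < κ)
    {P : ℝ × ℝ → Prop} (hP : ∀ᶠ θ in 𝓝 (0 : ℝ × ℝ), P θ) :
    ∃ ρ, 0 < ρ ∧ ρ < r ∧ ρ < δ ∧ C * ρ ^ 2 < κ * (ρ / 2) ∧ P (ρ ^ 2, ρ) := by
  have c1 : Tendsto (fun ρ : ℝ => (ρ ^ 2, ρ)) (𝓝 0) (𝓝 0) := by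
    have : ContinuousAt (fun ρ : ℝ => (ρ ^ 2, ρ)) 0 := by fun_prop
    have e : ((0 : ℝ) ^ 2, (0 : ℝ)) = 0 := by simp
    rwa [ContinuousAt, e] at this
  have c2 : ContinuousAt (fun ρ : ℝ => C * ρ) 0 := by fun_prop
  have h1 : ∀ᶠ ρ in 𝓝[>] (0 : ℝ), P (ρ ^ 2, ρ) :=
    (c1.eventually hP).filter_mono nhdsWithin_le_nhds
  have h2 : ∀ᶠ ρ in 𝓝[>] (0 : ℝ), C * ρ < κ / 2 :=
    (c2.eventually (gt_mem_nhds (by simpa using hκ))).filter_mono nhdsWithin_le_nhds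
  have h3 : ∀ᶠ ρ in 𝓝[>] (0 : ℝ), ρ ∈ Ioo 0 (min r δ) := Ioo_mem_nhdsGT (lt_min hr hδ)
  obtain ⟨ρ, h1, h2, h3⟩ := (h1.and (h2.and h3)).exists
  refine ⟨ρ, h3.1, h3.2.trans_le (min_le_left _ _), h3.2.trans_le (min_le_right _ _), ?_, h1⟩
  have := mul_lt_mul_of_pos_right h2 h3.1
  linarith

theorem exists_rotation {δ : ℝ} (hδ : 0 < δ) : ∃ ε : ℝ, |ε| < δ ∧
    ‖Complex.exp (ε * Complex.I)‖ = 1 ∧ Complex.exp (ε * Complex.I) ≠ 1 := by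
  have h0 : 0 < min (δ / 2) 1 := lt_min (by positivity) one_pos
  refine ⟨min (δ / 2) 1, ?_, Complex.norm_exp_ofReal_mul_I _, fun h => ?_⟩
  · rw [abs_of_pos h0]
    exact (min_le_left _ _).trans_lt (by linarith)
  · have h1 := congrArg Complex.im h
    rw [Complex.exp_ofReal_mul_I_im, Complex.one_im] at h1
    exact (Real.sin_pos_of_pos_of_lt_pi h0
      ((min_le_right _ _).trans_lt (by linarith [Real.pi_gt_three]))).ne' h1

/-- The properties of the perturbed link `G` and of the heat solution `v` which determine the types
of the critical points. -/
theorem types_of_critical_points {Φ : Spacetime → Spacetime} {v : Spacetime → ℝ}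
    (hv : ContDiff ℝ 2 v)
    (hγ₁ : ∀ i, ContDiff ℝ ∞ (imageLink Φ γ i)) (hper : ∀ i, Function.Periodic (γ i) (2 * Real.pi))
    (hinj : ∀ i j s s', imageLink Φ γ i s = imageLink Φ γ j s' →
      i = j ∧ ∃ n : ℤ, s' = s + n * (2 * Real.pi))
    (hcrit : ∀ i s, IsSpatialCritical v (imageLink Φ γ i s))
    (hjet : ∀ i s, 0 < jetDet v (imageLink Φ γ i s) (deriv (imageLink Φ γ i) s))
    (hheat : ∀ i s, heatOp v (imageLink Φ γ i s) = 0)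
    (hne : ∀ i s, 0 ≤ deriv (heightAlong (imageLink Φ γ i)) s →
      pderiv 2 v (imageLink Φ γ i s) ≠ 0)
    (hmax : ∀ i a b, IsPosInterval (deriv (heightAlong (γ i))) a b → ∀ s ∈ Ioo a b,
      (γ i '' Ioo a b ∈ Lmax → pderiv 2 v (imageLink Φ γ i s) < 0) ∧
        (γ i '' Ioo a b ∉ Lmax → 0 < pderiv 2 v (imageLink Φ γ i s)))
    (hLmax : Lmax ⊆ positiveIntervals γ) :
    (∀ ξ ∈ overlapUnion Φ Lmax (positiveIntervals (imageLink Φ γ)), IsSpatialMax v ξ) ∧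
      (∀ ξ ∈ overlapUnion Φ (positiveIntervals γ \ Lmax) (positiveIntervals (imageLink Φ γ)),
        IsSpatialMin v ξ) ∧
      (∀ ξ ∈ ⋃₀ negativeIntervals (imageLink Φ γ), IsSpatialSaddle v ξ) := by
  have hper₁ : ∀ i, Function.Periodic (imageLink Φ γ i) (2 * Real.pi) := fun i s => by
    simp only [imageLink, hper i s]
  have hdiff := fun i => (hγ₁ i).differentiable_infty
  have hd1 : ∀ j, Differentiable ℝ (pderiv j v) := fun j =>
    (hv.pderiv' (m := 1) (by norm_num) j).differentiable one_ne_zero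
  have hdet : ∀ i s, (deriv (imageLink Φ γ i) s 0 ^ 2 + deriv (imageLink Φ γ i) s 1 ^ 2 +
      deriv (imageLink Φ γ i) s 2 ^ 2) * spatialHessianDet v (imageLink Φ γ i s) =
      jetDet v (imageLink Φ γ i s) (deriv (imageLink Φ γ i) s) *
        deriv (heightAlong (imageLink Φ γ i)) s := by
    intro i s
    rw [deriv_heightAlong (hdiff i s)]
    exact jetDet_mul
      (fderiv_apply_of_eventuallyEq (hd1 0) (hdiff i s).hasDerivAt (hasDerivAt_const s 0)
        (.of_forall fun t => (hcrit i t).1))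
      (fderiv_apply_of_eventuallyEq (hd1 1) (hdiff i s).hasDerivAt (hasDerivAt_const s 0)
        (.of_forall fun t => (hcrit i t).2))
  have hdetpos : ∀ i s, 0 < deriv (heightAlong (imageLink Φ γ i)) s →
      0 < spatialHessianDet v (imageLink Φ γ i s) := fun i s hs =>
    pos_of_mul_pos_right ((hdet i s).symm ▸ mul_pos (hjet i s) hs) (by positivity)
  have htr : ∀ i s, pderiv 0 (pderiv 0 v) (imageLink Φ γ i s) +
      pderiv 1 (pderiv 1 v) (imageLink Φ γ i s) = pderiv 2 v (imageLink Φ γ i s) := fun i s => by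
    have := hheat i s
    rw [heatOp] at this
    linarith
  have hTc : ∀ i, Continuous fun s => pderiv 2 v (imageLink Φ γ i s) := fun i =>
    (hd1 2).continuous.comp (hγ₁ i).continuous
  -- a point of an overlapping interval
  have hover : ∀ K : Set (Set Spacetime), K ⊆ positiveIntervals γ →
      ∀ ξ ∈ overlapUnion Φ K (positiveIntervals (imageLink Φ γ)), ∃ i a' b' a b s t,
        IsPosInterval (deriv (heightAlong (imageLink Φ γ i))) a' b' ∧
        IsPosInterval (deriv (heightAlong (γ i))) a b ∧ γ i '' Ioo a b ∈ K ∧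
        s ∈ Ioo a b ∧ s ∈ Ioo a' b' ∧ t ∈ Ioo a' b' ∧ imageLink Φ γ i t = ξ := by
    rintro K hK ξ ⟨I', ⟨hI', I, hI, hmeet⟩, hξ⟩
    obtain ⟨j, a', b', h', rfl⟩ := mem_positiveIntervals.1 hI'
    obtain ⟨i, a, b, h, rfl⟩ := mem_positiveIntervals.1 (hK hI)
    obtain ⟨t, ht, rfl⟩ := hξ
    obtain ⟨_, ⟨_, ⟨s, hs, rfl⟩, rfl⟩, s', hs', he⟩ := hmeet
    obtain ⟨rfl, n, hn⟩ := hinj i j s s' he.symm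
    refine ⟨i, a', b', _, _, s', t, h', h.add_int (hper i).deriv_heightAlong n, ?_,
      ⟨by linarith [hs.1], by linarith [hs.2]⟩, hs', ht, rfl⟩
    rwa [image_Ioo_add_int (hper i)]
  refine ⟨fun ξ hξ => ?_, fun ξ hξ => ?_, ?_⟩
  · obtain ⟨i, a', b', a, b, s, t, h', h, hI, hs, hs', ht, rfl⟩ := hover _ hLmax ξ hξ
    refine isSpatialMax_of_spatialHessian hv (hcrit i t) (hdetpos i t (h'.2.2.2 t ht)) ?_
    rw [htr]
    exact neg_of_ne_zero_of_mem_Ioo (hTc i) (fun x hx => hne i x (h'.2.2.2 x hx).le) hs' ht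
      ((hmax i a b h s hs).1 hI)
  · obtain ⟨i, a', b', a, b, s, t, h', h, hI, hs, hs', ht, rfl⟩ := hover _ sdiff_subset ξ hξ
    refine isSpatialMin_of_spatialHessian hv (hcrit i t) (hdetpos i t (h'.2.2.2 t ht)) ?_
    rw [htr]
    exact neg_neg_iff_pos.1 (neg_of_ne_zero_of_mem_Ioo (T := fun x => -pderiv 2 v _) (hTc i).neg
      (fun x hx => neg_ne_zero.2 (hne i x (h'.2.2.2 x hx).le)) hs' ht
      (neg_neg_iff_pos.2 ((hmax i a b h s hs).2 hI.2)))
  · rintro ξ ⟨_, ⟨i, a, b, -, -, -, hneg, rfl⟩, s, hs, rfl⟩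
    refine ⟨hcrit i s, ?_⟩
    have h1 := mul_neg_of_pos_of_neg (hjet i s) (hneg s hs)
    rw [← hdet i s] at h1
    exact neg_of_mul_neg_right h1 (by positivity)

end Assembly

theorem mainTheorem5 {m : ℕ} (γ : Fin m → ℝ → Spacetime)
    (hγ : IsOrientedLink γ) (hgen : InGeneralPosition γ)
    (Lmax : Set (Set Spacetime)) (hmax : Lmax ⊆ positiveIntervals γ)
    (r : ℕ) (hr : 1 ≤ r) (ε₁ : ℝ) (hε₁ : 0 < ε₁) :
    ∃ (Ω : Set Spacetime) (Φ₁ : Spacetime → Spacetime) (v : Spacetime → ℝ),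
      -- the neighbourhood, the diffeomorphism and the local heat solution
      IsTubularNeighborhood γ Ω ∧ Ω ⊆ positiveTimes ∧
      IsDiffeoOn Φ₁ Ω ∧
      crNorm r Ω (fun ξ => Φ₁ ξ - ξ) < ENNReal.ofReal ε₁ ∧
      IsHeatSolutionOn v Ω ∧
      -- (A) the spatial critical points of `v` in `Ω` are exactly the points of `Φ₁(L)`
      {ξ ∈ Ω | IsSpatialCritical v ξ} = Φ₁ '' linkSet γ ∧
      -- the partition of `L` descends to `L₁ = Φ₁(L)`
      InGeneralPosition (imageLink Φ₁ γ) ∧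
      (∀ I' ∈ positiveIntervals (imageLink Φ₁ γ),
        ∃! I, I ∈ positiveIntervals γ ∧ (Φ₁ '' I ∩ I').Nonempty) ∧
      (∀ I ∈ positiveIntervals γ,
        ∃! I', I' ∈ positiveIntervals (imageLink Φ₁ γ) ∧ (Φ₁ '' I ∩ I').Nonempty) ∧
      -- (B) the types of the critical points
      (∀ ξ ∈ overlapUnion Φ₁ Lmax (positiveIntervals (imageLink Φ₁ γ)), IsSpatialMax v ξ) ∧
      (∀ ξ ∈ overlapUnion Φ₁ (positiveIntervals γ \ Lmax) (positiveIntervals (imageLink Φ₁ γ)),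
        IsSpatialMin v ξ) ∧
      (∀ ξ ∈ ⋃₀ negativeIntervals (imageLink Φ₁ γ), IsSpatialSaddle v ξ) ∧
      -- (C) structural stability
      (∀ ξ ∈ Φ₁ '' linkSet γ, (stabilityMatrix v ξ).rank = 2) := by
  -- The profile of exponent r + 4 yields a family of class C^(r + 3), and the critical section
  -- loses one derivative. The resulting class C^(r + 2) covers both the C^r estimate and the two
  -- derivatives needed for the heights.
  obtain ⟨Y, ρ₀, w, z, R, h⟩ := exists_isApproxSolution hγ hgen Lmax (k := r + 4 + 2) (by lia)
  obtain ⟨V, hV, hV0, hVs, hVheat⟩ := h.exists_family (n := r + 2 + 1) (by lia) (by lia)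
  obtain ⟨r₀, hr₀, hrρ, d, hd0, hdper, C, -, hcrit⟩ :=
    h.exists_critical_section (n := r + 2) (by lia) hV hV0 hVs
  have hV2 : ContDiff ℝ 2 fun q : (ℝ × ℝ) × Spacetime => V q.1 q.2 :=
    hV.of_le (by exact_mod_cast (by lia : 2 ≤ r + 2 + 1))
  -- the perturbed link
  set G : Fin m → ℝ × ℝ → ℝ → Spacetime := fun i θ s => Y i (s, d i (θ, s)) with hG
  have hG0 : ∀ i, G i 0 = γ i := fun i => funext fun s => by simp only [hG, hd0, h.core]
  have hGper : ∀ i θ, Function.Periodic (G i θ) (2 * Real.pi) := by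
    intro i θ s
    have h1 := hdper i θ s 1
    have h2 := h.tube.periodic i s (d i (θ, s)) 1
    simp only [Int.cast_one, one_mul] at h1 h2
    simp only [hG, h1, h2]
  have hGc : ∀ i θ s (n : ℕ∞ω), n ≤ (∞ : ℕ∞ω) → ContDiffAt ℝ n (d i) (θ, s) →
      ContDiffAt ℝ n (fun q : (ℝ × ℝ) × ℝ => G i q.1 q.2) (θ, s) := fun i θ s n hn hd =>
    ((h.tube.smooth i).of_le hn).contDiffAt.comp (θ, s) (contDiffAt_snd.prodMk hd)
  have hdn : ∀ i s, ContDiffAt ℝ (r + 2 : ℕ) (d i) (0, s) := fun i s =>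
    (hcrit.self_of_nhds i s).2.1
  have hG2 : ∀ i s, ContDiffAt ℝ 2 (fun q : (ℝ × ℝ) × ℝ => G i q.1 q.2) (0, s) := fun i s =>
    (hGc i 0 s _ ENat.LEInfty.out (hdn i s)).of_le (by exact_mod_cast (by lia : 2 ≤ r + 2))
  have hH2 : ∀ i s, ContDiffAt ℝ 2 (fun q : (ℝ × ℝ) × ℝ => heightAlong (G i q.1) q.2) (0, s) :=
    fun i s => (EuclideanSpace.proj (𝕜 := ℝ) (2 : Fin 3)).contDiff.contDiffAt.comp (0, s) (hG2 i s)
  have hHper : ∀ i θ, Function.Periodic (heightAlong (G i θ)) (2 * Real.pi) := fun i θ s => by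
    simp only [heightAlong, hGper i θ s]
  -- properties which persist for small parameters
  have e1 : ∀ᶠ θ in 𝓝 (0 : ℝ × ℝ), ∀ i s, 0 < jetDet (V θ) (G i θ s) (deriv (G i θ) s) :=
    eventually_all.2 fun i => eventually_jetDet_pos hV2
      (fun s => (hG2 i s).of_le (by norm_num)) (hGper i) fun s => by
        rw [hG0, show (0 : ℝ × ℝ) = (0, 0) from rfl, hV0]; exact h.jet i s
  choose c₀ hc₀ e2 using fun i => exists_nondegenerate_height (G := fun θ => heightAlong (G i θ))
    (hH2 i) (hHper i) (fun s hs => by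
      rw [hG0] at hs ⊢
      exact hgen i s hs)
  have hf₀ : ∀ i s, |deriv (heightAlong (γ i)) s| ≤ c₀ i →
      deriv (deriv (heightAlong (γ i))) s ≠ 0 := fun i s hs => by
    have := ((e2 i).self_of_nhds s).1
    rw [hG0] at this
    exact this hs
  set T : Fin m → ℝ × ℝ → ℝ → ℝ := fun i θ s => pderiv 2 (V θ) (G i θ s) with hT
  have e3 : ∀ i, ∀ᶠ θ in 𝓝 (0 : ℝ × ℝ), ∀ s,
      (0 ≤ deriv (heightAlong (G i θ)) s → T i θ s ≠ 0) ∧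
        (0 ≤ deriv (heightAlong (G i 0)) s → 0 < T i 0 s * T i θ s) := fun i => by
    refine eventually_sign_persists (T := T i) (g := fun θ => deriv (heightAlong (G i θ)))
      (fun s => ?_) (fun s => (ContDiffAt.deriv_param (G := fun θ => heightAlong (G i θ)) (hH2 i s)
        (m := 1) (by norm_num)).continuousAt)
      (fun θ s => by simp only [hT, hGper i θ s]) (fun θ => (hGper i θ).deriv_heightAlong)
      fun s hs => ?_
    · exact ContinuousAt.comp (g := fun q : (ℝ × ℝ) × Spacetime => pderiv 2 (V q.1) q.2)
        (f := fun q : (ℝ × ℝ) × ℝ => (q.1, G i q.1 q.2)) (x := (0, s))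
        (hV2.contDiffAt.pderiv_param (m := 1) (by norm_num) 2 :
          ContDiffAt ℝ 1 (fun q : (ℝ × ℝ) × Spacetime => pderiv 2 (V q.1) q.2)
            (0, G i 0 s)).continuousAt
        (continuousAt_fst.prodMk (hG2 i s).continuousAt)
    · rw [hG0] at hs
      obtain ⟨a, b, hab, hsab⟩ := exists_isPosInterval_of_nonneg
        (contDiff_euclidean.1 (hγ.smooth i) 2).deriv_infty.continuous
        (hγ.periodic i).deriv_heightAlong
        (exists_deriv_heightAlong_neg (hγ.smooth i) (hγ.periodic i) (hgen i)) (hgen i) hs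
      simp only [hT, hG0]
      rw [show (0 : ℝ × ℝ) = (0, 0) from rfl, hV0]
      by_cases hL : γ i '' Ioo a b ∈ Lmax
      · exact ((h.sign i a b hab s hsab).1 hL).ne
      · exact ((h.sign i a b hab s hsab).2 hL).ne'
  -- choice of the parameters
  obtain ⟨δ, hδ, hsmall⟩ := Metric.eventually_nhds_iff.1
    (eventually_iteratedFDeriv_tubeDesc_lt h.tube (r := r)
      (fun i s => (hdn i s).of_le (by exact_mod_cast (by lia : r ≤ r + 2))) hd0 hdper
      (ε := ε₁ / (r + 2)) (by positivity))
  -- The angle is fixed before ρ, so 1 - η is a nonzero constant while the displacement is O(ρ²).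
  obtain ⟨ε, hε, hη, hη1⟩ := exists_rotation hδ
  set η := Complex.exp (ε * Complex.I) with hηdef
  have hη1' : 1 - η ≠ 0 := sub_ne_zero.2 (Ne.symm hη1)
  obtain ⟨ρ, hρ, hρr, hρδ, hρC, ⟨hcrit, e1, e2, e3, hθδ⟩⟩ := exists_parameters (C := C) hr₀ hδ
    (norm_pos_iff.2 hη1') (hcrit.and (e1.and ((eventually_all.2 e2).and ((eventually_all.2 e3).and
      (Metric.ball_mem_nhds 0 hδ)))))
  set θ : ℝ × ℝ := (ρ ^ 2, ρ) with hθ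
  rw [dist_zero_right] at hθδ
  have hθ2 : 0 < θ.2 := hρ
  have hρρ : ρ < ρ₀ := hρr.trans_le hrρ
  -- The fixed point of ζ ↦ η ζ + d, that is, the centre of the rotation which takes 0 to d.
  set c : Fin m → ℝ → ℂ := fun i s => d i (θ, s) / (1 - η) with hc
  have hcd : ∀ i s, (1 - η) * c i s = d i (θ, s) := fun i s => mul_div_cancel₀ _ hη1'
  have hcR : ∀ i s, ‖c i s‖ < ρ / 2 := by
    intro i s
    rw [hc, norm_div, div_lt_iff₀ (norm_pos_iff.2 hη1'), mul_comm]
    refine ((hcrit i s).1.trans_eq ?_).trans_lt hρC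
    rw [hθ, abs_of_nonneg (sq_nonneg ρ)]
  have hdθ : ∀ i, ContDiff ℝ ∞ fun s => d i (θ, s) := fun i => contDiff_iff_contDiffAt.2 fun s =>
    ((hcrit i s).2.2.1 hθ2).comp s (contDiff_prodMk_right θ).contDiffAt
  have hcs : ∀ i, ContDiff ℝ ∞ (c i) := fun i => by
    simp only [hc, div_eq_mul_inv]; exact (hdθ i).mul contDiff_const
  have hcper : ∀ i, Function.Periodic (c i) (2 * Real.pi) := fun i s => by
    have := hdper i θ s 1
    rw [Int.cast_one, one_mul] at this
    simp only [hc, this]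
  have hdisc : ∀ i (p : ℝ × ℂ), ‖p.2 - c i p.1‖ < ρ / 2 → ‖p.2‖ < ρ := fun i p hp =>
    norm_lt_of_mem_disc hcR (by linarith) hp
  have h2 : 2 * (ρ / 2) ≤ ρ₀ := by linarith
  -- The point d is the rotated image of 0, so it has the same distance from the centre: d - c = -η
  -- c.
  have hmem0 : ∀ i s, ‖d i (θ, s) - c i s‖ < ρ / 2 := by
    intro i s
    rw [← hcd i s, sub_mul, one_mul, sub_sub_cancel_left, norm_neg, norm_mul, hη, one_mul]
    exact hcR i s
  have hdρ : ∀ i s, ‖d i (θ, s)‖ < ρ := fun i s => hdisc i (s, d i (θ, s)) (hmem0 i s)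
  -- the diffeomorphism
  set Φ : Spacetime → Spacetime :=
    tubeDesc Y ρ₀ (fun i p => Y i (p.1, c i p.1 + η * (p.2 - c i p.1))) with hΦ
  -- In this form the small divisor 1 - η disappears, and the map is visibly C^r-close to the
  -- identity.
  have hform : (fun i (p : ℝ × ℂ) => Y i (p.1, c i p.1 + η * (p.2 - c i p.1))) =
      fun i p => Y i (p.1, η * p.2 + d i (θ, p.1)) := by
    ext1 i; ext1 p
    rw [← hcd]
    congr 2
    ring
  have hΦY : ∀ i p, ‖p.2‖ < ρ₀ → Φ (Y i p) = Y i (p.1, η * p.2 + d i (θ, p.1)) := by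
    intro i p hp
    rw [hΦ, hform]
    exact h.tube.tubeDesc_apply (fun i s ζ n => by simp only [hdper, h.tube.periodic]) i hp
  have himg : ∀ i, imageLink Φ γ i = G i θ := by
    intro i
    ext1 s
    have := hΦY i (s, 0) (by simpa using h.tube.pos)
    rw [h.core] at this
    simpa [imageLink] using this
  have hsmooth₁ : ∀ i, ContDiff ℝ ∞ (imageLink Φ γ i) := fun i => by
    rw [himg]
    exact (h.tube.smooth i).comp (contDiff_id.prodMk (hdθ i))
  have hinj₁ : ∀ i j s s', imageLink Φ γ i s = imageLink Φ γ j s' →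
      i = j ∧ ∃ n : ℤ, s' = s + n * (2 * Real.pi) := by
    intro i j s s' he
    rw [himg, himg] at he
    obtain ⟨e1, -, e3⟩ := h.tube.inj i j _ _ ((hdρ i s).trans hρρ) ((hdρ j s').trans hρρ) he
    exact ⟨e1, e3⟩
  have hVθ : ContDiff ℝ ∞ (V θ) := contDiff_iff_contDiffAt.2 fun ξ =>
    (hVs θ ξ hθ2).comp ξ (contDiff_prodMk_right θ).contDiffAt
  have hheat : ∀ i p, ‖p.2‖ < ρ → heatOp (V θ) (Y i p) = 0 := fun i p hp =>
    hVheat ρ hρ i p (hp.trans hρρ) ((Complex.abs_im_le_norm _).trans hp.le)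
  have hcritG : ∀ i s, IsSpatialCritical (V θ) (imageLink Φ γ i s) := fun i s => by
    rw [himg]
    exact ((hcrit i s).2.2.2 _ ((hdρ i s).trans hρr)).2 rfl
  have hjet : ∀ i s, 0 < jetDet (V θ) (imageLink Φ γ i s) (deriv (imageLink Φ γ i) s) :=
    fun i s => by rw [himg]; exact e1 i s
  have htub := isTubularNeighborhood_discTube h.tube hcs hcper hcR h2
  have htypes := types_of_critical_points (Φ := Φ) (v := V θ) (hVθ.of_le ENat.LEInfty.out)
    hsmooth₁ hγ.periodic hinj₁ hcritG hjet
    (fun i s => by rw [himg]; exact hheat i _ (hdρ i s))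
    (fun i s hs => by rw [himg] at hs ⊢; exact (e3 i s).1 hs)
    (fun i a b hab s hs => by
      -- The time derivatives before and after the perturbation, at the same parameter, have
      -- positive product, so the prescribed sign carries over from w.
      have h1 := (e3 i s).2 (by rw [hG0]; exact (hab.2.2.2 s hs).le)
      have h2 := h.sign i a b hab s (Ioo_subset_Icc_self hs)
      simp only [hT, hG0] at h1
      rw [show (0 : ℝ × ℝ) = (0, 0) from rfl, hV0] at h1
      rw [himg]
      exact ⟨fun hL => (pos_iff_pos_of_mul_pos h1 |>.not.1 (h2.1 hL).le.not_gt |>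
        fun h3 => (not_lt.1 h3).lt_of_ne (right_ne_zero_of_mul h1.ne')),
        fun hL => (pos_iff_pos_of_mul_pos h1).1 (h2.2 hL)⟩) hmax
  have hpart := partition_descends (Φ := Φ) hc₀ hγ.smooth hsmooth₁ hγ.periodic hinj₁ hf₀
    (fun i s hs => by rw [himg] at hs ⊢; exact (e2 i s).1 hs)
    (fun i s => by
      have := (e2 i s).2
      rw [himg]
      rwa [hG0] at this)
  have hopen : IsOpen (discTube Y c (ρ / 2)) := isOpen_iUnion fun i =>
    h.tube.isOpen_image i (isOpen_lt ((continuous_snd.sub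
      ((hcs i).continuous.comp continuous_fst)).norm) continuous_const)
      fun p hp => (hdisc i p hp).trans hρρ
  refine ⟨discTube Y c (ρ / 2), Φ, V θ, ?_, ?_,
    isDiffeoOn_discTube h.tube hcs hcper hcR h2 hη, ?_, ⟨hVθ.contDiffOn, ?_⟩, ?_, hpart.1,
    hpart.2.1, hpart.2.2, htypes.1, htypes.2.1, htypes.2.2, ?_⟩
  · simpa only [h.core] using htub
  · rintro ξ hξ
    obtain ⟨i, p, hp, rfl⟩ := mem_iUnion.1 hξ
    exact h.mem_positiveTimes i p ((hdisc i p hp).trans hρρ)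
  · refine crNorm_lt hε₁ fun ξ hξ k hk => ?_
    have hEq : (fun ξ => Φ ξ - ξ) =ᶠ[𝓝 ξ] tubeDesc Y ρ₀ fun i p =>
        Y i (p.1, η * p.2 + d i (θ, p.1)) - Y i p := by
      filter_upwards [hopen.mem_nhds hξ] with ξ' hξ'
      obtain ⟨i, p, hp, rfl⟩ := mem_iUnion.1 hξ'
      have hp' := (hdisc i p hp).trans hρρ
      rw [hΦY i p hp', h.tube.tubeDesc_apply
        (fun i s ζ n => by simp only [hdper, h.tube.periodic]) i hp']
    rw [(EventuallyEq.iteratedFDeriv ℝ hEq k).eq_of_nhds]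
    obtain ⟨i, p, hp, rfl⟩ := mem_iUnion.1 hξ
    refine hsmall (y := ((ε, θ), p.2)) ?_ i p.1 k hk
    rw [dist_zero_right]
    exact max_lt (max_lt hε hθδ) ((hdisc i p hp).trans hρδ)
  · rintro ξ hξ
    obtain ⟨i, p, hp, rfl⟩ := mem_iUnion.1 hξ
    exact sub_eq_zero.1 (hheat i p (hdisc i p hp))
  · ext ξ
    constructor
    · rintro ⟨hξ, hξc⟩
      obtain ⟨i, p, hp, rfl⟩ := mem_iUnion.1 hξ
      have e := ((hcrit i p.1).2.2.2 p.2 ((hdisc i p hp).trans hρr)).1 hξc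
      refine ⟨γ i p.1, mem_iUnion.2 ⟨i, mem_range_self _⟩, ?_⟩
      have := congrFun (himg i) p.1
      simp only [imageLink, hG, ← e] at this
      exact this
    · rintro ⟨ξ, hξ, rfl⟩
      obtain ⟨i, s, rfl⟩ := mem_iUnion.1 hξ
      refine ⟨?_, hcritG i s⟩
      have := congrFun (himg i) s
      simp only [imageLink] at this
      rw [this]
      exact mem_iUnion.2 ⟨i, _, hmem0 i s, rfl⟩
  · rintro _ ⟨ξ, hξ, rfl⟩
    obtain ⟨i, s, rfl⟩ := mem_iUnion.1 hξ
    exact rank_stabilityMatrix (hjet i s).ne'
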